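/- There is an absolute constant $c>0$ such that for every $n\ge 3$, every graph $G$ on $n$ vertices with minimum degree at least $n/2$ and every integer $b$ with $1\le b\le cn/\log n$, Maker has a winning strategy in the $(1:b)$ Maker–Breaker Hamiltonicity game on $G$, no matter which player moves first. Here the two players alternately claim previously unclaimed edges of $G$, Maker one edge and Breaker $b$ edges in each turn (all remaining edges if fewer than $b$ are left), until every edge is claimed, and Maker wins if the edges claimed by Maker contain the edge set of a Hamilton cycle of $G$; $\log$ is the natural logarithm. Consequently the critical bias is of order $n/\log n$: there are absolute constants $c_1,c_2>0$ and $n_0$ such that for every $n\ge n_0$, every graph $G$ on $n$ vertices with minimum degree at least $n/2$ and either choice of the player who moves first, the maximum $b_0$ of all integers $b\ge 0$ for which Maker has a winning strategy in the $(1:b)$ Hamiltonicity game on $G$ exists and satisfies $c_1 n/\log n\le b_0\le c_2 n/\log n$. -/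

import Mathlib

namespace MakerBreaker

/-- The two players of a Maker–Breaker game. -/
inductive Player
  | maker
  | breaker

section Game

variable {α : Type*} [DecidableEq α]

/-- The unoccupied elements of the board, when Maker occupies `M` and Breaker occupies `B`. -/
def free (board M B : Finset α) : Finset α := board \ (M ∪ B)

/-- A (history dependent) strategy of Maker: it looks at the list of all moves made so far by both
players (latest move first, each move being the set of elements claimed in it) and names the
element which Maker claims next. -/
abbrev Strategy (α : Type*) := List (Finset α) → α

/-- The partial plays of the `(1 : b)` game on `board`, started by `first`, in which Maker follows
`σ`. `Play board b σ first p h M B` says: such a play can reach the position in which `h` is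
the list of the moves made so far (latest first), player `p` is the next to move, and `M`, `B` are
the sets of elements occupied by Maker and by Breaker. In his turn Maker claims one free element;
Breaker claims `b` free elements, or all of them if fewer than `b` are left. Nobody moves when the
board is full. -/
inductive Play (board : Finset α) (b : ℕ) (σ : Strategy α) (first : Player) :
    Player → List (Finset α) → Finset α → Finset α → Prop
  | start : Play board b σ first first [] ∅ ∅
  | maker_move {h : List (Finset α)} {M B : Finset α} :
      Play board b σ first Player.maker h M B →
      (free board M B).Nonempty →
      Play board b σ first Player.breaker ({σ h} :: h) (insert (σ h) M) B
  | breaker_move {h : List (Finset α)} {M B : Finset α} (S : Finset α) :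
      Play board b σ first Player.breaker h M B →
      (free board M B).Nonempty →
      S ⊆ free board M B →
      S.card = min b (free board M B).card →
      Play board b σ first Player.maker (S :: h) M (B ∪ S)

/-- `σ` is a winning strategy of Maker: it always tells Maker to claim a free element, and whenever
the board is full, Maker's elements contain one of the winning sets. (Every play ends, since each
move of Maker occupies a new element.) -/
structure IsWinningStrategy (board : Finset α) (winningSets : Set (Finset α)) (b : ℕ)
    (first : Player) (σ : Strategy α) : Prop where
  legal : ∀ (h : List (Finset α)) (M B : Finset α),
    Play board b σ first Player.maker h M B → (free board M B).Nonempty → σ h ∈ free board M B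
  wins : ∀ (p : Player) (h : List (Finset α)) (M B : Finset α),
    Play board b σ first p h M B → free board M B = ∅ → ∃ A ∈ winningSets, A ⊆ M

/-- Maker has a winning strategy in the `(1 : b)` Maker–Breaker game with the given board and
winning sets, when `first` makes the first move. -/
def MakerWins (board : Finset α) (winningSets : Set (Finset α)) (b : ℕ) (first : Player) : Prop :=
  ∃ σ : Strategy α, IsWinningStrategy board winningSets b first σ

end Game

/-- The edge sets of the Hamilton cycles of `G`. -/
def hamiltonCycles {V : Type*} [DecidableEq V] (G : SimpleGraph V) : Set (Finset (Sym2 V)) :=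
  {A | ∃ (v : V) (p : G.Walk v v), p.IsHamiltonianCycle ∧ A = p.edges.toFinset}

/-- Maker has a winning strategy in the `(1 : b)` Hamiltonicity game on `G`: the board is the edge
set of `G`, and the winning sets are the edge sets of the Hamilton cycles of `G`. -/
def MakerWinsHamiltonicity {V : Type*} [Fintype V] [DecidableEq V] (G : SimpleGraph V)
    [DecidableRel G.Adj] (b : ℕ) (first : Player) : Prop :=
  MakerWins G.edgeFinset (hamiltonCycles G) b first

/-- `b₀` is the critical bias of the Hamiltonicity game on `G`: the maximum `b` such that Maker
wins the `(1 : b)` game. -/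
def IsCriticalBias {V : Type*} [Fintype V] [DecidableEq V] (G : SimpleGraph V)
    [DecidableRel G.Adj] (first : Player) (b₀ : ℕ) : Prop :=
  IsGreatest {b : ℕ | MakerWinsHamiltonicity G b first} b₀

end MakerBreaker

/-! Maker plays in two phases. In the first, a potential argument of Erdős–Selfridge type
(`exists_potential_le`) lets her meet, within `O(n log n)` moves, every member of a light family of
edge sets, that is, one with `∑ exp (-(C log n / n) |A|) ≤ 1/2`. For example, `n ^ m` sets of at
least order `m n` edges each are light. In the second phase each of her edges lowers an integer
which is at most `n` at the beginning and vanishes only for Hamiltonian graphs. If at every time `ε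
n²` edges of `G` would lower it, one of these boosters is free, since both players together have
claimed only `O(b n log n) < ε n²` edges. So it suffices that `G` is `Robust`, meaning that hitting
some light family guarantees this many boosters (`makerWins_of_robust`).

The integer is the deficit of a `Frame`: the least number of edges that Maker's graph `H` lacks of a
Hamilton cycle of the complete graph with prescribed forced edges and admissible other edges.
Deleting a missing edge from an optimal cycle leaves a Hamilton path lacking fewer edges than the
deficit. Rotations along edges of `H` preserve this property, and adding the pair of ends to `H`
lowers the deficit. Hitting a light family makes small sets expand, and Pósa's lemma then gives
quadratically many such pairs of ends. The difficulty is that boosters must be edges of `G`, which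
may contain only about half of all pairs. There are three cases.

If `G` has a sparse balanced cut, it is close to two cliques: two disjoint crossing edges are
forced, and the rest of the cycle stays within the sides, where almost all pairs are edges
(`robust_of_sparse_cut`). If some cut has almost `n² / 4` edges, `G` is almost complete bipartite: a
matching inside the larger side is forced to make up for the difference in size, and the rest of the
cycle crosses (`robust_of_large_cut`).

Otherwise rotations reach `(1/2 + γ) n` ends, so that the minimum degree provides boosters
(`robust_of_no_extremal_cut`). To see this, rotate as long as a score bounded by `n²` can be raised
by order `n`. This takes `O(n)` rotations, so only `n ^ O(n)` families of paths can arise, whatever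
Maker's graph is. The sets of improving edges that have order `n²` elements thus form a light
family, and once they are hit, the process stops only when few edges of `G` improve the score. If
there are fewer ends than claimed, the neighbourhood of a typical end is almost determined by the
order of the vertices along one path. Symmetry of adjacency then makes a set of about `n / 2` ends
almost complete or almost independent, which gives an extremal cut (`sparse_or_large_cut`).

For the upper bound, Breaker isolates a vertex by a box game strategy (`boxInvariant_step`). -/

open Finset

namespace MakerBreaker

/-! ### Maker's strategies from invariants -/

section Positional

variable {α : Type*} [DecidableEq α]

/-- The position reached after a list of moves: the player to move, and the elements occupied by
Maker and by Breaker. -/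
def decode (first : Player) : List (Finset α) → Player × Finset α × Finset α
  | [] => (first, ∅, ∅)
  | S :: h =>
    match decode first h with
    | (Player.maker, M, B) => (Player.breaker, S ∪ M, B)
    | (Player.breaker, M, B) => (Player.maker, M, B ∪ S)

lemma Play.decode_eq {board : Finset α} {b : ℕ} {σ : Strategy α} {first p : Player}
    {h : List (Finset α)} {M B : Finset α} (hp : Play board b σ first p h M B) :
    decode first h = (p, M, B) := by
  induction hp with
  | start => rfl
  | maker_move _ _ ih => simp only [decode, ih]; rfl
  | breaker_move S _ _ _ _ ih => simp [decode, ih]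

/-- Maker wins if she can maintain an invariant of the positions in which she is to move. -/
lemma makerWins_of_invariant [Nonempty α] {board : Finset α} {W : Set (Finset α)} {b : ℕ} {first : Player}
    (Inv : Finset α → Finset α → Prop)
    (h0 : ∀ S ⊆ board, S.card ≤ b → Inv ∅ S)
    (step : ∀ M B, Inv M B → (free board M B).Nonempty →
      ∃ e ∈ free board M B, ∀ S ⊆ free board (insert e M) B, S.card ≤ b →
        Inv (insert e M) (B ∪ S))
    (win : ∀ M B, Inv M B → free board M B = ∅ → ∃ A ∈ W, A ⊆ M) :
    MakerWins board W b first := by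
  classical
  choose! f hf hf' using step
  let σ : Strategy α := fun h => f (decode first h).2.1 (decode first h).2.2
  have main : ∀ (p : Player) (h : List (Finset α)) (M B : Finset α),
      Play board b σ first p h M B →
      (p = Player.maker → Inv M B) ∧
      (p = Player.breaker → ∀ S ⊆ free board M B, S.card ≤ b → Inv M (B ∪ S)) := by
    intro p h M B hp
    induction hp with
    | start =>
      -- Both first players are covered: `S = ∅` if Maker begins, and Breaker's opening move
      -- otherwise.
      refine ⟨fun _ => h0 ∅ (empty_subset _) (by simp), fun _ S hS hb => ?_⟩
      rw [empty_union]
      exact h0 S (hS.trans sdiff_subset) hb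
    | @maker_move h M B hp hn ih =>
      refine ⟨by simp, fun _ => ?_⟩
      have hσ : σ h = f M B := by simp only [σ, hp.decode_eq]
      rw [hσ]
      exact hf' M B (ih.1 rfl) hn
    | @breaker_move h M B S hp hn hS hc ih =>
      refine ⟨fun _ => ih.2 rfl S hS (hc ▸ min_le_left _ _), by simp⟩
  refine ⟨σ, fun h M B hp hn => ?_, fun p h M B hp he => ?_⟩
  · have hσ : σ h = f M B := by simp only [σ, hp.decode_eq]
    rw [hσ]
    exact hf M B ((main _ _ _ _ hp).1 rfl) hn
  · cases p with
    | maker => exact win M B ((main _ _ _ _ hp).1 rfl) he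
    | breaker =>
      have := (main _ _ _ _ hp).2 rfl ∅ (empty_subset _) (by simp)
      rw [union_empty] at this
      exact win M B this he

end Positional

/-! ### Hitting a light family quickly by a potential -/

section Hitting

variable {α : Type*} [DecidableEq α]

/-- The potential of a position for the player who wants to hit all members of `F`. -/
noncomputable def potential (F : Finset (Finset α)) (η θ lam : ℝ) (M B : Finset α) : ℝ :=
  ∑ A ∈ F with Disjoint A M,
    Real.exp (-η * A.card + θ * A.card * M.card + lam * (A ∩ B).card)

lemma exp_le_one_add_two_mul {x : ℝ} (h0 : 0 ≤ x) (h1 : x ≤ 1) : Real.exp x ≤ 1 + 2 * x := by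
  have h := Real.abs_exp_sub_one_sub_id_le (x := x) (by rwa [abs_of_nonneg h0])
  have h2 := (abs_le.1 h).2
  nlinarith

/-- Maker takes a free element of largest load, the total weight of the unhit sets through it. As
the potential is below `1`, at least half of each unhit set is free, so averaging gives a load of at
least `R / (2N)`, where `R` is the weighted total size of the unhit sets and `N` the size of the
board. The weight she removes pays for Breaker's `b` elements, which cost at most half the load, and
for the growth of the clock term `θ |A| |M|`, which costs at most the other half. -/
lemma exists_potential_le {board : Finset α} {F : Finset (Finset α)} (hF : ∀ A ∈ F, A ⊆ board)
    {b : ℕ} (hb : 1 ≤ b) {η : ℝ} (hη : η ≤ 1 / (8 * b)) {M B : Finset α}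
    (hpot : potential F η (1 / (24 * board.card)) (1 / (4 * b)) M B < 1)
    (hfree : (free board M B).Nonempty) :
    ∃ e ∈ free board M B, ∀ S ⊆ free board (insert e M) B, S.card ≤ b →
      potential F η (1 / (24 * board.card)) (1 / (4 * b)) (insert e M) (B ∪ S) ≤
        potential F η (1 / (24 * board.card)) (1 / (4 * b)) M B := by
  classical
  have hbpos : (0 : ℝ) < b := by exact_mod_cast hb
  set N : ℝ := (board.card : ℝ) with hN
  have hNpos : 0 < N := by
    have : (free board M B) ⊆ board := sdiff_subset
    have := (hfree.mono this).card_pos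
    rw [hN]; exact_mod_cast this
  set θ : ℝ := 1 / (24 * N) with hθ
  set lam : ℝ := 1 / (4 * b) with hlam
  have hθpos : 0 < θ := by positivity
  have hlampos : 0 < lam := by positivity
  set w : Finset α → ℝ := fun A =>
    Real.exp (-η * A.card + θ * A.card * M.card + lam * (A ∩ B).card) with hw
  have hwpos : ∀ A, 0 < w A := fun A => Real.exp_pos _
  set U := F.filter (fun A => Disjoint A M) with hU
  have hP : potential F η θ lam M B = ∑ A ∈ U, w A := rfl
  set load : α → ℝ := fun e => ∑ A ∈ U with e ∈ A, w A with hload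
  obtain ⟨e, he, hmax⟩ := exists_max_image (free board M B) load hfree
  refine ⟨e, he, fun S hS hSb => ?_⟩
  have heM : e ∉ M := by
    have := he; simp only [free, mem_sdiff, mem_union, not_or] at this; exact this.2.1
  -- every unhit set has many free elements
  have hhalf : ∀ A ∈ U, (A.card : ℝ) / 2 ≤ (A ∩ free board M B).card := by
    intro A hA
    have hAF : A ∈ F ∧ Disjoint A M := by simpa [hU] using hA
    have h1 : w A < 1 := lt_of_le_of_lt
      (single_le_sum (f := w) (fun A _ => (hwpos A).le) hA) (hP ▸ hpot)
    have h2 : -η * A.card + θ * A.card * M.card + lam * (A ∩ B).card < 0 := by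
      have := Real.exp_lt_one_iff.1 h1
      exact this
    have h3 : η ≤ lam / 2 := by
      refine hη.trans (le_of_eq ?_); rw [hlam]; field_simp; norm_num
    have h4 : lam * (A ∩ B).card ≤ lam * (A.card / 2) := by
      have : 0 ≤ θ * A.card * M.card := by positivity
      have : η * A.card ≤ lam / 2 * A.card := by gcongr
      nlinarith
    have h5 := le_of_mul_le_mul_left h4 hlampos
    have h6 : A ∩ free board M B = A \ B := by
      ext x
      simp only [free, mem_inter, mem_sdiff, mem_union, not_or]
      constructor
      · rintro ⟨h, _, _, h'⟩; exact ⟨h, h'⟩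
      · rintro ⟨h, h'⟩
        exact ⟨h, hF A hAF.1 h, fun hM => (disjoint_left.1 hAF.2 h hM), h'⟩
    have h7 : (A \ B).card + (A ∩ B).card = A.card := card_sdiff_add_card_inter A B
    have h8 : ((A \ B).card : ℝ) + (A ∩ B).card = A.card := by exact_mod_cast h7
    rw [h6]; linarith
  set R := ∑ A ∈ U, w A * A.card with hR
  have hRnn : 0 ≤ R := sum_nonneg fun A _ => mul_nonneg (hwpos A).le (by positivity)
  have hdc : ∀ T : Finset α, ∑ f ∈ T, load f = ∑ A ∈ U, w A * (A ∩ T).card := by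
    intro T
    simp only [hload, sum_filter]
    rw [sum_comm]
    refine sum_congr rfl fun A _ => ?_
    rw [← sum_filter, sum_const, nsmul_eq_mul, mul_comm, inter_comm, filter_mem_eq_inter]
  have hL : R / 2 ≤ N * load e := by
    have h1 : ∑ f ∈ free board M B, load f ≤ (free board M B).card * load e := by
      rw [← nsmul_eq_mul]; exact sum_le_card_nsmul _ _ _ hmax
    have hle : 0 ≤ load e := sum_nonneg fun A _ => (hwpos A).le
    have h2 : ((free board M B).card : ℝ) * load e ≤ N * load e := by
      gcongr
      rw [hN]
      exact_mod_cast card_le_card (sdiff_subset : free board M B ⊆ board)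
    rw [hdc] at h1
    have h3 : R / 2 ≤ ∑ A ∈ U, w A * (A ∩ free board M B).card := by
      rw [hR, sum_div]
      refine sum_le_sum fun A hA => ?_
      have := mul_le_mul_of_nonneg_left (hhalf A hA) (hwpos A).le
      linarith
    linarith
  have hSload : ∑ A ∈ U, w A * (A ∩ S).card ≤ b * load e := by
    rw [← hdc]
    have hle : 0 ≤ load e := sum_nonneg fun A _ => (hwpos A).le
    calc ∑ f ∈ S, load f ≤ S.card * load e := by
          rw [← nsmul_eq_mul]
          refine sum_le_card_nsmul _ _ _ fun f hf => hmax f ?_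
          have := hS hf
          simp only [free, mem_sdiff, mem_union, mem_insert, not_or] at this ⊢
          exact ⟨this.1, this.2.1.2, this.2.2⟩
      _ ≤ b * load e := by gcongr
  -- the new potential
  have hnew : potential F η θ lam (insert e M) (B ∪ S) ≤
      ∑ A ∈ U with e ∉ A, w A * (1 + 3 * (θ * A.card) + 2 * (lam * (A ∩ S).card)) := by
    have hfil : F.filter (fun A => Disjoint A (insert e M)) = U.filter (fun A => e ∉ A) := by
      ext A
      simp only [hU, mem_filter, disjoint_insert_right]
      tauto
    unfold potential
    rw [hfil]
    refine sum_le_sum fun A hA => ?_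
    have hAF : A ∈ F := by simp only [hU, mem_filter] at hA; exact hA.1.1
    rw [card_insert_of_notMem heM]
    have hinter : ((A ∩ (B ∪ S)).card : ℝ) ≤ (A ∩ B).card + (A ∩ S).card := by
      rw [inter_union_distrib_left]; exact_mod_cast card_union_le _ _
    have hAN : (A.card : ℝ) ≤ N := by rw [hN]; exact_mod_cast card_le_card (hF A hAF)
    have hASb : ((A ∩ S).card : ℝ) ≤ b := by
      exact_mod_cast (card_le_card inter_subset_right).trans hSb
    have ha1 : θ * A.card ≤ 1 := by
      rw [hθ, one_div, inv_mul_le_iff₀ (by positivity)]; nlinarith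
    have hc1 : lam * (A ∩ S).card ≤ 1 / 4 := by
      rw [hlam, one_div, inv_mul_le_iff₀ (by positivity)]; nlinarith
    have ha0 : 0 ≤ θ * A.card := by positivity
    have hc0 : 0 ≤ lam * (A ∩ S).card := by positivity
    calc Real.exp (-η * A.card + θ * A.card * ((M.card + 1 : ℕ) : ℝ) + lam * (A ∩ (B ∪ S)).card)
        ≤ Real.exp ((-η * A.card + θ * A.card * M.card + lam * (A ∩ B).card) + θ * A.card
            + lam * (A ∩ S).card) := by
          apply Real.exp_le_exp.2
          push_cast
          nlinarith [mul_le_mul_of_nonneg_left hinter hlampos.le]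
      _ = w A * (Real.exp (θ * A.card) * Real.exp (lam * (A ∩ S).card)) := by
          rw [Real.exp_add, Real.exp_add, mul_assoc]
      _ ≤ w A * ((1 + 2 * (θ * A.card)) * (1 + 2 * (lam * (A ∩ S).card))) := by
          refine mul_le_mul_of_nonneg_left ?_ (hwpos A).le
          exact mul_le_mul (exp_le_one_add_two_mul ha0 ha1)
            (exp_le_one_add_two_mul hc0 (by linarith)) (Real.exp_pos _).le (by linarith)
      -- The cross term `4xy`, with `x = θ |A|` and `y = lam |A ∩ S|`, is at most `x` because `y ≤
      -- 1/4`.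
      _ ≤ w A * (1 + 3 * (θ * A.card) + 2 * (lam * (A ∩ S).card)) := by
          refine mul_le_mul_of_nonneg_left ?_ (hwpos A).le
          nlinarith
  have hsplit : ∑ A ∈ U with e ∉ A, w A = (∑ A ∈ U, w A) - load e := by
    rw [eq_sub_iff_add_eq, hload, add_comm]
    exact sum_filter_add_sum_filter_not U (fun A => e ∈ A) w
  have hexp : ∑ A ∈ U with e ∉ A, w A * (1 + 3 * (θ * A.card) + 2 * (lam * (A ∩ S).card)) ≤
      (∑ A ∈ U, w A) - load e + 3 * θ * R + 2 * lam * (b * load e) := by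
    calc _ = ∑ A ∈ U with e ∉ A, w A + ∑ A ∈ U with e ∉ A,
          (3 * θ * (w A * A.card) + 2 * lam * (w A * (A ∩ S).card)) := by
          rw [← sum_add_distrib]; refine sum_congr rfl fun A _ => by ring
      _ ≤ ((∑ A ∈ U, w A) - load e) + ∑ A ∈ U,
          (3 * θ * (w A * A.card) + 2 * lam * (w A * (A ∩ S).card)) := by
          rw [hsplit]
          refine add_le_add_right (sum_le_sum_of_subset_of_nonneg (filter_subset _ _) ?_) _
          intro A _ _
          have := (hwpos A).le
          positivity
      _ ≤ _ := by
          rw [sum_add_distrib, ← mul_sum, ← mul_sum, ← hR]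
          have := mul_le_mul_of_nonneg_left hSload (by positivity : 0 ≤ 2 * lam)
          linarith
  have hlb : 2 * lam * (b * load e) = load e / 2 := by
    rw [hlam]; field_simp; norm_num
  have hθR : 3 * θ * R ≤ load e / 2 := by
    have h1 : 3 * θ * R = R / 2 * (1 / (4 * N)) := by rw [hθ]; field_simp; ring
    have h2 : R / 2 * (1 / (4 * N)) ≤ N * load e * (1 / (4 * N)) := by gcongr
    have h3 : N * load e * (1 / (4 * N)) = load e / 4 := by field_simp
    have hle : 0 ≤ load e := sum_nonneg fun A _ => (hwpos A).le
    linarith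
  rw [hP]
  linarith

/-- The term `θ |A| |M|` is a clock: once `θ |M|` reaches `η`, a single unhit set would weigh at
least `1`. -/
lemma hits_of_potential_lt_one {F : Finset (Finset α)} {η θ lam : ℝ} (hlam : 0 ≤ lam)
    {M B : Finset α} (hpot : potential F η θ lam M B < 1) (ht : η ≤ θ * M.card) :
    ∀ A ∈ F, (A ∩ M).Nonempty := by
  intro A hA
  by_contra hn
  rw [not_nonempty_iff_eq_empty, ← disjoint_iff_inter_eq_empty] at hn
  have h1 : Real.exp (-η * A.card + θ * A.card * M.card + lam * (A ∩ B).card) < 1 :=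
    lt_of_le_of_lt (single_le_sum
      (f := fun A : Finset α => Real.exp (-η * A.card + θ * A.card * M.card + lam * (A ∩ B).card))
      (fun A _ => (Real.exp_pos _).le) (mem_filter.2 ⟨hA, hn⟩)) hpot
  have h2 := Real.exp_lt_one_iff.1 h1
  have : 0 ≤ lam * (A ∩ B).card := by positivity
  have : η * A.card ≤ θ * M.card * A.card := by gcongr
  nlinarith

/-- An opening move of Breaker costs a factor of at most `exp (1/4) ≤ 3/2`. -/
lemma potential_empty_lt_one {F : Finset (Finset α)} {η θ : ℝ} {b : ℕ} (hb : 1 ≤ b)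
    (hF : ∑ A ∈ F, Real.exp (-η * A.card) ≤ 1 / 2) {S : Finset α} (hS : S.card ≤ b) :
    potential F η θ (1 / (4 * b)) ∅ S < 1 := by
  have hbpos : (0 : ℝ) < b := by exact_mod_cast hb
  have hterm : ∀ A ∈ F.filter (fun A => Disjoint A ∅),
      Real.exp (-η * A.card + θ * A.card * (∅ : Finset α).card + 1 / (4 * b) * (A ∩ S).card) ≤
        (3 / 2) * Real.exp (-η * A.card) := by
    intro A _
    have h1 : ((A ∩ S).card : ℝ) ≤ b := by
      exact_mod_cast (card_le_card inter_subset_right).trans hS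
    have h2 : 1 / (4 * b) * ((A ∩ S).card : ℝ) ≤ 1 / 4 := by
      rw [one_div, inv_mul_le_iff₀ (by positivity)]; nlinarith
    have h3 := exp_le_one_add_two_mul (x := 1 / (4 * b) * ((A ∩ S).card : ℝ)) (by positivity)
      (by linarith)
    rw [card_empty, Nat.cast_zero, mul_zero, add_zero, Real.exp_add, mul_comm]
    gcongr
    linarith
  calc potential F η θ (1 / (4 * b)) ∅ S
      ≤ ∑ A ∈ F.filter (fun A => Disjoint A ∅), (3 / 2) * Real.exp (-η * A.card) :=
        sum_le_sum hterm
    _ = 3 / 2 * ∑ A ∈ F, Real.exp (-η * A.card) := by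
        rw [← mul_sum]; simp
    _ < 1 := by linarith

end Hitting

/-! ### Robust graphs: Maker hits a family, then claims boosters -/

section Robust

variable {n : ℕ} (G : SimpleGraph (Fin n)) [DecidableRel G.Adj]

/-- The graphs `H` between `M` and `G` are measured by `t`: measure zero means Hamiltonian, and
otherwise many edges of `G` decrease the measure. -/
def IsBoosterMeasure (ε : ℝ) (M : Finset (Sym2 (Fin n))) (t : Finset (Sym2 (Fin n)) → ℕ) : Prop :=
  t M ≤ n ∧ ∀ H, M ⊆ H → H ⊆ G.edgeFinset →
    (t H = 0 → ∃ A ∈ hamiltonCycles G, A ⊆ H) ∧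
    (0 < t H → ε * n ^ 2 ≤ (G.edgeFinset.filter fun e => t (insert e H) < t H).card)

/-- A graph is robust when hitting some light family of edge sets yields a booster measure. -/
def Robust (C ε : ℝ) : Prop :=
  ε * n ^ 2 ≤ G.edgeFinset.card ∧
  ∃ F : Finset (Finset (Sym2 (Fin n))), (∀ A ∈ F, A ⊆ G.edgeFinset) ∧
    ∑ A ∈ F, Real.exp (-(C * Real.log n / n) * A.card) ≤ 1 / 2 ∧
    ∀ M ⊆ G.edgeFinset, (∀ A ∈ F, (A ∩ M).Nonempty) → ∃ t, IsBoosterMeasure G ε M t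

lemma card_edgeFinset_le : (G.edgeFinset.card : ℝ) ≤ n ^ 2 / 2 := by
  have h := G.card_edgeFinset_le_card_choose_two
  rw [Fintype.card_fin] at h
  calc (G.edgeFinset.card : ℝ) ≤ (n.choose 2 : ℕ) := by exact_mod_cast h
    _ ≤ n ^ 2 / 2 := by
        rw [Nat.cast_choose_two]
        have : (0 : ℝ) ≤ n := by positivity
        nlinarith

lemma inter_free_nonempty_of_card_lt {α : Type*} [DecidableEq α] {board M B X : Finset α}
    (hX : X ⊆ board) (h : M.card + B.card < X.card) : (X ∩ free board M B).Nonempty := by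
  have h1 : (M ∪ B).card < X.card := (card_union_le _ _).trans_lt h
  obtain ⟨x, hx, hx'⟩ := exists_mem_notMem_of_card_lt_card h1
  exact ⟨x, mem_inter.2 ⟨hx, mem_sdiff.2 ⟨hX hx, hx'⟩⟩⟩

/-- Maker spends at most `T` moves, with `T = O(n log n)`, on hitting the family and at most `n` on
boosters. All that time fewer than `ε n²` edges are claimed, so some booster is free; nor can the
board fill up too early, as it has at least `ε n²` edges. -/
theorem makerWins_of_robust {C ε : ℝ} (hC : 0 < C) (hε : 0 < ε) (hn : 3 ≤ n)
    (hG : Robust G C ε) {b : ℕ} (hb : 1 ≤ b)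
    (hbC : (b : ℝ) * (8 * C * Real.log n) ≤ n)
    (hbε : (b : ℝ) * ((24 * C + 8) * Real.log n) < ε * n) (first : Player) :
    MakerWinsHamiltonicity G b first := by
  classical
  obtain ⟨hεN, F, hFE, hFsum, hF⟩ := hG
  have hn3 : (3 : ℝ) ≤ n := by exact_mod_cast hn
  have hnpos : (0 : ℝ) < n := by linarith
  have hlog : 1 ≤ Real.log n := by
    rw [Real.le_log_iff_exp_le hnpos]
    exact (Real.exp_one_lt_d9.le.trans (by norm_num)).trans hn3
  have hb1 : (1 : ℝ) ≤ b := by exact_mod_cast hb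
  set η : ℝ := C * Real.log n / n with hη
  have hηpos : 0 < η := by positivity
  have hηb : η ≤ 1 / (8 * b) := by
    rw [hη, div_le_div_iff₀ hnpos (by positivity)]; nlinarith
  set E := G.edgeFinset with hE
  have hNpos : (0 : ℝ) < E.card := lt_of_lt_of_le (by positivity) hεN
  set θ : ℝ := 1 / (24 * E.card) with hθ
  -- The number of moves after which the clock `θ |M|` has reached `η`.
  set T : ℕ := ⌈24 * E.card * η⌉₊ with hT
  have hTθ : η ≤ θ * T := by
    have h1 : 24 * E.card * η ≤ T := Nat.le_ceil _
    rw [hθ, one_div, ← div_eq_inv_mul, le_div_iff₀ (by positivity)]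
    linarith
  have hTpos : 0 < T := Nat.ceil_pos.2 (by positivity)
  have hTle : (T : ℝ) + n + 1 ≤ (12 * C + 4) * (n * Real.log n) := by
    have h1 : (T : ℝ) < 24 * E.card * η + 1 := Nat.ceil_lt_add_one (by positivity)
    have h2 : 24 * (E.card : ℝ) * η ≤ 24 * (n ^ 2 / 2) * η := by
      gcongr; exact card_edgeFinset_le G
    have h3 : 24 * ((n : ℝ) ^ 2 / 2) * η = 12 * C * (n * Real.log n) := by
      rw [hη]; field_simp; ring
    have h4 : (n : ℝ) ≤ n * Real.log n := by nlinarith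
    nlinarith
  have hcount : ∀ M B : Finset (Sym2 (Fin n)), M.card ≤ T + n → B.card ≤ b * (M.card + 1) →
      ((M.card + B.card : ℕ) : ℝ) < ε * n ^ 2 := by
    intro M B hM hB
    have h1 : ((M.card + B.card : ℕ) : ℝ) ≤ (T + n + 1) * (2 * b) := by
      have : M.card + B.card ≤ (T + n + 1) * (2 * b) := by
        calc M.card + B.card ≤ (T + n) + b * (T + n + 1) := by gcongr; exact hB.trans (by gcongr)
          _ ≤ (T + n + 1) * (2 * b) := by nlinarith
      exact_mod_cast this
    calc ((M.card + B.card : ℕ) : ℝ) ≤ (T + n + 1) * (2 * b) := h1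
      _ ≤ (12 * C + 4) * (n * Real.log n) * (2 * b) := by gcongr
      _ = (b * ((24 * C + 8) * Real.log n)) * n := by ring
      _ < ε * n * n := by gcongr
      _ = ε * n ^ 2 := by ring
  let Ham : Finset (Sym2 (Fin n)) → Prop := fun M => ∃ A ∈ hamiltonCycles G, A ⊆ M
  -- The alternatives are: done, hitting, boosting. In the last one `t M + |M|` never increases,
  -- which bounds the length of the phase.
  let Inv : Finset (Sym2 (Fin n)) → Finset (Sym2 (Fin n)) → Prop := fun M B =>
    M ⊆ E ∧ (Ham M ∨ (B.card ≤ b * (M.card + 1) ∧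
      ((M.card < T ∧ potential F η θ (1 / (4 * b)) M B < 1) ∨
        ∃ M₀ t, M₀ ⊆ M ∧ IsBoosterMeasure G ε M₀ t ∧ t M + M.card ≤ n + T)))
  have hcardB : ∀ (M B S : Finset (Sym2 (Fin n))) (e : Sym2 (Fin n)), e ∉ M →
      B.card ≤ b * (M.card + 1) → S.card ≤ b → (B ∪ S).card ≤ b * ((insert e M).card + 1) := by
    intro M B S e he hB hS
    rw [card_insert_of_notMem he]
    calc (B ∪ S).card ≤ B.card + S.card := card_union_le _ _
      _ ≤ b * (M.card + 1) + b := by gcongr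
      _ = _ := by ring
  have hfreeE : ∀ {M B : Finset (Sym2 (Fin n))} {e}, e ∈ free E M B → e ∈ E ∧ e ∉ M ∧ e ∉ B := by
    intro M B e he
    simpa [free, mem_sdiff, mem_union, not_or] using he
  have : Nonempty (Sym2 (Fin n)) := ⟨s(⟨0, by omega⟩, ⟨0, by omega⟩)⟩
  refine makerWins_of_invariant Inv ?_ ?_ ?_
  · intro S _ hSb
    refine ⟨empty_subset _, Or.inr ⟨by simpa using hSb, Or.inl ⟨by simpa using hTpos, ?_⟩⟩⟩
    exact potential_empty_lt_one hb hFsum hSb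
  · rintro M B ⟨hME, hM⟩ hfree
    rcases hM with hM | ⟨hB, ⟨hMT, hpot⟩ | ⟨M₀, t, hM₀, ht, htn⟩⟩
    · obtain ⟨e, he⟩ := hfree
      refine ⟨e, he, fun S _ _ => ⟨insert_subset (hfreeE he).1 hME, Or.inl ?_⟩⟩
      obtain ⟨A, hA, hAM⟩ := hM
      exact ⟨A, hA, hAM.trans (subset_insert _ _)⟩
    · obtain ⟨e, he, hstep⟩ := exists_potential_le hFE hb hηb hpot hfree
      refine ⟨e, he, fun S hS hSb => ⟨insert_subset (hfreeE he).1 hME, Or.inr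
        ⟨hcardB M B S e (hfreeE he).2.1 hB hSb, ?_⟩⟩⟩
      have hpot' := lt_of_le_of_lt (hstep S hS hSb) hpot
      have hcard := card_insert_of_notMem (hfreeE he).2.1
      by_cases hlt : (insert e M).card < T
      · exact Or.inl ⟨hlt, hpot'⟩
      · right
        have hceq : (insert e M).card = T := by omega
        have hhits := hits_of_potential_lt_one (by positivity) hpot' (hceq ▸ hTθ)
        obtain ⟨t, ht⟩ := hF _ (insert_subset (hfreeE he).1 hME) hhits
        exact ⟨_, t, Subset.rfl, ht, by rw [hceq]; exact Nat.add_le_add_right ht.1 _⟩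
    · have hprop := ht.2 M hM₀ hME
      rcases Nat.eq_zero_or_pos (t M) with h0 | h0
      · obtain ⟨e, he⟩ := hfree
        refine ⟨e, he, fun S _ _ => ⟨insert_subset (hfreeE he).1 hME, Or.inl ?_⟩⟩
        obtain ⟨A, hA, hAM⟩ := hprop.1 h0
        exact ⟨A, hA, hAM.trans (subset_insert _ _)⟩
      · have hboost := hprop.2 h0
        have hlt : M.card + B.card < (E.filter fun e => t (insert e M) < t M).card := by
          have := (hcount M B (by omega) hB).trans_le hboost
          exact_mod_cast this
        obtain ⟨e, he⟩ := inter_free_nonempty_of_card_lt (filter_subset _ _) hlt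
        rw [mem_inter, mem_filter] at he
        refine ⟨e, he.2, fun S _ hSb => ⟨insert_subset he.1.1 hME, Or.inr
          ⟨hcardB M B S e (hfreeE he.2).2.1 hB hSb, Or.inr
            ⟨M₀, t, hM₀.trans (subset_insert _ _), ht, ?_⟩⟩⟩⟩
        rw [card_insert_of_notMem (hfreeE he.2).2.1]
        have := he.1.2
        omega
  · rintro M B ⟨hME, hM⟩ hfull
    by_contra hnot
    have hEle : E.card ≤ M.card + B.card := by
      by_contra hlt
      obtain ⟨e, he⟩ := inter_free_nonempty_of_card_lt (Subset.refl E) (not_le.1 hlt)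
      rw [hfull, inter_empty] at he
      exact absurd he (notMem_empty _)
    have hEle' : (E.card : ℝ) ≤ ((M.card + B.card : ℕ) : ℝ) := by exact_mod_cast hEle
    rcases hM with hM | ⟨hB, ⟨hMT, _⟩ | ⟨M₀, t, hM₀, ht, htn⟩⟩
    · exact hnot hM
    · have := hcount M B (by omega) hB
      linarith
    · have := hcount M B (by omega) hB
      linarith

end Robust

/-! ### Breaker's strategies from invariants -/

section BreakerStrategy

variable {α : Type*} [DecidableEq α]

/-- Maker does not win if Breaker can maintain an invariant of the positions in which he is to
move, such that no winning set is claimed at the end. -/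
lemma not_makerWins_of_invariant {board : Finset α} {W : Set (Finset α)} {b : ℕ} {first : Player}
    (J : Finset α → Finset α → Prop) (hboard : board.Nonempty)
    (h0 : J ∅ ∅) (h1 : ∀ e ∈ board, J {e} ∅)
    (lose : ∀ M B, J M B → ∀ A ∈ W, ¬ A ⊆ M)
    (step : ∀ M B, J M B → (free board M B).Nonempty →
      ∃ S ⊆ free board M B, S.card = min b (free board M B).card ∧
        ∀ e ∈ free board M (B ∪ S), J (insert e M) (B ∪ S)) :
    ¬ MakerWins board W b first := by
  rintro ⟨σ, hσ⟩
  have key : ∀ k : ℕ, ∀ h M B, (free board M B).card = k →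
      Play board b σ first Player.breaker h M B → ¬ J M B := by
    intro k
    induction k using Nat.strong_induction_on with
    | _ k ih =>
      intro h M B hk hp hJ
      by_cases hf : (free board M B).Nonempty
      · obtain ⟨S, hS, hSc, hS'⟩ := step M B hJ hf
        have hp' := Play.breaker_move S hp hf hS hSc
        by_cases hf' : (free board M (B ∪ S)).Nonempty
        · have hleg := hσ.legal _ _ _ hp' hf'
          refine ih _ ?_ _ _ _ rfl (Play.maker_move hp' hf') (hS' _ hleg)
          rw [← hk]
          refine card_lt_card ((ssubset_iff_of_subset ?_).2 ⟨σ (S :: h), ?_, ?_⟩)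
          · intro x hx
            simp only [free, mem_sdiff, mem_union, mem_insert, not_or] at hx ⊢
            tauto
          · simp only [free, mem_sdiff, mem_union, not_or] at hleg ⊢
            tauto
          · simp [free]
        · obtain ⟨A, hA, hAM⟩ := hσ.wins _ _ _ _ hp' (not_nonempty_iff_eq_empty.1 hf')
          exact lose M B hJ A hA hAM
      · obtain ⟨A, hA, hAM⟩ := hσ.wins _ _ _ _ hp (not_nonempty_iff_eq_empty.1 hf)
        exact lose M B hJ A hA hAM
  cases first with
  | breaker => exact key _ _ _ _ rfl Play.start h0
  | maker =>
    have hp : Play board b σ Player.maker Player.maker [] ∅ ∅ := Play.start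
    have hf : (free board ∅ ∅).Nonempty := by simpa [free] using hboard
    have hleg := hσ.legal _ _ _ hp hf
    have hJ := h1 (σ []) (by simpa [free] using hleg)
    rw [← insert_empty_eq] at hJ
    exact key _ _ _ _ rfl (Play.maker_move hp hf) hJ

end BreakerStrategy

/-! ### Upper bound: Breaker isolates a vertex -/

section UpperBound

variable {n : ℕ} (G : SimpleGraph (Fin n))

lemma exists_mem_of_mem_hamiltonCycles {A : Finset (Sym2 (Fin n))} (hA : A ∈ hamiltonCycles G)
    (v : Fin n) : ∃ e ∈ A, v ∈ e := by
  obtain ⟨u, p, hp, rfl⟩ := hA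
  have hv : v ∈ p.support := hp.mem_support v
  have hnil : ¬ p.Nil := hp.isCycle.not_nil
  obtain ⟨e, he, hve⟩ := (SimpleGraph.Walk.mem_support_iff_exists_mem_edges_of_not_nil hnil).1 hv
  exact ⟨e, by simpa using he, hve⟩

variable [DecidableRel G.Adj]

/-- The free edges at a vertex. -/
def freeAt (M B : Finset (Sym2 (Fin n))) (v : Fin n) : Finset (Sym2 (Fin n)) :=
  (free G.edgeFinset M B).filter fun e => v ∈ e

/-- Some set of vertices is untouched by Maker, and has few free edges at each vertex. -/
def BoxInvariant (b : ℕ) (M B : Finset (Sym2 (Fin n))) : Prop :=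
  ∃ U : Finset (Fin n), U.Nonempty ∧ U.card ≤ b ∧ (∀ v ∈ U, ∀ e ∈ M, v ∉ e) ∧
    ∀ v ∈ U, ((freeAt G M B v).card : ℝ) ≤ b / 8 * Real.log U.card

lemma card_filter_mem_sym2_le (U : Finset (Fin n)) (e : Sym2 (Fin n)) :
    U.card ≤ (U.filter fun v => v ∉ e).card + 2 := by
  induction e with
  | _ x y =>
    have : U ⊆ (U.filter fun v => v ∉ s(x, y)) ∪ {x, y} := by
      intro v hv
      simp only [mem_union, mem_filter, Sym2.mem_iff, mem_insert, mem_singleton]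
      tauto
    calc U.card ≤ _ := card_le_card this
      _ ≤ _ := (card_union_le _ _).trans (Nat.add_le_add_left card_le_two _)

lemma log_sub_log_sub_two {j : ℕ} (hj : 5 ≤ j) :
    Real.log j - Real.log (j - 2 : ℕ) ≤ 4 / j := by
  have h2 : 2 ≤ j := by omega
  have hj' : (5 : ℝ) ≤ j := by exact_mod_cast hj
  rw [Nat.cast_sub h2, Nat.cast_ofNat, ← Real.log_div (by linarith) (by linarith)]
  refine (Real.log_le_sub_one_of_pos (div_pos (by linarith) (by linarith))).trans ?_
  rw [div_sub_one (by linarith), div_le_div_iff₀ (by linarith) (by linarith)]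
  nlinarith

/-- A box game with the free edges at the `j` vertices of `U` as boxes. Breaker claims `⌊b / j⌋`
edges from each box, or the whole box if it is smaller. Maker's reply spoils at most two boxes, and
the allowed size `(b / 8) log j` then drops by at most `b / (2j) ≤ ⌊b / j⌋`. When `j < 5`, a whole
box fits into one turn. -/
lemma boxInvariant_step {b : ℕ} {M B : Finset (Sym2 (Fin n))} (hJ : BoxInvariant G b M B) :
    ∃ S ⊆ free G.edgeFinset M B, S.card = min b (free G.edgeFinset M B).card ∧
      ∀ e ∈ free G.edgeFinset M (B ∪ S), BoxInvariant G b (insert e M) (B ∪ S) := by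
  obtain ⟨U, hUne, hUb, hUM, hU⟩ := hJ
  have hjpos := hUne.card_pos
  have hb1 : 1 ≤ b := hjpos.trans_le hUb
  have hb0 : (0 : ℝ) < b := by exact_mod_cast hb1
  set E := G.edgeFinset
  have hfsub : ∀ v, freeAt G M B v ⊆ free E M B := fun v => filter_subset _ _
  have hext : ∀ S₀ ⊆ free E M B, S₀.card ≤ b →
      ∃ S, S₀ ⊆ S ∧ S ⊆ free E M B ∧ S.card = min b (free E M B).card := by
    intro S₀ h h'
    obtain ⟨S, h1, h2, h3⟩ := exists_subsuperset_card_eq h (le_min h' (card_le_card h))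
      (min_le_right _ _)
    exact ⟨S, h1, h2, h3⟩
  rcases Nat.lt_or_ge U.card 5 with hj | hj
  · obtain ⟨v, hv⟩ := hUne
    have hle : (freeAt G M B v).card ≤ b := by
      have h1 := hU v hv
      have h2 : Real.log U.card ≤ 8 := by
        have : (U.card : ℝ) ≤ 5 := by exact_mod_cast hj.le
        have h3 := Real.log_le_sub_one_of_pos (x := (U.card : ℝ)) (by exact_mod_cast hjpos)
        linarith
      have h3 : (b : ℝ) / 8 * Real.log U.card ≤ b / 8 * 8 := by gcongr
      have : ((freeAt G M B v).card : ℝ) ≤ b := by linarith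
      exact_mod_cast this
    obtain ⟨S, hS0, hS, hSc⟩ := hext _ (hfsub v) hle
    refine ⟨S, hS, hSc, fun e he => ⟨{v}, singleton_nonempty v, by simpa using hb1, ?_, ?_⟩⟩
    · intro w hw e' he'
      rw [mem_singleton] at hw; subst hw
      rcases mem_insert.1 he' with rfl | he'
      · intro hve
        simp only [free, mem_sdiff, mem_union, not_or] at he
        exact he.2.2.2 (hS0 (mem_filter.2 ⟨mem_sdiff.2 ⟨he.1, by simp [he]⟩, hve⟩))
      · exact hUM w hv e' he'
    · intro w hw
      rw [mem_singleton] at hw; subst hw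
      -- As `log 1 = 0`, the invariant for a singleton demands that no free edge is left.
      have : freeAt G (insert e M) (B ∪ S) w = ∅ := by
        refine eq_empty_of_forall_notMem fun f hf => ?_
        simp only [freeAt, free, mem_filter, mem_sdiff, mem_union, mem_insert, not_or] at hf
        exact hf.1.2.2.2 (hS0 (by simp [freeAt, free, hf]))
      rw [this]; simp
  · set q := b / U.card with hq
    have hch : ∀ v, ∃ S ⊆ freeAt G M B v, S.card = min q (freeAt G M B v).card := fun v =>
      exists_subset_card_eq (min_le_right _ _)
    choose f hf hfc using hch
    obtain ⟨S, hS0, hS, hSc⟩ := hext (U.biUnion f)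
      (biUnion_subset.2 fun v _ => (hf v).trans (hfsub v))
      (calc (U.biUnion f).card ≤ U.card * q :=
            card_biUnion_le_card_mul _ _ _ fun v _ => (hfc v).le.trans (min_le_left _ _)
        _ ≤ b := Nat.mul_div_le b U.card)
    refine ⟨S, hS, hSc, fun e he => ?_⟩
    have hU' : U.card - 2 ≤ (U.filter fun v => v ∉ e).card := by
      have := card_filter_mem_sym2_le U e; omega
    obtain ⟨U', hU'sub, hU'c⟩ := exists_subset_card_eq hU'
    have hU'U : U' ⊆ U := hU'sub.trans (filter_subset _ _)
    refine ⟨U', card_pos.1 (by omega), by omega, ?_, ?_⟩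
    · intro w hw e' he'
      rcases mem_insert.1 he' with rfl | he'
      · exact (mem_filter.1 (hU'sub hw)).2
      · exact hUM w (hU'U hw) e' he'
    · intro w hw
      have h1 : freeAt G (insert e M) (B ∪ S) w ⊆ freeAt G M B w \ f w := by
        intro x hx
        simp only [freeAt, free, mem_filter, mem_sdiff, mem_union, mem_insert, not_or] at hx ⊢
        refine ⟨⟨⟨hx.1.1, hx.1.2.1.2, hx.1.2.2.1⟩, hx.2⟩, fun hxf => hx.1.2.2.2 ?_⟩
        exact hS0 (mem_biUnion.2 ⟨w, hU'U hw, hxf⟩)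
      have h2 : (freeAt G (insert e M) (B ∪ S) w).card ≤ (freeAt G M B w).card - q := by
        refine (card_le_card h1).trans ?_
        rw [card_sdiff_of_subset (hf w), hfc w]; omega
      rw [hU'c]
      have hlog0 : 0 ≤ Real.log (U.card - 2 : ℕ) := Real.log_natCast_nonneg _
      rcases Nat.le_total (freeAt G M B w).card q with hle | hle
      · have : (freeAt G (insert e M) (B ∪ S) w).card = 0 := by omega
        rw [this]; simp only [Nat.cast_zero]; positivity
      · have h3 : ((freeAt G (insert e M) (B ∪ S) w).card : ℝ) ≤ (freeAt G M B w).card - q := by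
          have h4 : (freeAt G (insert e M) (B ∪ S) w).card + q ≤ (freeAt G M B w).card := by omega
          have : ((freeAt G (insert e M) (B ∪ S) w).card : ℝ) + q ≤ (freeAt G M B w).card := by
            exact_mod_cast h4
          linarith
        have hjr : (5 : ℝ) ≤ U.card := by exact_mod_cast hj
        have hq2 : (b : ℝ) / (2 * U.card) ≤ q := by
          have hq1 : 1 ≤ q := (Nat.one_le_div_iff hjpos).2 hUb
          have h5 : b < U.card * q + U.card := by
            have := Nat.div_add_mod b U.card
            have h6 := Nat.mod_lt b hjpos
            rw [hq]; omega
          have h6 : b ≤ q * (2 * U.card) := by nlinarith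
          rw [div_le_iff₀ (by positivity)]
          exact_mod_cast h6
        have h7 := hU w (hU'U hw)
        have h8 := log_sub_log_sub_two hj
        have h9 : (b : ℝ) / 8 * (Real.log U.card - Real.log (U.card - 2 : ℕ)) ≤
            b / 8 * (4 / U.card) := by gcongr
        have h10 : (b : ℝ) / 8 * (4 / U.card) = b / (2 * U.card) := by field_simp; norm_num
        rw [mul_sub] at h9
        linarith

lemma card_freeAt_empty_le (M : Finset (Sym2 (Fin n))) (v : Fin n) :
    (freeAt G M ∅ v).card ≤ n := by
  calc (freeAt G M ∅ v).card ≤ (univ.image fun w : Fin n => s(v, w)).card := by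
        refine card_le_card fun e he => ?_
        obtain ⟨w, rfl⟩ := (mem_filter.1 he).2
        exact mem_image_of_mem _ (mem_univ w)
    _ ≤ n := card_image_le.trans (by simp)

/-- The two spare vertices allow for an opening edge of Maker. -/
lemma boxInvariant_start {b j : ℕ} (hj : 1 ≤ j) (hjb : j ≤ b) (hjn : j + 2 ≤ n)
    (hlog : (n : ℝ) ≤ b / 8 * Real.log j) (M : Finset (Sym2 (Fin n))) (hM : M.card ≤ 1) :
    BoxInvariant G b M ∅ := by
  have hU : ∃ U : Finset (Fin n), U.card = j ∧ ∀ v ∈ U, ∀ e ∈ M, v ∉ e := by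
    rcases M.eq_empty_or_nonempty with rfl | ⟨e, he⟩
    · obtain ⟨U, _, hU⟩ := exists_subset_card_eq (s := (univ : Finset (Fin n))) (n := j)
        (by simp; omega)
      exact ⟨U, hU, by simp⟩
    · have h1 := card_filter_mem_sym2_le (univ : Finset (Fin n)) e
      obtain ⟨U, hUs, hU⟩ := exists_subset_card_eq (s := univ.filter fun v : Fin n => v ∉ e) (n := j)
        (by rw [card_univ, Fintype.card_fin] at h1; omega)
      refine ⟨U, hU, fun v hv e' he' => ?_⟩
      rw [card_le_one.1 hM e' he' e he]
      exact (mem_filter.1 (hUs hv)).2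
  obtain ⟨U, hUc, hU⟩ := hU
  refine ⟨U, card_pos.1 (by omega), by omega, hU, fun v _ => ?_⟩
  rw [hUc]
  exact le_trans (by exact_mod_cast card_freeAt_empty_le G M v) hlog

lemma not_makerWinsHamiltonicity_of_log {b j : ℕ} (hj : 1 ≤ j) (hjb : j ≤ b) (hjn : j + 2 ≤ n)
    (hlog : (n : ℝ) ≤ b / 8 * Real.log j) (hE : G.edgeFinset.Nonempty) (first : Player) :
    ¬ MakerWinsHamiltonicity G b first := by
  refine not_makerWins_of_invariant (BoxInvariant G b) hE
    (boxInvariant_start G hj hjb hjn hlog _ (by simp))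
    (fun e _ => boxInvariant_start G hj hjb hjn hlog _ (by simp)) ?_
    (fun M B hJ _ => boxInvariant_step G hJ)
  rintro M B ⟨U, ⟨v, hv⟩, _, hUM, _⟩ A hA hAM
  obtain ⟨e, he, hve⟩ := exists_mem_of_mem_hamiltonCycles G hA v
  exact hUM v hv e (hAM he) hve

/-- Breaker wins with bias larger than `32 n / log n`. -/
theorem not_makerWinsHamiltonicity (hn : Real.exp 16 + 4 ≤ n) (hE : G.edgeFinset.Nonempty) {b : ℕ}
    (hb : 32 * n / Real.log n < b) (first : Player) : ¬ MakerWinsHamiltonicity G b first := by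
  have hexp := Real.exp_pos 16
  have hn4 : (4 : ℝ) ≤ n := by linarith
  have hn4' : 4 ≤ n := by exact_mod_cast hn4
  have hlogn : 16 ≤ Real.log n := (Real.le_log_iff_exp_le (by linarith)).2 (by linarith)
  have hb' : 32 * n < b * Real.log n := (div_lt_iff₀ (by linarith)).1 hb
  -- For small `b` take `j = b`: since `log n ≤ 2 √n`, the bias is at least `√n`, so `log b ≥ (log
  -- n) / 2`. Otherwise take `j = n - 2`.
  rcases Nat.lt_or_ge b (n - 2) with hbn | hbn
  · have hbpos : 0 < b := by
      rcases Nat.eq_zero_or_pos b with rfl | h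
      · simp at hb'; linarith
      · exact h
    refine not_makerWinsHamiltonicity_of_log G hbpos le_rfl (by omega) ?_ hE first
    have hs : Real.log n ≤ 2 * Real.sqrt n := by
      have h1 : Real.log n = 2 * Real.log (Real.sqrt n) := by
        rw [Real.log_sqrt (by linarith)]; ring
      have h2 := Real.log_le_sub_one_of_pos (x := Real.sqrt n) (Real.sqrt_pos.2 (by linarith))
      linarith
    have hsq : Real.sqrt n * Real.sqrt n = n := Real.mul_self_sqrt (by linarith)
    have hspos : 0 < Real.sqrt n := Real.sqrt_pos.2 (by linarith)
    have hbs : Real.sqrt n ≤ b := by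
      by_contra hlt
      rw [not_le] at hlt
      have : (b : ℝ) * Real.log n ≤ Real.sqrt n * (2 * Real.sqrt n) := by gcongr
      nlinarith
    have hlogb : Real.log n / 2 ≤ Real.log b := by
      rw [← Real.log_sqrt (by linarith)]
      exact Real.log_le_log hspos hbs
    have : (b : ℝ) / 8 * (Real.log n / 2) ≤ b / 8 * Real.log b := by gcongr
    nlinarith
  · refine not_makerWinsHamiltonicity_of_log G (j := n - 2) (by omega) hbn (by omega) ?_ hE first
    have hcast : ((n - 2 : ℕ) : ℝ) = n - 2 := by push_cast [Nat.cast_sub (by omega : 2 ≤ n)]; ring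
    have hlog : 16 ≤ Real.log (n - 2 : ℕ) := by
      rw [hcast]
      exact (Real.le_log_iff_exp_le (by linarith)).2 (by linarith)
    have hbr : (n : ℝ) - 2 ≤ b := by rw [← hcast]; exact_mod_cast hbn
    have : (b : ℝ) / 8 * 16 ≤ b / 8 * Real.log (n - 2 : ℕ) := by gcongr
    linarith

end UpperBound

/-! ### Rotations of paths and Pósa's lemma -/

section Rotation

variable {V : Type*}

/-- The edges between consecutive vertices of a list. -/
def edgesOf : List V → List (Sym2 V)
  | a :: b :: l => s(a, b) :: edgesOf (b :: l)
  | _ => []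

lemma edgesOf_append (X : List V) (u z : V) (Y : List V) :
    edgesOf (X ++ u :: z :: Y) = edgesOf (X ++ [u]) ++ s(u, z) :: edgesOf (z :: Y) := by
  induction X with
  | nil => simp [edgesOf]
  | cons a X ih =>
    cases X with
    | nil => simp [edgesOf]
    | cons b X => simp only [List.cons_append, edgesOf] at ih ⊢; rw [ih]

lemma edgesOf_reverse (P : List V) : edgesOf P.reverse = (edgesOf P).reverse := by
  induction P with
  | nil => rfl
  | cons a P ih =>
    cases P with
    | nil => rfl
    | cons b P =>
      rw [List.reverse_cons, List.reverse_cons, List.append_assoc, List.singleton_append,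
        edgesOf_append, ← List.reverse_cons, ih]
      simp [edgesOf, Sym2.eq_swap]

lemma mem_edgesOf_iff {P : List V} {e : Sym2 V} :
    e ∈ edgesOf P ↔ ∃ X a b Y, P = X ++ a :: b :: Y ∧ e = s(a, b) := by
  constructor
  · intro h
    induction P with
    | nil => simp [edgesOf] at h
    | cons a P ih =>
      cases P with
      | nil => simp [edgesOf] at h
      | cons b P =>
        rcases List.mem_cons.1 h with rfl | h
        · exact ⟨[], a, b, P, rfl, rfl⟩
        · obtain ⟨X, c, d, Y, hP, he⟩ := ih h
          exact ⟨a :: X, c, d, Y, by rw [hP]; rfl, he⟩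
  · rintro ⟨X, a, b, Y, rfl, rfl⟩
    rw [edgesOf_append]; simp

lemma length_edgesOf (P : List V) : (edgesOf P).length = P.length - 1 := by
  induction P with
  | nil => rfl
  | cons a P ih =>
    cases P with
    | nil => rfl
    | cons b P => simp [edgesOf, ih]

/-- Reverse the part of a list after position `j`. -/
def rot (j : ℕ) (P : List V) : List V := P.take (j + 1) ++ (P.drop (j + 1)).reverse

lemma rot_append (X : List V) (u : V) (Y : List V) :
    rot X.length (X ++ u :: Y) = X ++ u :: Y.reverse := by
  have h : X ++ u :: Y = (X ++ [u]) ++ Y := by simp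
  have hl : X.length + 1 = (X ++ [u]).length := by simp
  rw [rot, h, hl, List.take_left, List.drop_left]; simp

/-- The paths obtained from `P₀` by a sequence of rotations, each of an earlier path. The pair
`(i, j)` rotates the path number `i` at position `j`. -/
def eval (P₀ : List V) : List (ℕ × ℕ) → List (List V)
  | [] => [P₀]
  -- Paths are listed latest first, and the default `[]` is never met by valid sequences. Rotations
  -- are coded by numbers so that they can be counted.
  | (i, j) :: τ => rot j ((eval P₀ τ).getD i []) :: eval P₀ τ

/-- Every rotation is at a pivot to which the end of the path is related. -/
def Valid (R : V → V → Prop) (P₀ : List V) : List (ℕ × ℕ) → Prop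
  | [] => True
  | (i, j) :: τ => Valid R P₀ τ ∧ ∃ X u z Y y, (eval P₀ τ)[i]? = some (X ++ u :: z :: Y) ∧
      X.length = j ∧ (z :: Y).getLast? = some y ∧ R y u

lemma length_eval (P₀ : List V) (τ : List (ℕ × ℕ)) : (eval P₀ τ).length = τ.length + 1 := by
  induction τ with
  | nil => rfl
  | cons p τ ih => obtain ⟨i, j⟩ := p; simp [eval, ih]

lemma mem_eval_self (P₀ : List V) (τ : List (ℕ × ℕ)) : P₀ ∈ eval P₀ τ := by
  induction τ with
  | nil => simp [eval]
  | cons p τ ih => exact List.mem_cons_of_mem _ ih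

lemma eval_cons_of_valid {P₀ : List V} {τ : List (ℕ × ℕ)} {i : ℕ} {X : List V} {u z : V}
    {Y : List V} (h : (eval P₀ τ)[i]? = some (X ++ u :: z :: Y)) :
    eval P₀ ((i, X.length) :: τ) = (X ++ u :: (z :: Y).reverse) :: eval P₀ τ := by
  simp only [eval, List.getD_eq_getElem?_getD, h, Option.getD_some, rot_append]

lemma Valid.induction {R : V → V → Prop} {P₀ : List V} {Q : List V → Prop} (h0 : Q P₀)
    (hrot : ∀ X u z Y y, Q (X ++ u :: z :: Y) → (z :: Y).getLast? = some y → R y u →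
      Q (X ++ u :: (z :: Y).reverse)) {τ : List (ℕ × ℕ)} (hτ : Valid R P₀ τ) :
    ∀ P ∈ eval P₀ τ, Q P := by
  induction τ with
  | nil => simpa [eval] using h0
  | cons p τ ih =>
    obtain ⟨i, j⟩ := p
    obtain ⟨hv, X, u, z, Y, y, hi, rfl, hy, hR⟩ := hτ
    rw [eval_cons_of_valid hi]
    intro P hP
    rcases List.mem_cons.1 hP with rfl | hP
    · exact hrot X u z Y y (ih hv _ (List.mem_of_getElem? hi)) hy hR
    · exact ih hv P hP

lemma Valid.append {R : V → V → Prop} {P₀ : List V} {τ : List (ℕ × ℕ)} (hτ : Valid R P₀ τ)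
    {X : List V} {u z : V} {Y : List V} {y : V} (h : X ++ u :: z :: Y ∈ eval P₀ τ)
    (hy : (z :: Y).getLast? = some y) (hR : R y u) :
    ∃ i, Valid R P₀ ((i, X.length) :: τ) ∧ i < τ.length + 1 ∧
      eval P₀ ((i, X.length) :: τ) = (X ++ u :: (z :: Y).reverse) :: eval P₀ τ := by
  obtain ⟨i, hi⟩ := List.getElem?_of_mem h
  refine ⟨i, ⟨hτ, X, u, z, Y, y, hi, rfl, hy, hR⟩, ?_, eval_cons_of_valid hi⟩
  rw [← length_eval P₀]
  exact (List.getElem?_eq_some_iff.1 hi).1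

variable [DecidableEq V]

/-- The last vertices of a family of paths. -/
def ends (Ps : List (List V)) : Finset V := (Ps.filterMap List.getLast?).toFinset

lemma mem_ends {Ps : List (List V)} {v : V} :
    v ∈ ends Ps ↔ ∃ P ∈ Ps, P.getLast? = some v := by
  simp [ends, List.mem_filterMap]

lemma ends_cons_rot (X : List V) (u z : V) (Y : List V) (Ps : List (List V)) :
    ends ((X ++ u :: (z :: Y).reverse) :: Ps) = insert z (ends Ps) := by
  have : (X ++ u :: (z :: Y).reverse).getLast? = some z := by
    simp [List.getLast?_append, List.getLast?_cons]
  rw [ends, List.filterMap_cons_some this, List.toFinset_cons]; rfl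

/-- There is a sequence of rotations whose set of ends does not grow by two more rotations. -/
lemma exists_maximal_valid [Fintype V] (R : V → V → Prop) {P₀ : List V} :
    ∃ τ, Valid R P₀ τ ∧ τ.length ≤ 2 * (ends (eval P₀ τ)).card ∧
      ∀ σ, σ.length ≤ 2 → Valid R P₀ (σ ++ τ) →
        (ends (eval P₀ (σ ++ τ))).card ≤ (ends (eval P₀ τ)).card := by
  classical
  -- Maximise the number of ends among the sequences at most twice as long as that number; up to two
  -- further rotations that gain an end keep this bound.
  let p : ℕ → Prop := fun k => ∃ τ, Valid R P₀ τ ∧ τ.length ≤ 2 * (ends (eval P₀ τ)).card ∧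
      (ends (eval P₀ τ)).card = k
  have hbd : ∀ k, p k → k ≤ Fintype.card V := by
    rintro k ⟨τ, _, _, rfl⟩; exact card_le_univ _
  have hp : p (ends (eval P₀ [])).card := ⟨[], trivial, by simp, rfl⟩
  obtain ⟨τ, h1, h2, h3⟩ := Nat.findGreatest_spec (P := p) (hbd _ hp) hp
  refine ⟨τ, h1, h2, fun σ hσ hv => ?_⟩
  by_contra hlt
  rw [not_le] at hlt
  have hp' : p (ends (eval P₀ (σ ++ τ))).card :=
    ⟨σ ++ τ, hv, by rw [List.length_append]; omega, rfl⟩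
  have h4 := Nat.le_findGreatest (hbd _ hp') hp'
  omega

/-- The neighbours of `T` along `P`. -/
def pathNbrs [Fintype V] (P : List V) (T : Finset V) : Finset V :=
  univ.filter fun w => ∃ v ∈ T, s(w, v) ∈ edgesOf P

lemma idxOf_append_cons {X : List V} {a : V} {Y : List V} (h : (X ++ a :: Y).Nodup) :
    (X ++ a :: Y).idxOf a = X.length := by
  have ha : a ∉ X := fun haX => (List.nodup_append.1 h).2.2 a haX a (by simp) rfl
  rw [List.idxOf_append_of_notMem ha]; simp

lemma card_pathNbrs_le [Fintype V] {P : List V} (hP : P.Nodup) (T : Finset V) :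
    (pathNbrs P T).card ≤ 2 * T.card := by
  have hsub : pathNbrs P T ⊆ T.image (fun v => P.getD (P.idxOf v + 1) v) ∪
      T.image (fun v => P.getD (P.idxOf v - 1) v) := by
    intro w hw
    obtain ⟨v, hv, he⟩ := (mem_filter.1 hw).2
    obtain ⟨X, a, b, Y, hXY, hab⟩ := mem_edgesOf_iff.1 he
    have hb' : P.idxOf b = X.length + 1 := by
      have h1 : P = (X ++ [a]) ++ b :: Y := by simp [hXY]
      rw [h1, idxOf_append_cons (h1 ▸ hP)]; simp
    have ha' : P.idxOf a = X.length := by rw [hXY, idxOf_append_cons (hXY ▸ hP)]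
    rw [Sym2.eq_iff] at hab
    rcases hab with ⟨rfl, rfl⟩ | ⟨rfl, rfl⟩
    · refine mem_union_right _ (mem_image.2 ⟨v, hv, ?_⟩)
      rw [hb', hXY]; simp
    · refine mem_union_left _ (mem_image.2 ⟨v, hv, ?_⟩)
      rw [ha', hXY]; simp
  calc _ ≤ _ := card_le_card hsub
    _ ≤ T.card + T.card := (card_union_le _ _).trans (add_le_add card_image_le card_image_le)
    _ = _ := by ring

/-- A rotation trades an edge `uz` for `uy`, where `y` and `z` are ends. A vertex `w` outside `T`
differs from both, and `w = u` would, by induction, make `w` a neighbour of `z` on `P₀`. So the path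
edges at `w` never change. -/
lemma Valid.mem_edgesOf_iff [Fintype V] {R : V → V → Prop} {P₀ : List V} {τ : List (ℕ × ℕ)}
    (hτ : Valid R P₀ τ) {T : Finset V} (hT : ends (eval P₀ τ) ⊆ T) {w : V} (hw : w ∉ T)
    (hw' : w ∉ pathNbrs P₀ T) :
    ∀ P ∈ eval P₀ τ, ∀ v, s(w, v) ∈ edgesOf P ↔ s(w, v) ∈ edgesOf P₀ := by
  induction τ with
  | nil => simp [eval]
  | cons p τ ih =>
    obtain ⟨i, j⟩ := p
    obtain ⟨hv, X, u, z, Y, y, hi, rfl, hy, hR⟩ := hτ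
    rw [eval_cons_of_valid hi] at hT ⊢
    rw [ends_cons_rot, insert_subset_iff] at hT
    intro P hP v
    rcases List.mem_cons.1 hP with rfl | hP
    · have hmem := List.mem_of_getElem? hi
      have ih' := ih hv hT.2 _ hmem
      rw [← ih' v]
      obtain ⟨Y', hY'⟩ : ∃ Y', (z :: Y).reverse = y :: Y' := by
        rw [List.getLast?_eq_head?_reverse] at hy
        exact List.head?_eq_some_iff.1 hy
      have hyT : y ∈ T := hT.2 (mem_ends.2 ⟨_, hmem, by
        rw [List.getLast?_append, List.getLast?_cons_cons, hy]; rfl⟩)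
      rw [hY', edgesOf_append, edgesOf_append, ← hY', edgesOf_reverse]
      have hwy : w ≠ y := fun h => hw (h ▸ hyT)
      have hwz : w ≠ z := fun h => hw (h ▸ hT.1)
      have hwu : w ≠ u := by
        rintro rfl
        refine hw' (mem_filter.2 ⟨mem_univ _, z, hT.1, (ih' z).1 ?_⟩)
        rw [edgesOf_append]; simp
      simp only [List.mem_append, List.mem_cons, List.mem_reverse, Sym2.eq_iff]
      tauto
    · exact ih hv hT.2 P hP v

/-- Pósa's lemma: the pivots reachable from a closed set of ends are ends, or neighbours of ends
along the original path. -/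
lemma posa [Fintype V] {R : V → V → Prop} {P₀ : List V} (hfull : ∀ v, v ∈ P₀)
    {τ : List (ℕ × ℕ)} (hτ : Valid R P₀ τ)
    (hmax : ∀ i j, Valid R P₀ ((i, j) :: τ) →
      ends (eval P₀ ((i, j) :: τ)) ⊆ ends (eval P₀ τ)) {y u : V}
    (hy : y ∈ ends (eval P₀ τ)) (hR : R y u) :
    u ∈ ends (eval P₀ τ) ∪ pathNbrs P₀ (ends (eval P₀ τ)) := by
  by_contra hu
  rw [mem_union, not_or] at hu
  obtain ⟨P, hP, hPy⟩ := mem_ends.1 hy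
  have huP : u ∈ P := by
    refine Valid.induction (Q := fun P => u ∈ P) (hfull u) ?_ hτ P hP
    intro X u' z Y y h _ _
    simpa [or_assoc, or_comm, or_left_comm] using h
  obtain ⟨X, Y, rfl⟩ := List.append_of_mem huP
  cases Y with
  | nil =>
    simp only [List.getLast?_append, List.getLast?_singleton, Option.some_or,
      Option.some.injEq] at hPy
    exact hu.1 (hPy ▸ hy)
  | cons z Y =>
    have hlast : (z :: Y).getLast? = some y := by
      rw [List.getLast?_append, List.getLast?_cons_cons] at hPy
      rw [← hPy, List.getLast?_cons]; rfl
    -- Rotating at `u` makes its successor `z` an end. As the edges at `u` have not changed, `uz`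
    -- lies on `P₀`.
    obtain ⟨i, hv, _, he⟩ := hτ.append hP hlast hR
    have hz := hmax _ _ hv
    rw [he, ends_cons_rot, insert_subset_iff] at hz
    refine hu.2 (mem_filter.2 ⟨mem_univ _, z, hz.1,
      (hτ.mem_edgesOf_iff Subset.rfl hu.1 hu.2 _ hP z).1 ?_⟩)
    rw [edgesOf_append]; simp

end Rotation

/-! ### Frames and their deficit -/

section Frames

variable {V : Type*}

/-- The Hamilton cycles of a frame are those of the complete graph which contain the forced edges
and otherwise use admissible edges only. -/
structure Frame (V : Type*) where
  /-- The admissible edges. -/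
  adm : Set (Sym2 V)
  /-- The forced edges. -/
  forced : Finset (Sym2 V)
  -- Keeps the closing pair admissible under rotations. It holds for pairs within the sides of a
  -- partition, for pairs across it, and for all pairs.
  trans : ∀ a b c d, s(a, b) ∈ adm → s(b, c) ∈ adm → s(c, d) ∈ adm → s(a, d) ∈ adm

/-- The path `P` is obtained from a Hamilton cycle of the frame by deleting an edge which is not
forced. -/
structure Frame.IsPath (F : Frame V) (P : List V) : Prop where
  nodup : P.Nodup
  full : ∀ v, v ∈ P
  mem : ∀ e ∈ edgesOf P, e ∈ F.adm ∨ e ∈ F.forced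
  forced : ∀ e ∈ F.forced, e ∈ edgesOf P
  closing : ∀ x y, P.head? = some x → P.getLast? = some y → s(y, x) ∈ F.adm

lemma Frame.IsPath.reverse {F : Frame V} {P : List V} (h : F.IsPath P) : F.IsPath P.reverse where
  nodup := List.nodup_reverse.2 h.nodup
  full v := List.mem_reverse.2 (h.full v)
  mem e he := h.mem e (by rwa [edgesOf_reverse, List.mem_reverse] at he)
  forced e he := by rw [edgesOf_reverse, List.mem_reverse]; exact h.forced e he
  closing x y hx hy := by
    rw [List.head?_reverse] at hx
    rw [List.getLast?_reverse] at hy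
    rw [Sym2.eq_swap]; exact h.closing y x hy hx

/-- Rotations preserve the paths of a frame. -/
lemma Frame.IsPath.rotate {F : Frame V} {X : List V} {u z : V} {Y : List V} {y : V}
    (h : F.IsPath (X ++ u :: z :: Y)) (hy : (z :: Y).getLast? = some y) (hadm : s(y, u) ∈ F.adm)
    (hforced : ∀ e ∈ F.forced, u ∉ e) : F.IsPath (X ++ u :: (z :: Y).reverse) := by
  obtain ⟨Y', hY'⟩ : ∃ Y', (z :: Y).reverse = y :: Y' := by
    rw [List.getLast?_eq_head?_reverse] at hy
    exact List.head?_eq_some_iff.1 hy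
  have hedge : edgesOf (X ++ u :: (z :: Y).reverse) =
      edgesOf (X ++ [u]) ++ s(u, y) :: (edgesOf (z :: Y)).reverse := by
    rw [hY', edgesOf_append, ← hY', edgesOf_reverse]
  have hold : edgesOf (X ++ u :: z :: Y) = edgesOf (X ++ [u]) ++ s(u, z) :: edgesOf (z :: Y) :=
    edgesOf_append X u z Y
  have hperm : (X ++ u :: (z :: Y).reverse).Perm (X ++ u :: z :: Y) :=
    ((List.reverse_perm _).cons _).append_left _
  refine ⟨hperm.nodup_iff.2 h.nodup, fun v => hperm.mem_iff.2 (h.full v), ?_, ?_, ?_⟩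
  · intro e he
    rw [hedge] at he
    simp only [List.mem_append, List.mem_cons, List.mem_reverse] at he
    rcases he with he | rfl | he
    · exact h.mem e (by rw [hold]; simp [he])
    · left; rwa [Sym2.eq_swap]
    · exact h.mem e (by rw [hold]; simp [he])
  · intro e he
    have h1 := h.forced e he
    rw [hold] at h1
    rw [hedge]
    simp only [List.mem_append, List.mem_cons, List.mem_reverse] at h1 ⊢
    rcases h1 with h1 | rfl | h1
    · exact Or.inl h1
    · exact absurd (Sym2.mem_mk_left u z) (hforced _ he)
    · exact Or.inr (Or.inr h1)
  · intro x w hx hw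
    have hw' : z = w := by
      simpa [List.getLast?_append, List.getLast?_cons] using hw
    subst hw'
    have hx' : (X ++ u :: z :: Y).head? = some x := by
      cases X <;> simpa using hx
    have hlast : (X ++ u :: z :: Y).getLast? = some y := by
      rw [List.getLast?_append, List.getLast?_cons_cons, hy]; rfl
    have huz : s(u, z) ∈ F.adm := by
      rcases h.mem s(u, z) (by rw [hold]; simp) with h | h
      · exact h
      · exact absurd (Sym2.mem_mk_left u z) (hforced _ h)
    -- The new ends `z` and `x` are joined by the admissible pairs `zu`, `uy`, `yx`.
    refine F.trans z u y x (by rwa [Sym2.eq_swap]) (by rwa [Sym2.eq_swap]) ?_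
    exact h.closing x y hx' hlast

lemma exists_walk_of_edgesOf (G : SimpleGraph V) (l : List V) : ∀ a : V,
    (∀ e ∈ edgesOf (a :: l), e ∈ G.edgeSet) → ∃ b, (a :: l).getLast? = some b ∧
      ∃ p : G.Walk a b, p.support = a :: l ∧ p.edges = edgesOf (a :: l) := by
  induction l with
  | nil => exact fun a _ => ⟨a, rfl, SimpleGraph.Walk.nil, rfl, rfl⟩
  | cons c l ih =>
    intro a h
    obtain ⟨b, hb, p, hp, hp'⟩ := ih c fun e he => h e (List.mem_cons_of_mem _ he)
    have hac : G.Adj a c := h s(a, c) (by simp [edgesOf])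
    exact ⟨b, by rw [List.getLast?_cons_cons, hb], SimpleGraph.Walk.cons hac p, by simp [hp],
      by simp [hp', edgesOf]⟩

variable [DecidableEq V]

/-- The number of edges of a path which are missing in `H`. -/
def cost (H : Finset (Sym2 V)) (P : List V) : ℕ := (edgesOf P).countP (fun e => e ∉ H)

/-- The number of edges of a cycle which are missing in `H`. -/
def cycCost (H : Finset (Sym2 V)) (P : List V) : ℕ :=
  cost H P + match P.head?, P.getLast? with
    | some x, some y => if s(y, x) ∈ H then 0 else 1
    | _, _ => 0

/-- The least number of edges of a Hamilton cycle of the frame which are missing in `H`. -/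
noncomputable def Frame.deficit (F : Frame V) (H : Finset (Sym2 V)) : ℕ :=
  sInf {k | ∃ P, F.IsPath P ∧ cycCost H P = k}

/-- There is a path of the frame from `x` to `y` to which fewer edges than the deficit are
missing. -/
def Frame.Linked (F : Frame V) (H : Finset (Sym2 V)) (x y : V) : Prop :=
  ∃ P, F.IsPath P ∧ P.head? = some x ∧ P.getLast? = some y ∧ cost H P < F.deficit H

variable {F : Frame V} {H : Finset (Sym2 V)}

lemma cost_reverse (P : List V) : cost H P.reverse = cost H P := by
  rw [cost, edgesOf_reverse, List.countP_reverse, cost]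

lemma Frame.Linked.symm {x y : V} (h : F.Linked H x y) : F.Linked H y x := by
  obtain ⟨P, hP, hx, hy, hc⟩ := h
  exact ⟨P.reverse, hP.reverse, by rwa [List.head?_reverse], by rwa [List.getLast?_reverse],
    by rwa [cost_reverse]⟩

lemma cycCost_eq {P : List V} {x y : V} (hx : P.head? = some x) (hy : P.getLast? = some y) :
    cycCost H P = cost H P + if s(y, x) ∈ H then 0 else 1 := by
  rw [cycCost, hx, hy]

lemma deficit_le {P : List V} (hP : F.IsPath P) : F.deficit H ≤ cycCost H P :=
  Nat.sInf_le ⟨P, hP, rfl⟩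

lemma exists_cycCost_eq_deficit (hF : ∃ P, F.IsPath P) :
    ∃ P, F.IsPath P ∧ cycCost H P = F.deficit H := by
  obtain ⟨P, hP⟩ := hF
  exact Nat.sInf_mem (s := {k | ∃ P, F.IsPath P ∧ cycCost H P = k}) ⟨_, P, hP, rfl⟩

/-- The edge `uz` is replaced by `yu`, which is not missing. -/
lemma cost_rotate_le {X : List V} {u z : V} {Y : List V} {y : V}
    (hy : (z :: Y).getLast? = some y) (hH : s(y, u) ∈ H) :
    cost H (X ++ u :: (z :: Y).reverse) ≤ cost H (X ++ u :: z :: Y) := by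
  obtain ⟨Y', hY'⟩ : ∃ Y', (z :: Y).reverse = y :: Y' := by
    rw [List.getLast?_eq_head?_reverse] at hy
    exact List.head?_eq_some_iff.1 hy
  have hedge : edgesOf (X ++ u :: (z :: Y).reverse) =
      edgesOf (X ++ [u]) ++ s(u, y) :: (edgesOf (z :: Y)).reverse := by
    rw [hY', edgesOf_append, ← hY', edgesOf_reverse]
  rw [Sym2.eq_swap] at hH
  rw [cost, cost, hedge, edgesOf_append, List.countP_append, List.countP_append, List.countP_cons,
    List.countP_cons, List.countP_reverse]
  simp [hH]

/-- The new edge closes the path to a cycle lacking no more edges than the path did. -/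
lemma deficit_insert_lt {x y : V} (h : F.Linked H x y) :
    F.deficit (insert s(x, y) H) < F.deficit H := by
  obtain ⟨P, hP, hx, hy, hc⟩ := h
  refine (deficit_le hP).trans_lt (lt_of_le_of_lt ?_ hc)
  rw [cycCost_eq hx hy, if_pos (by rw [Sym2.eq_swap]; exact mem_insert_self _ _), add_zero]
  refine List.countP_mono_left fun e _ he => ?_
  simp only [decide_eq_true_eq, mem_insert, not_or] at he ⊢
  exact he.2

/-- An optimal cycle is opened at a missing edge. If this is the closing edge, the list serves as it
is; otherwise it is cut at the missing edge `ab` and its two pieces are exchanged. -/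
lemma exists_linked (hF : ∃ P, F.IsPath P) (hK : F.forced ⊆ H) (h0 : 0 < F.deficit H) :
    ∃ x y, F.Linked H x y := by
  obtain ⟨P, hP, hc⟩ := exists_cycCost_eq_deficit (H := H) hF
  rcases P.eq_nil_or_concat with rfl | ⟨Z, y, hPy⟩
  · simp [cycCost, cost, edgesOf] at hc; omega
  have hy : P.getLast? = some y := by rw [hPy]; simp
  obtain ⟨x, W, hPx⟩ : ∃ x W, P = x :: W := by
    cases P with
    | nil => simp at hy
    | cons x W => exact ⟨x, W, rfl⟩
  have hx : P.head? = some x := by rw [hPx]; rfl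
  rw [cycCost_eq hx hy] at hc
  by_cases hyx : s(y, x) ∈ H
  swap
  · rw [if_neg hyx] at hc
    exact ⟨x, y, P, hP, hx, hy, by omega⟩
  rw [if_pos hyx, add_zero] at hc
  obtain ⟨e, he, heH⟩ := List.countP_pos_iff.1 (hc ▸ h0 : 0 < cost H P)
  simp only [decide_eq_true_eq] at heH
  obtain ⟨X, a, b, Y, hXY, rfl⟩ := mem_edgesOf_iff.1 he
  have hold : edgesOf P = edgesOf (X ++ [a]) ++ s(a, b) :: edgesOf (b :: Y) := by
    rw [hXY, edgesOf_append]
  obtain ⟨Z', hZ'⟩ : ∃ Z', b :: Y = Z' ++ [y] := by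
    have : (b :: Y).getLast? = some y := by
      rw [← hy, hXY, List.getLast?_append, List.getLast?_cons_cons, List.getLast?_cons]; rfl
    exact List.getLast?_eq_some_iff.1 this
  obtain ⟨W', hW'⟩ : ∃ W', X ++ [a] = x :: W' := by
    have : (X ++ [a]).head? = some x := by
      rw [← hx, hXY]; cases X <;> rfl
    exact List.head?_eq_some_iff.1 this
  have hnew : edgesOf ((b :: Y) ++ (X ++ [a])) =
      edgesOf (b :: Y) ++ s(y, x) :: edgesOf (X ++ [a]) := by
    rw [hZ', hW', List.append_assoc, List.singleton_append, edgesOf_append]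
  have hperm : ((b :: Y) ++ (X ++ [a])).Perm P := by
    rw [hXY]
    refine List.perm_append_comm.trans ?_
    simp
  have hclos : s(y, x) ∈ F.adm := hP.closing x y hx hy
  have hab : s(a, b) ∈ F.adm := by
    rcases hP.mem _ he with h | h
    · exact h
    · exact absurd (hK h) heH
  refine ⟨b, a, (b :: Y) ++ (X ++ [a]), ⟨hperm.nodup_iff.2 hP.nodup,
    fun v => hperm.mem_iff.2 (hP.full v), ?_, ?_, ?_⟩, rfl, by simp [List.getLast?_append, List.getLast?_cons], ?_⟩
  · intro e he
    rw [hnew] at he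
    simp only [List.mem_append, List.mem_cons] at he
    rcases he with he | rfl | he
    · exact hP.mem e (by rw [hold]; simp [he])
    · exact Or.inl hclos
    · exact hP.mem e (by rw [hold]; simp only [List.mem_append]; exact Or.inl he)
  · intro e he
    have h1 := hP.forced e he
    rw [hold] at h1
    rw [hnew]
    simp only [List.mem_append, List.mem_cons] at h1 ⊢
    rcases h1 with h1 | rfl | h1
    · exact Or.inr (Or.inr h1)
    · exact absurd (hK he) heH
    · exact Or.inl h1
  · intro x' y' hx' hy'
    have h1 : b = x' := by simpa using hx'
    have h2 : a = y' := by simpa [List.getLast?_append, List.getLast?_cons] using hy'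
    rw [← h1, ← h2]; exact hab
  · have h1 : cost H ((b :: Y) ++ (X ++ [a])) + 1 = cost H P := by
      rw [cost, cost, hnew, hold, List.countP_append, List.countP_append, List.countP_cons,
        List.countP_cons]
      simp [hyx, heH]; omega
    omega

/-- If small sets expand, then every linked vertex is linked to many vertices. -/
lemma card_linked_of_expansion [Fintype V] (Γ : V → V → Prop)
    (hΓ : ∀ y u, Γ y u → s(y, u) ∈ F.adm ∧ ∀ e ∈ F.forced, u ∉ e) {k : ℕ}
    (hexp : ∀ U W : Finset V, U.Nonempty → U.card ≤ k → W.card ≤ 3 * U.card →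
      ∃ y ∈ U, ∃ u, u ∉ W ∧ Γ y u ∧ s(y, u) ∈ H) {x y : V} (h : F.Linked H x y)
    (T : Finset V) (hT : ∀ z, F.Linked H x z → z ∈ T) : k < T.card := by
  obtain ⟨P₀, hP₀, hx, hy, hc⟩ := h
  obtain ⟨τ, hτ, _, hmax⟩ := exists_maximal_valid (fun y u => Γ y u ∧ s(y, u) ∈ H) (P₀ := P₀)
  have hQ : ∀ P ∈ eval P₀ τ, F.IsPath P ∧ P.head? = some x ∧ cost H P < F.deficit H := by
    refine Valid.induction ⟨hP₀, hx, hc⟩ ?_ hτ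
    rintro X u z Y y ⟨h1, h2, h3⟩ hy ⟨hR1, hR2⟩
    refine ⟨h1.rotate hy (hΓ _ _ hR1).1 (hΓ _ _ hR1).2, ?_, (cost_rotate_le hy hR2).trans_lt h3⟩
    cases X <;> simpa using h2
  have hends : ends (eval P₀ τ) ⊆ T := by
    intro z hz
    obtain ⟨P, hP, hPz⟩ := mem_ends.1 hz
    obtain ⟨h1, h2, h3⟩ := hQ P hP
    exact hT z ⟨P, h1, h2, hPz, h3⟩
  refine lt_of_lt_of_le ?_ (card_le_card hends)
  by_contra hle
  rw [not_lt] at hle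
  have hmax' : ∀ i j, Valid (fun y u => Γ y u ∧ s(y, u) ∈ H) P₀ ((i, j) :: τ) →
      ends (eval P₀ ((i, j) :: τ)) ⊆ ends (eval P₀ τ) := by
    intro i j hv
    have h1 := hmax [(i, j)] (by simp) hv
    have h2 : ends (eval P₀ τ) ⊆ ends (eval P₀ ((i, j) :: τ)) := by
      intro v hv
      obtain ⟨P, hP, hPv⟩ := mem_ends.1 hv
      exact mem_ends.2 ⟨P, List.mem_cons_of_mem _ hP, hPv⟩
    exact (eq_of_subset_of_card_le h2 h1).ge
  have hne : (ends (eval P₀ τ)).Nonempty :=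
    ⟨y, mem_ends.2 ⟨P₀, mem_eval_self P₀ τ, hy⟩⟩
  -- Pósa's lemma confines the pivots to the ends and their neighbours on `P₀`, at most three times
  -- as many vertices as ends; expansion leads outside.
  obtain ⟨y', hy', u, hu, hR⟩ := hexp (ends (eval P₀ τ))
    (ends (eval P₀ τ) ∪ pathNbrs P₀ (ends (eval P₀ τ))) hne hle
    ((card_union_le _ _).trans (by have := card_pathNbrs_le hP₀.nodup (ends (eval P₀ τ)); omega))
  exact hu (posa hP₀.full hτ hmax' hy' hR)

end Frames

/-! ### Deficit zero gives a Hamilton cycle, linked pairs give boosters -/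

section HamiltonCycle

variable {V : Type*} [DecidableEq V]

/-- The ends have positions `0` and `|P| - 1`, which are not consecutive for three or more vertices.
-/
lemma closing_notMem_edgesOf {P : List V} (hP : P.Nodup) (hlen : 3 ≤ P.length) {x y : V}
    (hx : P.head? = some x) (hy : P.getLast? = some y) : s(y, x) ∉ edgesOf P := by
  intro h
  obtain ⟨X, a, b, Y, hXY, hab⟩ := mem_edgesOf_iff.1 h
  have hb' : P.idxOf b = X.length + 1 := by
    have h1 : P = (X ++ [a]) ++ b :: Y := by simp [hXY]
    rw [h1, idxOf_append_cons (h1 ▸ hP)]; simp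
  have ha' : P.idxOf a = X.length := by rw [hXY, idxOf_append_cons (hXY ▸ hP)]
  have hx' : P.idxOf x = 0 := by
    obtain ⟨W, rfl⟩ := List.head?_eq_some_iff.1 hx
    simp
  have hy' : P.idxOf y = P.length - 1 := by
    obtain ⟨W, rfl⟩ := List.getLast?_eq_some_iff.1 hy
    rw [idxOf_append_cons hP]; simp
  rw [Sym2.eq_iff] at hab
  rcases hab with ⟨rfl, rfl⟩ | ⟨rfl, rfl⟩ <;> omega

lemma exists_hamiltonCycle_of_deficit_eq_zero [Fintype V] (hn : 3 ≤ Fintype.card V)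
    {G : SimpleGraph V} [DecidableRel G.Adj] {F : Frame V} {H : Finset (Sym2 V)}
    (hF : ∃ P, F.IsPath P) (hH : H ⊆ G.edgeFinset) (h0 : F.deficit H = 0) :
    ∃ A ∈ hamiltonCycles G, A ⊆ H := by
  obtain ⟨P, hP, hc⟩ := exists_cycCost_eq_deficit (H := H) hF
  rw [h0] at hc
  have hlen : P.length = Fintype.card V := by
    rw [← List.toFinset_card_of_nodup hP.nodup, ← card_univ]
    congr 1
    exact eq_univ_of_forall fun v => List.mem_toFinset.2 (hP.full v)
  obtain ⟨x, W, rfl⟩ : ∃ x W, P = x :: W := by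
    cases P with
    | nil => simp at hlen; omega
    | cons x W => exact ⟨x, W, rfl⟩
  obtain ⟨y, hy⟩ : ∃ y, (x :: W).getLast? = some y := by
    rw [List.getLast?_cons]; exact ⟨_, rfl⟩
  rw [cycCost_eq rfl hy] at hc
  have hcl : s(y, x) ∈ H := by
    by_contra h
    rw [if_neg h] at hc; omega
  have hall : ∀ e ∈ edgesOf (x :: W), e ∈ H := by
    have : cost H (x :: W) = 0 := by omega
    rw [cost, List.countP_eq_zero] at this
    simpa using this
  obtain ⟨b, hb, p, hp, hp'⟩ := exists_walk_of_edgesOf G W x fun e he => by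
    simpa using hH (hall e he)
  rw [hy, Option.some.injEq] at hb
  subst hb
  have hadj : G.Adj y x := by simpa using hH hcl
  refine ⟨_, ⟨y, SimpleGraph.Walk.cons hadj p, ?_, rfl⟩, ?_⟩
  · rw [SimpleGraph.Walk.isHamiltonianCycle_iff_isCycle_and_support_count_tail_eq_one]
    refine ⟨?_, fun v => ?_⟩
    · rw [SimpleGraph.Walk.cons_isCycle_iff, SimpleGraph.Walk.isPath_def, hp, hp']
      exact ⟨hP.nodup, closing_notMem_edgesOf hP.nodup (by omega) rfl hy⟩
    · rw [SimpleGraph.Walk.support_cons, List.tail_cons, hp]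
      exact List.count_eq_one_of_mem hP.nodup (hP.full v)
  · intro e he
    rw [SimpleGraph.Walk.edges_cons, List.mem_toFinset, hp', List.mem_cons] at he
    rcases he with rfl | he
    · exact hcl
    · exact hall e he

lemma card_le_two_mul_card_image_sym2 (D : Finset (V × V)) :
    D.card ≤ 2 * (D.image fun p => s(p.1, p.2)).card := by
  refine card_le_mul_card_image D 2 fun e _ => ?_
  induction e with
  | _ a b =>
    calc (D.filter fun p => s(p.1, p.2) = s(a, b)).card
        ≤ ({(a, b), (b, a)} : Finset (V × V)).card := by
          refine card_le_card fun p hp => ?_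
          have := (mem_filter.1 hp).2
          rw [Sym2.eq_iff] at this
          simp only [mem_insert, mem_singleton, Prod.ext_iff]
          exact this
      _ ≤ 2 := card_le_two

/-- A frame is a booster measure if there are always many linked pairs of adjacent vertices. -/
lemma isBoosterMeasure_deficit {n : ℕ} (hn : 3 ≤ n) (G : SimpleGraph (Fin n))
    [DecidableRel G.Adj] {F : Frame (Fin n)} (hF : ∃ P, F.IsPath P) {ε : ℝ}
    {M : Finset (Sym2 (Fin n))} (hM : F.forced ⊆ M)
    (hlink : ∀ H, M ⊆ H → ∀ x y, F.Linked H x y → ∃ D : Finset (Fin n × Fin n),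
      (∀ p ∈ D, F.Linked H p.1 p.2 ∧ G.Adj p.1 p.2) ∧ 2 * ε * n ^ 2 ≤ D.card) :
    IsBoosterMeasure G ε M F.deficit := by
  refine ⟨?_, fun H hMH hHE => ⟨fun h0 => ?_, fun h0 => ?_⟩⟩
  · obtain ⟨P, hP⟩ := hF
    have hlen : P.length ≤ n := by
      simpa using hP.nodup.length_le_card
    have h1 : cost M P ≤ P.length - 1 := length_edgesOf P ▸ List.countP_le_length
    obtain ⟨x, W, rfl⟩ : ∃ x W, P = x :: W := by
      cases P with
      | nil => exact absurd (hP.full ⟨0, by omega⟩) (by simp)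
      | cons x W => exact ⟨x, W, rfl⟩
    obtain ⟨y, hy⟩ : ∃ y, (x :: W).getLast? = some y := by
      rw [List.getLast?_cons]; exact ⟨_, rfl⟩
    refine (deficit_le hP).trans ?_
    rw [cycCost_eq rfl hy]
    simp only [List.length_cons] at h1 hlen
    split_ifs <;> omega
  · exact exists_hamiltonCycle_of_deficit_eq_zero (by simpa using hn) hF hHE h0
  · obtain ⟨x, y, hxy⟩ := exists_linked hF (hM.trans hMH) h0
    obtain ⟨D, hD, hDc⟩ := hlink H hMH x y hxy
    have himg : D.image (fun p => s(p.1, p.2)) ⊆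
        G.edgeFinset.filter fun e => F.deficit (insert e H) < F.deficit H := by
      intro e he
      obtain ⟨p, hp, rfl⟩ := mem_image.1 he
      exact mem_filter.2 ⟨by simpa using (hD p hp).2, deficit_insert_lt (hD p hp).1⟩
    have h1 := card_le_two_mul_card_image_sym2 D
    have h2 := h1.trans (Nat.mul_le_mul_left 2 (card_le_card himg))
    have h3 : (D.card : ℝ) ≤ 2 * ((G.edgeFinset.filter fun e =>
        F.deficit (insert e H) < F.deficit H).card : ℝ) := by exact_mod_cast h2
    linarith

end HamiltonCycle

/-! ### Light families and expansion -/

section Families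

variable {n : ℕ}

/-- The total weight of a family of edge sets. -/
noncomputable def weight (n : ℕ) (C : ℝ) (F : Finset (Finset (Sym2 (Fin n)))) : ℝ :=
  ∑ A ∈ F, Real.exp (-(C * Real.log n / n) * A.card)

lemma weight_union_le (C : ℝ) (F F' : Finset (Finset (Sym2 (Fin n)))) :
    weight n C (F ∪ F') ≤ weight n C F + weight n C F' := by
  unfold weight
  rw [← sum_union_inter]
  exact le_add_of_nonneg_right (sum_nonneg fun _ _ => (Real.exp_pos _).le)

lemma weight_biUnion_le {ι : Type*} [DecidableEq ι] (C : ℝ) (s : Finset ι)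
    (F : ι → Finset (Finset (Sym2 (Fin n)))) :
    weight n C (s.biUnion F) ≤ ∑ i ∈ s, weight n C (F i) := by
  induction s using Finset.induction_on with
  | empty => simp [weight]
  | insert i s hi ih =>
    rw [biUnion_insert, sum_insert hi]
    exact (weight_union_le C _ _).trans (by gcongr)

/-- A family of few large sets is light. -/
lemma weight_le (hn : 1 ≤ n) {C a : ℝ} (hC : 0 ≤ C) {m p : ℕ}
    {F : Finset (Finset (Sym2 (Fin n)))} (hcard : F.card ≤ n ^ m) (ha : ∀ A ∈ F, a ≤ A.card)
    (h : ((m : ℝ) + p) * n ≤ C * a) : weight n C F ≤ ((n : ℝ) ^ p)⁻¹ := by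
  have hn0 : (0 : ℝ) < n := by exact_mod_cast hn
  have hlog : 0 ≤ Real.log n := Real.log_natCast_nonneg n
  -- Each member weighs at most `n ^ (-(m + p))`, and there are at most `n ^ m` members.
  have hterm : ∀ A ∈ F, Real.exp (-(C * Real.log n / n) * A.card) ≤
      ((n : ℝ) ^ m)⁻¹ * ((n : ℝ) ^ p)⁻¹ := by
    intro A hA
    have h1 : ((m : ℝ) + p) ≤ C * A.card / n := by
      rw [le_div_iff₀ hn0]
      exact h.trans (mul_le_mul_of_nonneg_left (ha A hA) hC)
    have h2 : ((m : ℝ) + p) * Real.log n ≤ C * Real.log n / n * A.card := by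
      calc ((m : ℝ) + p) * Real.log n ≤ C * A.card / n * Real.log n := by gcongr
        _ = _ := by ring
    calc Real.exp (-(C * Real.log n / n) * A.card)
        ≤ Real.exp (-(((m + p : ℕ) : ℝ) * Real.log n)) := by
          apply Real.exp_le_exp.2; push_cast; linarith
      _ = ((n : ℝ) ^ (m + p))⁻¹ := by
          rw [Real.exp_neg, Real.exp_nat_mul, Real.exp_log hn0]
      _ = _ := by rw [pow_add, mul_inv]
  calc weight n C F ≤ F.card * (((n : ℝ) ^ m)⁻¹ * ((n : ℝ) ^ p)⁻¹) := by
        rw [← nsmul_eq_mul]; exact sum_le_card_nsmul _ _ _ hterm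
    _ ≤ (n : ℝ) ^ m * (((n : ℝ) ^ m)⁻¹ * ((n : ℝ) ^ p)⁻¹) := by
        gcongr; exact_mod_cast hcard
    _ = _ := by rw [← mul_assoc, mul_inv_cancel₀ (by positivity), one_mul]

open Classical in
/-- The edges from `U` to pivots outside `U ∪ W`. -/
noncomputable def leaving (Γ : Fin n → Fin n → Prop) (U W : Finset (Fin n)) :
    Finset (Sym2 (Fin n)) :=
  (univ.filter fun p : Fin n × Fin n => p.1 ∈ U ∧ p.2 ∉ U ∪ W ∧ Γ p.1 p.2).image
    fun p => s(p.1, p.2)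

open Classical in
lemma le_card_leaving {Γ : Fin n → Fin n → Prop} {d : ℕ}
    (hd : ∀ y, ∃ N : Finset (Fin n), d ≤ N.card ∧ ∀ u ∈ N, Γ y u) (U W : Finset (Fin n)) :
    U.card * (d - (U.card + W.card)) ≤ (leaving Γ U W).card := by
  rw [leaving, card_image_of_injOn]
  · have hsub : (U.sigma fun y => (univ.filter fun u => Γ y u) \ (U ∪ W)).card =
        (univ.filter fun p : Fin n × Fin n => p.1 ∈ U ∧ p.2 ∉ U ∪ W ∧ Γ p.1 p.2).card := by
      refine card_bij (fun p _ => (p.1, p.2)) ?_ ?_ ?_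
      · rintro ⟨a, b⟩ h
        simp only [mem_sigma, mem_sdiff, mem_filter, mem_univ, true_and] at h ⊢
        tauto
      · rintro ⟨a, b⟩ _ ⟨c, d⟩ _ h
        simp only [Prod.mk.injEq] at h
        obtain ⟨rfl, rfl⟩ := h; rfl
      · rintro ⟨a, b⟩ h
        simp only [mem_filter, mem_univ, true_and] at h
        refine ⟨⟨a, b⟩, ?_, rfl⟩
        simp only [mem_sigma, mem_sdiff, mem_filter, mem_univ, true_and]
        tauto
    rw [← hsub, card_sigma, ← smul_eq_mul]
    refine card_nsmul_le_sum _ _ _ fun y _ => ?_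
    have h1 := le_card_sdiff (U ∪ W) (univ.filter fun u => Γ y u)
    have h2 := card_union_le U W
    obtain ⟨N, hN, hNΓ⟩ := hd y
    have h3 : N.card ≤ (univ.filter fun u => Γ y u).card :=
      card_le_card fun u hu => mem_filter.2 ⟨mem_univ u, hNΓ u hu⟩
    omega
  · rintro ⟨a, b⟩ hab ⟨c, d⟩ hcd h
    simp only [coe_filter, mem_univ, true_and, Set.mem_ofPred_eq, mem_union, not_or] at hab hcd
    simp only [Sym2.eq_iff] at h
    rcases h with ⟨rfl, rfl⟩ | ⟨rfl, rfl⟩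
    · rfl
    · exact absurd hab.1 hcd.2.1.1

open Classical in
/-- Hitting a suitable light family makes small sets expand. -/
lemma exists_expansion_family (hn : 1 ≤ n) (G : SimpleGraph (Fin n)) [DecidableRel G.Adj]
    {Γ : Fin n → Fin n → Prop} (hΓ : ∀ y u, Γ y u → G.Adj y u) {d k : ℕ} (hk : 16 * k ≤ d)
    (hd : ∀ y, ∃ N : Finset (Fin n), d ≤ N.card ∧ ∀ u ∈ N, Γ y u) {C : ℝ} (hC0 : 0 ≤ C)
    (hC : 20 * (n : ℝ) ≤ C * d) :
    ∃ F : Finset (Finset (Sym2 (Fin n))), (∀ A ∈ F, A ⊆ G.edgeFinset) ∧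
      weight n C F ≤ (n : ℝ)⁻¹ ∧
      ∀ M : Finset (Sym2 (Fin n)), (∀ A ∈ F, (A ∩ M).Nonempty) →
        ∀ U W : Finset (Fin n), U.Nonempty → U.card ≤ k → W.card ≤ 7 * U.card →
          ∃ y ∈ U, ∃ u, u ∉ W ∧ Γ y u ∧ s(y, u) ∈ M := by
  have hdn : d ≤ n := by
    obtain ⟨N, hN, _⟩ := hd ⟨0, by omega⟩
    simpa using hN.trans (card_le_univ N)
  have hn0 : (0 : ℝ) < n := by exact_mod_cast hn
  let Fs : ℕ → Finset (Finset (Sym2 (Fin n))) := fun s =>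
    ((powersetCard s univ) ×ˢ (powersetCard (7 * s) univ)).image fun p => leaving Γ p.1 p.2
  refine ⟨(Finset.Icc 1 k).biUnion Fs, ?_, ?_, ?_⟩
  · intro A hA
    obtain ⟨s, _, hA⟩ := mem_biUnion.1 hA
    obtain ⟨p, _, rfl⟩ := mem_image.1 hA
    intro e he
    obtain ⟨q, hq, rfl⟩ := mem_image.1 he
    simpa using hΓ _ _ (mem_filter.1 hq).2.2.2
  · have hs : ∀ s ∈ Finset.Icc 1 k, weight n C (Fs s) ≤ ((n : ℝ) ^ 2)⁻¹ := by
      intro s hs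
      obtain ⟨hs1, hsk⟩ := Finset.mem_Icc.1 hs
      -- There are at most `n ^ (8s)` pairs `(U, W)`, and each has at least `s d / 2` leaving edges
      -- because `8s ≤ d / 2`. So `20 n ≤ C d` gives weight at most `n ^ (-2s)`.
      refine (weight_le hn hC0 (m := 8 * s) (p := 2 * s) (a := s * (d / 2)) ?_ ?_ ?_).trans ?_
      · calc (Fs s).card ≤ n.choose s * n.choose (7 * s) := by
              refine card_image_le.trans ?_
              rw [card_product, card_powersetCard, card_powersetCard, card_univ, Fintype.card_fin]
          _ ≤ n ^ s * n ^ (7 * s) := Nat.mul_le_mul (Nat.choose_le_pow _ _) (Nat.choose_le_pow _ _)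
          _ = n ^ (8 * s) := by rw [← pow_add]; congr 1; ring
      · intro A hA
        obtain ⟨p, hp, rfl⟩ := mem_image.1 hA
        obtain ⟨h1, h2⟩ := mem_product.1 hp
        have h3 := (mem_powersetCard.1 h1).2
        have h4 := (mem_powersetCard.1 h2).2
        have h5 := le_card_leaving hd p.1 p.2
        rw [h3, h4] at h5
        have h6 : d ≤ 2 * (d - (s + 7 * s)) := by omega
        have h7 : ((d : ℝ)) ≤ 2 * ((d - (s + 7 * s) : ℕ) : ℝ) := by exact_mod_cast h6
        have h8 : (s : ℝ) * ((d - (s + 7 * s) : ℕ) : ℝ) ≤ (leaving Γ p.1 p.2).card := by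
          exact_mod_cast h5
        have : (0 : ℝ) ≤ s := by positivity
        nlinarith
      · push_cast
        have : (0 : ℝ) ≤ s := by positivity
        nlinarith
      · have : (n : ℝ) ^ 2 ≤ (n : ℝ) ^ (2 * s) :=
          pow_le_pow_right₀ (by exact_mod_cast hn) (by omega)
        gcongr
    calc weight n C ((Finset.Icc 1 k).biUnion Fs) ≤ ∑ s ∈ Finset.Icc 1 k, weight n C (Fs s) :=
          weight_biUnion_le C _ _
      _ ≤ k * ((n : ℝ) ^ 2)⁻¹ := by
          have := sum_le_card_nsmul _ _ _ hs
          simpa using this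
      _ ≤ n * ((n : ℝ) ^ 2)⁻¹ := by
          gcongr; exact_mod_cast (by omega : k ≤ n)
      _ = (n : ℝ)⁻¹ := by field_simp
  · intro M hM U W hU hUk hW
    obtain ⟨W', hWW', _, hW'c⟩ := exists_subsuperset_card_eq (subset_univ W) hW
      (by rw [card_univ, Fintype.card_fin]; omega)
    obtain ⟨e, he⟩ := hM (leaving Γ U W') (mem_biUnion.2 ⟨U.card,
      Finset.mem_Icc.2 ⟨hU.card_pos, hUk⟩, mem_image.2 ⟨(U, W'), by
        simp [mem_powersetCard, hW'c], rfl⟩⟩)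
    obtain ⟨he, heM⟩ := mem_inter.1 he
    obtain ⟨⟨y, u⟩, hp, rfl⟩ := mem_image.1 he
    obtain ⟨h1, h2, h3⟩ := (mem_filter.1 hp).2
    exact ⟨y, h1, u, fun h => h2 (mem_union_right _ (hWW' h)), h3, heM⟩

open Classical in
/-- In a frame almost all of whose admissible pairs are edges, expansion yields boosters. -/
lemma isBoosterMeasure_of_expansion (hn : 3 ≤ n) (G : SimpleGraph (Fin n)) [DecidableRel G.Adj]
    {F : Frame (Fin n)} (hF : ∃ P, F.IsPath P) {ε : ℝ} {M : Finset (Sym2 (Fin n))}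
    (hM : F.forced ⊆ M) (Γ : Fin n → Fin n → Prop)
    (hΓ : ∀ y u, Γ y u → s(y, u) ∈ F.adm ∧ ∀ e ∈ F.forced, u ∉ e) {k : ℕ}
    (hexp : ∀ U W : Finset (Fin n), U.Nonempty → U.card ≤ k → W.card ≤ 3 * U.card →
      ∃ y ∈ U, ∃ u, u ∉ W ∧ Γ y u ∧ s(y, u) ∈ M)
    {N : Finset (Fin n × Fin n)} (hN : ∀ x y, s(x, y) ∈ F.adm → ¬ G.Adj x y → (x, y) ∈ N)
    (hmiss : (N.card : ℝ) + 2 * ε * n ^ 2 ≤ (k : ℝ) ^ 2) :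
    IsBoosterMeasure G ε M F.deficit := by
  refine isBoosterMeasure_deficit hn G hF hM fun H hMH x y hxy => ?_
  have hexp' : ∀ U W : Finset (Fin n), U.Nonempty → U.card ≤ k → W.card ≤ 3 * U.card →
      ∃ y ∈ U, ∃ u, u ∉ W ∧ Γ y u ∧ s(y, u) ∈ H := by
    intro U W h1 h2 h3
    obtain ⟨y, hy, u, hu, h4, h5⟩ := hexp U W h1 h2 h3
    exact ⟨y, hy, u, hu, h4, hMH h5⟩
  let L : Fin n → Finset (Fin n) := fun x => univ.filter fun z => F.Linked H x z
  have hL : ∀ x y, F.Linked H x y → k < (L x).card := fun x y h =>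
    card_linked_of_expansion Γ hΓ hexp' h (L x) (by simp [L])
  -- Being linked is symmetric, so each of the more than `k` vertices linked to `x` is itself linked
  -- to more than `k`. Linked pairs are admissible, so at most `|N|` of them are not edges.
  let Q : Finset (Fin n × Fin n) := univ.filter fun p => F.Linked H p.1 p.2
  have hQ : k ^ 2 ≤ Q.card := by
    have h1 : ((L x).sigma L).card ≤ Q.card := by
      refine card_le_card_of_injOn (fun p => (p.1, p.2)) ?_ ?_
      · rintro ⟨a, b⟩ h
        simp only [coe_sigma, Set.mem_sigma_iff, mem_coe] at h
        have := h.2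
        simp only [L, mem_filter, mem_univ, true_and] at this
        simp [Q, this]
      · rintro ⟨a, b⟩ _ ⟨c, d⟩ _ h
        simp only [Prod.mk.injEq] at h
        obtain ⟨rfl, rfl⟩ := h; rfl
    rw [card_sigma] at h1
    refine le_trans ?_ h1
    have h2 : ∀ z ∈ L x, k ≤ (L z).card := fun z hz =>
      (hL z x (mem_filter.1 hz).2.symm).le
    have h3 := card_nsmul_le_sum (L x) (fun z => (L z).card) k h2
    have h4 := (hL x y hxy).le
    rw [smul_eq_mul] at h3
    nlinarith
  refine ⟨Q.filter fun p => G.Adj p.1 p.2, fun p hp => ?_, ?_⟩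
  · obtain ⟨h1, h2⟩ := mem_filter.1 hp
    exact ⟨(mem_filter.1 h1).2, h2⟩
  · have h1 : (Q.filter fun p => ¬ G.Adj p.1 p.2).card ≤ N.card := by
      refine card_le_card fun p hp => ?_
      obtain ⟨h1, h2⟩ := mem_filter.1 hp
      obtain ⟨P, hP, hx, hy, _⟩ := (mem_filter.1 h1).2
      refine hN _ _ ?_ h2
      rw [Sym2.eq_swap]
      exact hP.closing _ _ hx hy
    have h2 := card_filter_add_card_filter_not (s := Q) (fun p => G.Adj p.1 p.2)
    have h3 : k ^ 2 ≤ (Q.filter fun p => G.Adj p.1 p.2).card + N.card := by omega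
    have h4 : (k : ℝ) ^ 2 ≤ ((Q.filter fun p => G.Adj p.1 p.2).card : ℝ) + N.card := by
      exact_mod_cast h3
    linarith

end Families

/-! ### Counting edges across cuts -/

section Cuts

variable {n : ℕ} (G : SimpleGraph (Fin n)) [DecidableRel G.Adj]

/-- The number of edges between `A` and its complement. -/
def cutSize (A : Finset (Fin n)) : ℕ := ∑ a ∈ A, (G.neighborFinset a ∩ Aᶜ).card

lemma sum_card_neighborFinset_inter_comm (A B : Finset (Fin n)) :
    ∑ a ∈ A, (G.neighborFinset a ∩ B).card = ∑ b ∈ B, (G.neighborFinset b ∩ A).card := by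
  have h : ∀ A B : Finset (Fin n), ∑ a ∈ A, (G.neighborFinset a ∩ B).card =
      ∑ a ∈ A, ∑ b ∈ B, if G.Adj a b then 1 else 0 := by
    intro A B
    refine sum_congr rfl fun a _ => ?_
    rw [sum_boole, Nat.cast_id]
    congr 1
    ext b; simp [and_comm]
  rw [h, h, sum_comm]
  simp only [G.adj_comm]

lemma cutSize_compl (A : Finset (Fin n)) : cutSize G Aᶜ = cutSize G A := by
  rw [cutSize, cutSize, sum_card_neighborFinset_inter_comm, compl_compl]

lemma card_inter_add_card_inter_compl (A : Finset (Fin n)) (v : Fin n) :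
    (G.neighborFinset v ∩ A).card + (G.neighborFinset v ∩ Aᶜ).card = G.degree v := by
  rw [← G.card_neighborFinset_eq_degree, ← sdiff_eq_inter_compl, add_comm,
    card_sdiff_add_card_inter]

/-- When `v` leaves `A`, its edges into `A` begin to cross and those to the complement cease to. -/
lemma cutSize_erase {A : Finset (Fin n)} {v : Fin n} (hv : v ∈ A) :
    cutSize G (A.erase v) + (G.neighborFinset v ∩ Aᶜ).card =
      cutSize G A + (G.neighborFinset v ∩ A).card := by
  have h1 : ∀ a ∈ A.erase v, (G.neighborFinset a ∩ (A.erase v)ᶜ).card =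
      (G.neighborFinset a ∩ Aᶜ).card + if G.Adj v a then 1 else 0 := by
    intro a _
    rw [compl_erase]
    by_cases h : G.Adj v a
    · rw [inter_insert_of_mem (by simpa using h.symm), card_insert_of_notMem (by simp [hv]), if_pos h]
    · rw [inter_insert_of_notMem (by simpa [G.adj_comm] using h), if_neg h, add_zero]
  have h2 : ∑ a ∈ A.erase v, (if G.Adj v a then 1 else 0) = (G.neighborFinset v ∩ A).card := by
    rw [sum_boole, Nat.cast_id]
    congr 1
    ext b
    simp only [mem_filter, mem_erase, mem_inter, SimpleGraph.mem_neighborFinset]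
    constructor
    · rintro ⟨⟨_, h⟩, h'⟩; exact ⟨h', h⟩
    · rintro ⟨h', h⟩; exact ⟨⟨h'.ne', h⟩, h'⟩
  rw [cutSize, sum_congr rfl h1, sum_add_distrib, h2, cutSize, ← add_sum_erase A _ hv]
  ring

lemma sum_inter_add_cutSize (A : Finset (Fin n)) :
    ∑ a ∈ A, (G.neighborFinset a ∩ A).card + cutSize G A = ∑ a ∈ A, G.degree a := by
  rw [cutSize, ← sum_add_distrib]
  exact sum_congr rfl fun a _ => card_inter_add_card_inter_compl G A a

variable {G}

lemma card_mul_le_sum_degree (hdeg : ∀ v, n ≤ 2 * G.degree v) (A : Finset (Fin n)) :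
    A.card * n ≤ 2 * ∑ a ∈ A, G.degree a := by
  rw [mul_sum, ← smul_eq_mul]
  exact card_nsmul_le_sum _ _ _ fun a _ => hdeg a

lemma sq_le_card_edgeFinset (hdeg : ∀ v, n ≤ 2 * G.degree v) :
    (n : ℝ) ^ 2 / 4 ≤ G.edgeFinset.card := by
  have h := card_mul_le_sum_degree hdeg univ
  rw [G.sum_degrees_eq_twice_card_edges, card_univ, Fintype.card_fin] at h
  have h' : (n : ℝ) * n ≤ 2 * (2 * G.edgeFinset.card) := by exact_mod_cast h
  nlinarith

/-- The pairs within `A` which are not edges. -/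
lemma card_filter_not_adj (A B : Finset (Fin n)) :
    (univ.filter fun p : Fin n × Fin n => p.1 ∈ A ∧ p.2 ∈ B ∧ ¬ G.Adj p.1 p.2).card +
      ∑ a ∈ A, (G.neighborFinset a ∩ B).card = A.card * B.card := by
  have h1 : (univ.filter fun p : Fin n × Fin n => p.1 ∈ A ∧ p.2 ∈ B ∧ ¬ G.Adj p.1 p.2).card =
      ((A ×ˢ B).filter fun p => ¬ G.Adj p.1 p.2).card := by
    congr 1; ext p; simp [and_assoc]
  have h2 : ∑ a ∈ A, (G.neighborFinset a ∩ B).card =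
      ((A ×ˢ B).filter fun p => G.Adj p.1 p.2).card := by
    rw [card_filter, sum_product]
    refine sum_congr rfl fun a _ => ?_
    rw [sum_boole, Nat.cast_id]
    congr 1
    ext b; simp [and_comm]
  rw [h1, h2, add_comm, card_filter_add_card_filter_not, card_product]

end Cuts

/-! ### Graphs close to two disjoint cliques -/

section SparseCut

variable {n : ℕ} {G : SimpleGraph (Fin n)} [DecidableRel G.Adj]

lemma exists_mem_of_mem_edgesOf {V : Type*} {P : List V} {e : Sym2 V} (he : e ∈ edgesOf P) :
    ∃ a ∈ P, ∃ b ∈ P, e = s(a, b) := by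
  obtain ⟨X, a, b, Y, rfl, rfl⟩ := mem_edgesOf_iff.1 he
  exact ⟨a, by simp, b, by simp, rfl⟩

/-- The pairs of vertices on the same side of a partition. -/
def sameSide (A : Finset (Fin n)) : Set (Sym2 (Fin n)) :=
  Sym2.fromRel (r := fun x y => (x ∈ A ↔ y ∈ A)) ⟨fun _ _ h => h.symm⟩

lemma mem_sameSide {A : Finset (Fin n)} {x y : Fin n} :
    s(x, y) ∈ sameSide A ↔ (x ∈ A ↔ y ∈ A) := Sym2.fromRel_prop

/-- The frame of the Hamilton cycles crossing a partition at two given edges only. -/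
def twoSidedFrame (A : Finset (Fin n)) (a₁ b₁ a₂ b₂ : Fin n) : Frame (Fin n) where
  adm := sameSide A
  forced := {s(a₁, b₁), s(a₂, b₂)}
  trans a b c d h1 h2 h3 := by rw [mem_sameSide] at *; tauto

/-- Traverse `A` up to `a₂`, cross to `b₂`, traverse the complement up to `b₁` and return to `a₁`.
Placing `a₁` last puts the closing pair inside `A`. -/
lemma exists_isPath_twoSidedFrame {A : Finset (Fin n)} {a₁ b₁ a₂ b₂ : Fin n} (ha₁ : a₁ ∈ A)
    (ha₂ : a₂ ∈ A) (hb₁ : b₁ ∉ A) (hb₂ : b₂ ∉ A) (ha : a₁ ≠ a₂) (hb : b₁ ≠ b₂) :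
    ∃ P, (twoSidedFrame A a₁ b₁ a₂ b₂).IsPath P := by
  set L₁ := (A \ {a₁, a₂}).toList with hL₁
  set L₂ := (Aᶜ \ {b₁, b₂}).toList with hL₂
  have hm₁ : ∀ x, x ∈ L₁ ↔ x ∈ A ∧ x ≠ a₁ ∧ x ≠ a₂ := fun x => by simp [hL₁]
  have hm₂ : ∀ x, x ∈ L₂ ↔ x ∉ A ∧ x ≠ b₁ ∧ x ≠ b₂ := fun x => by simp [hL₂]
  have hn₁ : L₁.Nodup := nodup_toList _
  have hn₂ : L₂.Nodup := nodup_toList _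
  have hedge : edgesOf (L₁ ++ a₂ :: b₂ :: (L₂ ++ [b₁, a₁])) =
      edgesOf (L₁ ++ [a₂]) ++ s(a₂, b₂) :: (edgesOf (b₂ :: L₂ ++ [b₁]) ++ [s(b₁, a₁)]) := by
    rw [edgesOf_append, ← List.cons_append, edgesOf_append]; rfl
  refine ⟨L₁ ++ a₂ :: b₂ :: (L₂ ++ [b₁, a₁]), ?_, ?_, ?_, ?_, ?_⟩
  · simp only [List.nodup_append, List.nodup_cons, List.mem_cons, List.mem_append, hm₁, hm₂,
      hn₁, hn₂, List.not_mem_nil, List.nodup_nil]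
    aesop
  · intro v
    simp only [List.mem_cons, List.mem_append, hm₁, hm₂, List.not_mem_nil]
    tauto
  · intro e he
    rw [hedge] at he
    simp only [List.mem_append, List.mem_cons, List.not_mem_nil, or_false] at he
    rcases he with he | rfl | he | rfl
    · obtain ⟨x, hx, y, hy, rfl⟩ := exists_mem_of_mem_edgesOf he
      simp only [List.mem_append, List.mem_singleton, hm₁] at hx hy
      left; rw [twoSidedFrame, mem_sameSide]
      have : x ∈ A := by rcases hx with h | rfl; exacts [h.1, ha₂]
      have : y ∈ A := by rcases hy with h | rfl; exacts [h.1, ha₂]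
      tauto
    · right; simp [twoSidedFrame]
    · obtain ⟨x, hx, y, hy, rfl⟩ := exists_mem_of_mem_edgesOf he
      simp only [List.mem_append, List.mem_cons, List.not_mem_nil, or_false, hm₂] at hx hy
      left; rw [twoSidedFrame, mem_sameSide]
      have : x ∉ A := by rcases hx with (rfl | h) | rfl; exacts [hb₂, h.1, hb₁]
      have : y ∉ A := by rcases hy with (rfl | h) | rfl; exacts [hb₂, h.1, hb₁]
      tauto
    · right; simp [twoSidedFrame, Sym2.eq_swap]
  · intro e he
    rw [hedge]
    simp only [twoSidedFrame, mem_insert, mem_singleton] at he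
    rcases he with rfl | rfl
    · rw [Sym2.eq_swap]; simp
    · simp
  · intro x y hx hy
    have hy' : a₁ = y := by simpa [List.getLast?_append, List.getLast?_cons] using hy
    have hx' : x ∈ A := by
      rcases hL : L₁ with _ | ⟨c, L⟩
      · rw [hL] at hx
        simp only [List.nil_append, List.head?_cons, Option.some.injEq] at hx
        exact hx ▸ ha₂
      · rw [hL] at hx
        simp only [List.cons_append, List.head?_cons, Option.some.injEq] at hx
        exact hx ▸ ((hm₁ c).1 (by rw [hL]; simp)).1
    rw [twoSidedFrame, mem_sameSide, ← hy']
    tauto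

variable (G) in
/-- The edges across a partition which avoid the vertex `w`. -/
def crossing (A : Finset (Fin n)) (w : Fin n) : Finset (Sym2 (Fin n)) :=
  G.edgeFinset.filter fun e => ∃ a ∈ A, ∃ b ∉ A, e = s(a, b) ∧ w ≠ a ∧ w ≠ b

lemma crossing_compl (A : Finset (Fin n)) (w : Fin n) : crossing G Aᶜ w = crossing G A w := by
  ext e
  simp only [crossing, mem_filter, mem_compl, not_not]
  refine and_congr_right fun _ => ⟨?_, ?_⟩ <;>
  · rintro ⟨a, ha, b, hb, rfl, h1, h2⟩
    exact ⟨b, hb, a, ha, Sym2.eq_swap, h2, h1⟩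

/-- One edge is chosen for each vertex of `A` other than `w`. The choices are distinct, each having
only one end in `A`. -/
lemma card_le_card_crossing {A : Finset (Fin n)} {w : Fin n}
    (h : ∀ a ∈ A, a ≠ w → ∃ b ∉ A, b ≠ w ∧ G.Adj a b) : A.card ≤ (crossing G A w).card + 1 := by
  have h' : ∀ a, ∃ b, a ∈ A → a ≠ w → b ∉ A ∧ b ≠ w ∧ G.Adj a b := fun a => by
    by_cases ha : a ∈ A ∧ a ≠ w
    · obtain ⟨b, hb⟩ := h a ha.1 ha.2; exact ⟨b, fun _ _ => hb⟩
    · exact ⟨a, fun h1 h2 => absurd ⟨h1, h2⟩ ha⟩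
  choose f hf using h'
  have h1 : (A.erase w).card ≤ (crossing G A w).card := by
    refine card_le_card_of_injOn (fun a => s(a, f a)) ?_ ?_
    · intro a ha
      obtain ⟨h1, h2⟩ := mem_erase.1 ha
      obtain ⟨h3, h4, h5⟩ := hf a h2 h1
      exact mem_coe.2 (mem_filter.2 ⟨by simpa using h5, a, h2, f a, h3, rfl, h1.symm, h4.symm⟩)
    · intro a ha c hc hac
      obtain ⟨h1, h2⟩ := mem_erase.1 ha
      obtain ⟨h3, h4⟩ := mem_erase.1 hc
      simp only [Sym2.eq_iff] at hac
      rcases hac with h | h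
      · exact h.1
      · exact absurd h2 (h.1 ▸ (hf c h4 h3).1)
  have := pred_card_le_card_erase (s := A) (a := w)
  omega

/-- At most `|A| - 1` neighbours of `a` lie in `A`. -/
lemma exists_adj_compl {A : Finset (Fin n)} (hdeg : ∀ v, n ≤ 2 * G.degree v) {a : Fin n}
    (ha : a ∈ A) : n + 2 ≤ 2 * A.card + 2 * (G.neighborFinset a ∩ Aᶜ).card := by
  have h1 := card_inter_add_card_inter_compl G A a
  have h2 : (G.neighborFinset a ∩ A).card ≤ (A.erase a).card := by
    refine card_le_card fun x hx => ?_
    simp only [mem_inter, SimpleGraph.mem_neighborFinset] at hx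
    exact mem_erase.2 ⟨hx.1.ne', hx.2⟩
  have h3 := card_erase_add_one ha
  have h4 := hdeg a
  omega

lemma card_crossing_of_two_mul_lt {A : Finset (Fin n)} (hdeg : ∀ v, n ≤ 2 * G.degree v)
    (hA : 2 * A.card < n) (w : Fin n) : A.card ≤ (crossing G A w).card + 1 := by
  refine card_le_card_crossing fun a ha _ => ?_
  have h := exists_adj_compl hdeg ha
  obtain ⟨b, hb, hbw⟩ := exists_mem_ne (s := G.neighborFinset a ∩ Aᶜ) (by omega) w
  simp only [mem_inter, SimpleGraph.mem_neighborFinset, mem_compl] at hb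
  exact ⟨b, hb.2, hbw, hb.1⟩

lemma card_crossing_of_two_mul_eq {A : Finset (Fin n)} (hdeg : ∀ v, n ≤ 2 * G.degree v)
    (hA : 2 * A.card = n) {w : Fin n} (hw : w ∈ A) : A.card ≤ (crossing G A w).card + 1 := by
  refine card_le_card_crossing fun a ha _ => ?_
  have h := exists_adj_compl hdeg ha
  obtain ⟨b, hb⟩ := card_pos.1 (by omega : 0 < (G.neighborFinset a ∩ Aᶜ).card)
  simp only [mem_inter, SimpleGraph.mem_neighborFinset, mem_compl] at hb
  exact ⟨b, hb.2, fun h => hb.2 (h ▸ hw), hb.1⟩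

/-- In a side with fewer than `n / 2` vertices each vertex has two neighbours across, one of them
different from `w`. If the sides are equal there may be only one, and the side containing `w` is
used. -/
lemma le_card_crossing {A : Finset (Fin n)} (hdeg : ∀ v, n ≤ 2 * G.degree v)
    {m : ℕ} (hA : m ≤ A.card) (hA' : m ≤ Aᶜ.card) (w : Fin n) :
    m ≤ (crossing G A w).card + 1 := by
  have hc : A.card + Aᶜ.card = n := by rw [card_add_card_compl, Fintype.card_fin]
  rcases lt_trichotomy (2 * A.card) n with h | h | h
  · exact hA.trans (card_crossing_of_two_mul_lt hdeg h w)
  · by_cases hw : w ∈ A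
    · exact hA.trans (card_crossing_of_two_mul_eq hdeg h hw)
    · rw [← crossing_compl]
      exact hA'.trans (card_crossing_of_two_mul_eq hdeg (by omega) (mem_compl.2 hw))
  · rw [← crossing_compl]
    exact hA'.trans (card_crossing_of_two_mul_lt hdeg (by omega) w)

/-- No single vertex covers all crossing edges in `M`, and a bipartite graph without such a vertex
has two disjoint edges. -/
lemma exists_disjoint_crossing {A : Finset (Fin n)} (hn : 0 < n) {M : Finset (Sym2 (Fin n))}
    (hM : ∀ w, (crossing G A w ∩ M).Nonempty) :
    ∃ a₁ ∈ A, ∃ b₁ ∉ A, ∃ a₂ ∈ A, ∃ b₂ ∉ A, a₁ ≠ a₂ ∧ b₁ ≠ b₂ ∧ s(a₁, b₁) ∈ M ∧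
      s(a₂, b₂) ∈ M := by
  have h : ∀ w, ∃ a ∈ A, ∃ b ∉ A, s(a, b) ∈ M ∧ w ≠ a ∧ w ≠ b := by
    intro w
    obtain ⟨e, he⟩ := hM w
    obtain ⟨he, heM⟩ := mem_inter.1 he
    obtain ⟨_, a, ha, b, hb, rfl, h1, h2⟩ := mem_filter.1 he
    exact ⟨a, ha, b, hb, heM, h1, h2⟩
  obtain ⟨a, ha, b, hb, h1, _⟩ := h ⟨0, hn⟩
  obtain ⟨a', ha', b', hb', h2, h3, _⟩ := h a
  obtain ⟨a'', ha'', b'', hb'', h4, _, h5⟩ := h b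
  by_cases hbb : b = b'
  · subst hbb
    by_cases haa : a = a''
    · subst haa
      exact ⟨a', ha', b, hb', a, ha, b'', hb'', h3.symm, h5, h2, h4⟩
    · exact ⟨a, ha, b, hb, a'', ha'', b'', hb'', haa, h5, h1, h4⟩
  · exact ⟨a, ha, b, hb, a', ha', b', hb', h3, hbb, h1, h2⟩

/-- A partition with few crossing edges can be chosen so that every vertex has many neighbours
on its own side. -/
lemma exists_sparse_cut {ε₀ : ℝ} (hε₀ : ε₀ ≤ 1 / 100) (hn : 100 ≤ n)
    (hdeg : ∀ v, n ≤ 2 * G.degree v) {T : Finset (Fin n)}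
    (hT : n ≤ 3 * T.card) (hT' : 3 * T.card ≤ 2 * n) (hcut : (cutSize G T : ℝ) ≤ ε₀ * n ^ 2) :
    ∃ A : Finset (Fin n), (cutSize G A : ℝ) ≤ ε₀ * n ^ 2 ∧
      (n : ℝ) / 2 - 3 * ε₀ * n ≤ A.card ∧ (n : ℝ) / 2 - 3 * ε₀ * n ≤ Aᶜ.card ∧
      (∀ v ∈ A, n ≤ 4 * (G.neighborFinset v ∩ A).card) ∧
      (∀ v ∉ A, n ≤ 4 * (G.neighborFinset v ∩ Aᶜ).card) := by
  have hn0 : (100 : ℝ) ≤ n := by exact_mod_cast hn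
  -- A minimum cut among the balanced ones. As degrees are at least `n / 2` and few edges cross, its
  -- sides have almost `n / 2` vertices, so that moving one vertex keeps it balanced. Minimality
  -- then puts at least half of the neighbours of each vertex on its own side.
  obtain ⟨A, hA, hmin⟩ := exists_min_image
    (univ.filter fun A : Finset (Fin n) => n ≤ 3 * A.card ∧ 3 * A.card ≤ 2 * n) (cutSize G)
    ⟨T, by simp [hT, hT']⟩
  simp only [mem_filter, mem_univ, true_and] at hA hmin
  have hcutA : (cutSize G A : ℝ) ≤ ε₀ * n ^ 2 :=
    le_trans (by exact_mod_cast hmin T ⟨hT, hT'⟩) hcut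
  have hc : A.card + Aᶜ.card = n := by rw [card_add_card_compl, Fintype.card_fin]
  have hsize : ∀ B : Finset (Fin n), n ≤ 3 * B.card → (cutSize G B : ℝ) ≤ ε₀ * n ^ 2 →
      (n : ℝ) / 2 - 3 * ε₀ * n ≤ B.card := by
    intro B hB hcB
    have h1 := card_mul_le_sum_degree hdeg B
    rw [← sum_inter_add_cutSize] at h1
    have h2 : ∑ a ∈ B, (G.neighborFinset a ∩ B).card ≤ B.card * B.card := by
      rw [← smul_eq_mul]
      exact sum_le_card_nsmul _ _ _ fun a _ => card_le_card inter_subset_right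
    have h3 : (B.card : ℝ) * n ≤ 2 * (B.card * B.card + cutSize G B) := by
      exact_mod_cast h1.trans (by gcongr)
    have h4 : (n : ℝ) ≤ 3 * B.card := by exact_mod_cast hB
    have h5 : ε₀ * n ^ 2 ≤ 3 * ε₀ * n * B.card := by
      rcases le_total 0 ε₀ with h | h
      · have : ε₀ * n * n ≤ ε₀ * n * (3 * B.card) := by gcongr
        nlinarith
      · have : (0 : ℝ) ≤ cutSize G B := by positivity
        have h6 : ε₀ * n ^ 2 = 0 := le_antisymm (mul_nonpos_of_nonpos_of_nonneg h (by positivity))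
          (by linarith)
        have h7 : ε₀ = 0 := by
          rcases mul_eq_zero.1 h6 with h | h
          · exact h
          · exact absurd h (by positivity)
        simp [h7]
    by_contra hlt
    rw [not_le] at hlt
    have h8 : (0 : ℝ) < B.card := by linarith
    nlinarith
  have hA1 := hsize A hA.1 hcutA
  have hA2 := hsize Aᶜ (by omega) (by rwa [cutSize_compl])
  have hbal : ∀ B : Finset (Fin n), (n : ℝ) / 2 - 3 * ε₀ * n ≤ B.card → n ≤ 3 * Bᶜ.card →
      (∀ B' : Finset (Fin n), n ≤ 3 * B'.card ∧ 3 * B'.card ≤ 2 * n →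
        cutSize G B ≤ cutSize G B') → ∀ v ∈ B, n ≤ 4 * (G.neighborFinset v ∩ B).card := by
    intro B hB hBc hminB v hv
    have h1 : n ≤ 3 * (B.erase v).card := by
      rw [card_erase_of_mem hv]
      have h2 : (n : ℝ) * (1 / 2 - 3 / 100) ≤ B.card := by nlinarith
      have h3 : 47 * n ≤ 100 * B.card := by
        have : (47 : ℝ) * n ≤ 100 * B.card := by linarith
        exact_mod_cast this
      omega
    have hcB : B.card + Bᶜ.card = n := by rw [card_add_card_compl, Fintype.card_fin]
    have h2 := hminB (B.erase v) ⟨h1, by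
      have := card_erase_le (s := B) (a := v); omega⟩
    have h3 := cutSize_erase G hv
    have h4 := card_inter_add_card_inter_compl G B v
    have h5 := hdeg v
    omega
  refine ⟨A, hcutA, hA1, hA2, hbal A hA1 (by omega) hmin, fun v hv => ?_⟩
  refine hbal Aᶜ hA2 (by rw [compl_compl]; exact hA.1) (fun B' hB' => ?_) v (mem_compl.2 hv)
  rw [cutSize_compl]; exact hmin B' hB'

/-- `A` has at most `n / 2 + 3 ε₀ n` vertices, each of degree at least `n / 2`, and few edges leave
it. -/
lemma card_not_adj_sameSide {ε₀ : ℝ} (hε₀ : 0 ≤ ε₀)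
    (hdeg : ∀ v, n ≤ 2 * G.degree v) {A : Finset (Fin n)} (hcut : (cutSize G A : ℝ) ≤ ε₀ * n ^ 2)
    (hA' : (n : ℝ) / 2 - 3 * ε₀ * n ≤ Aᶜ.card) :
    ((univ.filter fun p : Fin n × Fin n => p.1 ∈ A ∧ p.2 ∈ A ∧ ¬ G.Adj p.1 p.2).card : ℝ) ≤
      4 * ε₀ * n ^ 2 := by
  have hc : A.card + Aᶜ.card = n := by rw [card_add_card_compl, Fintype.card_fin]
  have hc' : (A.card : ℝ) + Aᶜ.card = n := by exact_mod_cast hc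
  have h1 := card_filter_not_adj (G := G) A A
  have h2 := card_mul_le_sum_degree hdeg A
  rw [← sum_inter_add_cutSize] at h2
  set s := ∑ a ∈ A, (G.neighborFinset a ∩ A).card
  have h1' : ((univ.filter fun p : Fin n × Fin n => p.1 ∈ A ∧ p.2 ∈ A ∧ ¬ G.Adj p.1 p.2).card : ℝ)
      + s = A.card * A.card := by exact_mod_cast h1
  have h2' : (A.card : ℝ) * n ≤ 2 * (s + cutSize G A) := by exact_mod_cast h2
  have h3 : (A.card : ℝ) * (A.card - n / 2) ≤ n * (3 * ε₀ * n) := by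
    have h4 : (A.card : ℝ) - n / 2 ≤ 3 * ε₀ * n := by linarith
    have h5 : (A.card : ℝ) ≤ n := by
      have : (0 : ℝ) ≤ Aᶜ.card := by positivity
      linarith
    have h6 : (0 : ℝ) ≤ A.card := by positivity
    have h7 : (0 : ℝ) ≤ 3 * ε₀ * n := by positivity
    calc (A.card : ℝ) * (A.card - n / 2) ≤ A.card * (3 * ε₀ * n) := by gcongr
      _ ≤ _ := by gcongr
  nlinarith

/-- Graphs of large minimum degree with a sparse balanced cut are robust. -/
theorem robust_of_sparse_cut (hn : 1000 ≤ n) (hdeg : ∀ v, n ≤ 2 * G.degree v)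
    {T : Finset (Fin n)} (hT : n ≤ 3 * T.card) (hT' : 3 * T.card ≤ 2 * n)
    (hcut : (cutSize G T : ℝ) ≤ 1 / 2 ^ 18 * n ^ 2) {C : ℝ} (hC : 160 ≤ C) :
    Robust G C (1 / 2 ^ 16) := by
  have hn0 : (1000 : ℝ) ≤ n := by exact_mod_cast hn
  obtain ⟨A, hcutA, hA1, hA2, hdA, hdA'⟩ := exists_sparse_cut (by norm_num) (by omega) hdeg hT hT' hcut
  let Γ : Fin n → Fin n → Prop := fun y u => G.Adj y u ∧ (y ∈ A ↔ u ∈ A)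
  have hΓd : ∀ y, ∃ N : Finset (Fin n), n / 4 ≤ N.card ∧ ∀ u ∈ N, Γ y u := by
    intro y
    by_cases hy : y ∈ A
    · have h1 := hdA y hy
      exact ⟨G.neighborFinset y ∩ A, by omega, fun u hu => by simpa [Γ, hy] using hu⟩
    · have h1 := hdA' y hy
      exact ⟨G.neighborFinset y ∩ Aᶜ, by omega, fun u hu => by simpa [Γ, hy] using hu⟩
  have hquarter : (n : ℝ) / 8 ≤ ((n / 4 : ℕ) : ℝ) := by
    have : n ≤ 8 * (n / 4) := by omega
    have : (n : ℝ) ≤ 8 * ((n / 4 : ℕ) : ℝ) := by exact_mod_cast this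
    linarith
  obtain ⟨F₁, hF₁E, hF₁w, hF₁⟩ := exists_expansion_family (by omega) G (Γ := Γ) (fun _ _ h => h.1)
    (d := n / 4) (k := n / 64) (by omega) hΓd (by linarith : (0 : ℝ) ≤ C)
    (by nlinarith)
  have hcr : ∀ w, (n : ℝ) / 4 ≤ (crossing G A w).card := by
    intro w
    have h1 : n / 4 + 1 + 1 ≤ A.card := by
      have h2 : (n : ℝ) * (1 / 2 - 3 / 2 ^ 18) ≤ A.card := by linarith
      have h3 : (n : ℝ) * 2 ≤ 5 * A.card := by norm_num at h2; linarith
      have h4 : n * 2 ≤ 5 * A.card := by exact_mod_cast h3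
      omega
    have h1' : n / 4 + 1 + 1 ≤ Aᶜ.card := by
      have h2 : (n : ℝ) * (1 / 2 - 3 / 2 ^ 18) ≤ Aᶜ.card := by linarith
      have h3 : (n : ℝ) * 2 ≤ 5 * Aᶜ.card := by norm_num at h2; linarith
      have h4 : n * 2 ≤ 5 * Aᶜ.card := by exact_mod_cast h3
      omega
    have h2 := le_card_crossing hdeg h1 h1' w
    have h3 : n ≤ 4 * (crossing G A w).card := by omega
    have h4 : (n : ℝ) ≤ 4 * (crossing G A w).card := by exact_mod_cast h3
    linarith
  set F₂ : Finset (Finset (Sym2 (Fin n))) := univ.image (crossing G A) with hF₂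
  have hF₂w : weight n C F₂ ≤ ((n : ℝ) ^ 1)⁻¹ := by
    refine weight_le (by omega) (by linarith) (m := 1) (a := (n : ℝ) / 4) ?_ ?_ ?_
    · exact card_image_le.trans (by simp)
    · intro X hX
      obtain ⟨w, _, rfl⟩ := mem_image.1 hX
      exact hcr w
    · push_cast; nlinarith
  refine ⟨?_, F₁ ∪ F₂, ?_, ?_, ?_⟩
  · refine le_trans ?_ (sq_le_card_edgeFinset hdeg)
    have : (0 : ℝ) ≤ n ^ 2 := by positivity
    linarith
  · intro X hX
    rcases mem_union.1 hX with hX | hX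
    · exact hF₁E X hX
    · obtain ⟨w, _, rfl⟩ := mem_image.1 hX
      exact filter_subset _ _
  · refine (weight_union_le C F₁ F₂).trans ?_
    rw [pow_one] at hF₂w
    have : (n : ℝ)⁻¹ ≤ 1000⁻¹ := by gcongr
    linarith
  · intro M hME hM
    obtain ⟨a₁, ha₁, b₁, hb₁, a₂, ha₂, b₂, hb₂, ha, hb, h1, h2⟩ :=
      exists_disjoint_crossing (G := G) (A := A) (M := M) (by omega)
        fun w => hM _ (mem_union_right _ (mem_image_of_mem _ (mem_univ w)))
    refine ⟨(twoSidedFrame A a₁ b₁ a₂ b₂).deficit, ?_⟩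
    refine isBoosterMeasure_of_expansion (by omega) G
      (exists_isPath_twoSidedFrame ha₁ ha₂ hb₁ hb₂ ha hb) ?_
      (fun y u => Γ y u ∧ u ∉ ({a₁, b₁, a₂, b₂} : Finset (Fin n))) ?_ (k := n / 64) ?_
      (N := (univ.filter fun p : Fin n × Fin n => p.1 ∈ A ∧ p.2 ∈ A ∧ ¬ G.Adj p.1 p.2) ∪
        (univ.filter fun p : Fin n × Fin n => p.1 ∈ Aᶜ ∧ p.2 ∈ Aᶜ ∧ ¬ G.Adj p.1 p.2)) ?_ ?_
    · intro e he
      simp only [twoSidedFrame, mem_insert, mem_singleton] at he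
      rcases he with rfl | rfl <;> assumption
    · rintro y u ⟨hyu, hu⟩
      refine ⟨mem_sameSide.2 hyu.2, fun e he => ?_⟩
      simp only [twoSidedFrame, mem_insert, mem_singleton] at he
      simp only [mem_insert, mem_singleton, not_or] at hu
      rcases he with rfl | rfl <;> simp [hu]
    · intro U W hU hUk hW
      have hpos := hU.card_pos
      have h4 : ({a₁, b₁, a₂, b₂} : Finset (Fin n)).card ≤ 4 := card_le_four
      -- The four ends of the forced edges are added to `W`; this fits since `3 |U| + 4 ≤ 7 |U|`.
      obtain ⟨y, hy, u, hu, h5, h6⟩ := hF₁ M (fun X hX => hM X (mem_union_left _ hX)) U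
        (W ∪ {a₁, b₁, a₂, b₂}) hU hUk ((card_union_le _ _).trans (by omega))
      rw [mem_union, not_or] at hu
      exact ⟨y, hy, u, hu.1, ⟨h5, hu.2⟩, h6⟩
    · intro x y h1 h2
      rw [twoSidedFrame, mem_sameSide] at h1
      simp only [mem_union, mem_filter, mem_univ, true_and, mem_compl]
      tauto
    -- The missing pairs and the term `2 ε n²` contribute at most `n² / 2 ^ 15` each, together `(n /
    -- 128)²`.
    · have hm1 := card_not_adj_sameSide (by norm_num) hdeg hcutA hA2
      have hm2 := card_not_adj_sameSide (ε₀ := 1 / 2 ^ 18) (A := Aᶜ) (by norm_num) hdeg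
        (by rwa [cutSize_compl]) (by rwa [compl_compl])
      have hk : (n : ℝ) / 128 ≤ ((n / 64 : ℕ) : ℝ) := by
        have : n ≤ 128 * (n / 64) := by omega
        have : (n : ℝ) ≤ 128 * ((n / 64 : ℕ) : ℝ) := by exact_mod_cast this
        linarith
      have hk2 : ((n : ℝ) / 128) ^ 2 ≤ ((n / 64 : ℕ) : ℝ) ^ 2 := by gcongr
      have hle : (((univ.filter fun p : Fin n × Fin n => p.1 ∈ A ∧ p.2 ∈ A ∧ ¬ G.Adj p.1 p.2) ∪
          (univ.filter fun p : Fin n × Fin n => p.1 ∈ Aᶜ ∧ p.2 ∈ Aᶜ ∧ ¬ G.Adj p.1 p.2)).card : ℝ) ≤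
          ((univ.filter fun p : Fin n × Fin n => p.1 ∈ A ∧ p.2 ∈ A ∧ ¬ G.Adj p.1 p.2).card : ℝ) +
          ((univ.filter fun p : Fin n × Fin n => p.1 ∈ Aᶜ ∧ p.2 ∈ Aᶜ ∧ ¬ G.Adj p.1 p.2).card : ℝ) := by
        exact_mod_cast card_union_le _ _
      nlinarith

end SparseCut

/-! ### Random splitting of the vertex set -/

section Splitting

variable {n : ℕ}

/-- Up to the factor `2 ^ n` this is the mean of `c ^ |N \ X|` for uniformly random `X`: each
element of `N` contributes an independent factor of mean `(1 + c) / 2`. -/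
lemma sum_pow_card_sdiff (N : Finset (Fin n)) (c : ℝ) :
    ∑ X : Finset (Fin n), c ^ (N \ X).card = 2 ^ n * ((1 + c) / 2) ^ N.card := by
  have h := prod_add (fun _ : Fin n => (1 : ℝ)) (fun i => if i ∈ N then c else 1) univ
  have h1 : ∀ X : Finset (Fin n), ∏ i ∈ univ \ X, (if i ∈ N then c else 1) = c ^ (N \ X).card := by
    intro X
    rw [prod_ite, prod_const, prod_const_one, mul_one]
    congr 2
    ext i; simp [and_comm]
  simp only [prod_const_one, one_mul, h1, powerset_univ] at h
  rw [← h]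
  have h2 : ∀ i : Fin n, (1 + if i ∈ N then c else 1) = 2 * if i ∈ N then (1 + c) / 2 else 1 := by
    intro i; split_ifs <;> ring
  simp only [h2, prod_mul_distrib, prod_const, card_univ, Fintype.card_fin, prod_ite_mem,
    univ_inter]

/-- Some set contains a positive proportion of given pairs, and misses a positive proportion of
each of given large sets. -/
lemma exists_splitting {E : Finset (Fin n × Fin n)} (hE : E.Nonempty)
    (hoff : ∀ p ∈ E, p.1 ≠ p.2) (N : Fin n → Finset (Fin n))
    (hN : ∀ y, (n : ℝ) * (0.8625 : ℝ) ^ (N y).card ≤ 1 / 8) :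
    ∃ X : Finset (Fin n), E.card ≤ 8 * (E.filter fun p => p.1 ∈ X ∧ p.2 ∈ X).card ∧
      ∀ y, (N y).card ≤ 5 * (N y \ X).card := by
  have hEpos : (0 : ℝ) < E.card := by exact_mod_cast hE.card_pos
  -- A random `X` contains a given pair with probability `1/4`. The subtracted sum is a Chernoff
  -- bound: its terms have mean `(1.15 * 3/4) ^ |N y| = 0.8625 ^ |N y|`, and if `X` fails for `y`,
  -- the term of `y` is at least `1` because `1.15 ^ 5 > 2`, so that `f X ≤ 0`.
  set f : Finset (Fin n) → ℝ := fun X => ((E.filter fun p => p.1 ∈ X ∧ p.2 ∈ X).card : ℝ) -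
    E.card * ∑ y, (1.15 : ℝ) ^ (N y).card * (1 / 2) ^ (N y \ X).card with hf
  have hsum1 : ∑ X : Finset (Fin n), ((E.filter fun p => p.1 ∈ X ∧ p.2 ∈ X).card : ℝ) =
      2 ^ n * (E.card / 4) := by
    -- As `0 ^ 0 = 1`, the power is the indicator of `{p.1, p.2} ⊆ X`.
    have h1 : ∀ X : Finset (Fin n), ((E.filter fun p => p.1 ∈ X ∧ p.2 ∈ X).card : ℝ) =
        ∑ p ∈ E, (0 : ℝ) ^ (({p.1, p.2} : Finset (Fin n)) \ X).card := by
      intro X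
      rw [card_filter, Nat.cast_sum]
      refine sum_congr rfl fun p _ => ?_
      by_cases h : p.1 ∈ X ∧ p.2 ∈ X
      · have : ({p.1, p.2} : Finset (Fin n)) \ X = ∅ := by
          rw [sdiff_eq_empty_iff_subset, insert_subset_iff, singleton_subset_iff]; exact h
        simp [h, this]
      · have : (({p.1, p.2} : Finset (Fin n)) \ X).card ≠ 0 := by
          rw [Ne, card_eq_zero, sdiff_eq_empty_iff_subset, insert_subset_iff,
            singleton_subset_iff]
          exact h
        simp [h, this]
    simp only [h1]
    rw [sum_comm]
    have h2 : ∀ p ∈ E, ∑ X : Finset (Fin n), (0 : ℝ) ^ (({p.1, p.2} : Finset (Fin n)) \ X).card =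
        2 ^ n * (1 / 4) := by
      intro p hp
      rw [sum_pow_card_sdiff, card_pair (hoff p hp)]; norm_num
    rw [sum_congr rfl h2, sum_const, nsmul_eq_mul]; ring
  have hsum2 : ∑ X : Finset (Fin n), ∑ y, (1.15 : ℝ) ^ (N y).card * (1 / 2) ^ (N y \ X).card ≤
      2 ^ n * (1 / 8) := by
    rw [sum_comm]
    have h1 : ∀ y, ∑ X : Finset (Fin n), (1.15 : ℝ) ^ (N y).card * (1 / 2) ^ (N y \ X).card =
        2 ^ n * (0.8625 : ℝ) ^ (N y).card := by
      intro y
      rw [← mul_sum, sum_pow_card_sdiff, mul_left_comm, ← mul_pow]; norm_num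
    simp only [h1, ← mul_sum]
    gcongr
    rcases Nat.eq_zero_or_pos n with rfl | hn
    · simp
    have hn' : (0 : ℝ) < n := by exact_mod_cast hn
    calc ∑ y, (0.8625 : ℝ) ^ (N y).card ≤ ∑ y : Fin n, (1 / 8) / (n : ℝ) := by
          refine sum_le_sum fun y _ => ?_
          rw [le_div_iff₀ hn', mul_comm]; exact hN y
      _ = 1 / 8 := by rw [sum_const, card_univ, Fintype.card_fin, nsmul_eq_mul]; field_simp
  have htot : ∑ X : Finset (Fin n), (E.card : ℝ) / 8 ≤ ∑ X : Finset (Fin n), f X := by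
    have h0 : ∑ X : Finset (Fin n), f X = 2 ^ n * (E.card / 4) -
        E.card * ∑ X : Finset (Fin n), ∑ y, (1.15 : ℝ) ^ (N y).card * (1 / 2) ^ (N y \ X).card := by
      rw [hf, sum_sub_distrib, hsum1, mul_sum]
    have h1 := mul_le_mul_of_nonneg_left hsum2 hEpos.le
    rw [h0, sum_const, card_univ, Fintype.card_finset, Fintype.card_fin, nsmul_eq_mul]
    push_cast
    nlinarith
  obtain ⟨X, _, hX⟩ := exists_le_of_sum_le univ_nonempty htot
  have hg : ∀ y, (0 : ℝ) ≤ (1.15 : ℝ) ^ (N y).card * (1 / 2) ^ (N y \ X).card := fun y => by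
    positivity
  refine ⟨X, ?_, fun y => ?_⟩
  · have h1 : 0 ≤ (E.card : ℝ) * ∑ y, (1.15 : ℝ) ^ (N y).card * (1 / 2) ^ (N y \ X).card :=
      mul_nonneg hEpos.le (sum_nonneg fun y _ => hg y)
    have h2 : (E.card : ℝ) ≤ 8 * ((E.filter fun p => p.1 ∈ X ∧ p.2 ∈ X).card : ℝ) := by
      simp only [hf] at hX; linarith
    exact_mod_cast h2
  · by_contra hlt
    rw [not_le] at hlt
    have h1 : (1 : ℝ) ≤ (1.15 : ℝ) ^ (N y).card * (1 / 2) ^ (N y \ X).card := by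
      calc (1 : ℝ) ≤ ((1.15 : ℝ) ^ 5 * (1 / 2)) ^ (N y \ X).card :=
            one_le_pow₀ (by norm_num)
        _ = (1.15 : ℝ) ^ (5 * (N y \ X).card) * (1 / 2) ^ (N y \ X).card := by
            rw [mul_pow, ← pow_mul]
        _ ≤ _ := by
            gcongr
            norm_num
    have h2 : (1 : ℝ) ≤ ∑ y, (1.15 : ℝ) ^ (N y).card * (1 / 2) ^ (N y \ X).card :=
      h1.trans (single_le_sum (f := fun y => (1.15 : ℝ) ^ (N y).card * (1 / 2) ^ (N y \ X).card)
        (fun y _ => hg y) (mem_univ y))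
    have h3 : ((E.filter fun p => p.1 ∈ X ∧ p.2 ∈ X).card : ℝ) ≤ E.card := by
      exact_mod_cast card_filter_le _ _
    have h4 : (E.card : ℝ) * 1 ≤ E.card *
        ∑ y, (1.15 : ℝ) ^ (N y).card * (1 / 2) ^ (N y \ X).card := by gcongr
    simp only [hf] at hX
    linarith

end Splitting

/-! ### Alternating lists that contain a given matching -/

section Weave

variable {V : Type*}

/-- The vertices of a list of pairs. -/
def pairVerts (l : List (V × V)) : List V := l.flatMap fun p => [p.1, p.2]

/-- Alternate the pairs and the singletons of one side with the vertices of the other side. -/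
def weave : List (V × V) → List V → List V → List V
  | p :: l, as, b :: bs => p.1 :: p.2 :: b :: weave l as bs
  | [], a :: as, b :: bs => a :: b :: weave [] as bs
  | _, _, _ => []

lemma weave_perm : ∀ (l : List (V × V)) (as bs : List V), l.length + as.length = bs.length →
    (weave l as bs).Perm (pairVerts l ++ as ++ bs)
  | p :: l, as, b :: bs, h => by
    have ih := weave_perm l as bs (by simp at h; omega)
    rw [weave]
    simp only [pairVerts, List.flatMap_cons, List.cons_append, List.nil_append]
    refine (((ih.cons b).trans ?_).cons p.2).cons p.1
    exact List.perm_middle.symm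
  | [], a :: as, b :: bs, h => by
    have ih := weave_perm [] as bs (by simp at h ⊢; omega)
    rw [weave]
    refine ((ih.cons b).trans ?_).cons a
    exact List.perm_middle.symm
  | [], [], [], _ => by simp [weave, pairVerts]
  | p :: l, as, [], h => by simp at h
  | [], a :: as, [], h => by simp at h
  | [], [], b :: bs, h => by simp at h

/-- The vertex `c` in front carries the induction: every recursive call is preceded by a vertex
without `p`. -/
lemma weave_spec {p : V → Prop} : ∀ (l : List (V × V)) (as bs : List V),
    (∀ v ∈ pairVerts l, p v) → (∀ v ∈ as, p v) → (∀ v ∈ bs, ¬ p v) → ∀ c, ¬ p c →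
    (∀ e ∈ edgesOf (c :: weave l as bs), (∃ x y, e = s(x, y) ∧ p x ∧ ¬ p y) ∨
      ∃ q ∈ l, e = s(q.1, q.2)) ∧
    (∀ y, (c :: weave l as bs).getLast? = some y → ¬ p y) ∧
    (∀ x, (weave l as bs).head? = some x → p x)
  | q :: l, as, b :: bs, hl, has, hbs, c, hc => by
    simp only [pairVerts, List.flatMap_cons, List.cons_append, List.nil_append, List.mem_cons,
      forall_eq_or_imp] at hl hbs
    obtain ⟨h1, h2, h3⟩ := weave_spec l as bs hl.2.2 has hbs.2 b hbs.1
    rw [weave]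
    refine ⟨fun e he => ?_, fun y hy => h2 y (by simpa using hy), fun x hx => ?_⟩
    · simp only [edgesOf, List.mem_cons] at he
      rcases he with rfl | rfl | rfl | he
      · exact Or.inl ⟨q.1, c, Sym2.eq_swap, hl.1, hc⟩
      · exact Or.inr ⟨q, by simp, rfl⟩
      · exact Or.inl ⟨q.2, b, rfl, hl.2.1, hbs.1⟩
      · rcases h1 e he with h | ⟨q', hq', h⟩
        · exact Or.inl h
        · exact Or.inr ⟨q', by simp [hq'], h⟩
    · simp only [List.head?_cons, Option.some.injEq] at hx
      exact hx ▸ hl.1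
  | [], a :: as, b :: bs, hl, has, hbs, c, hc => by
    simp only [List.mem_cons, forall_eq_or_imp] at has hbs
    obtain ⟨h1, h2, h3⟩ := weave_spec [] as bs hl has.2 hbs.2 b hbs.1
    rw [weave]
    refine ⟨fun e he => ?_, fun y hy => h2 y (by simpa using hy), fun x hx => ?_⟩
    · simp only [edgesOf, List.mem_cons] at he
      rcases he with rfl | rfl | he
      · exact Or.inl ⟨a, c, Sym2.eq_swap, has.1, hc⟩
      · exact Or.inl ⟨a, b, rfl, has.1, hbs.1⟩
      · exact h1 e he
    · simp only [List.head?_cons, Option.some.injEq] at hx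
      exact hx ▸ has.1
  | [], [], bs, _, _, _, c, hc => by
    simp [weave, edgesOf, hc]
  | q :: l, as, [], _, _, _, c, hc => by
    simp [weave, edgesOf, hc]
  | [], a :: as, [], _, _, _, c, hc => by
    simp [weave, edgesOf, hc]

lemma mem_edgesOf_cons {P : List V} {e : Sym2 V} (h : e ∈ edgesOf P) (c : V) :
    e ∈ edgesOf (c :: P) := by
  cases P with
  | nil => simp [edgesOf] at h
  | cons a P => exact List.mem_cons_of_mem _ h

lemma pair_mem_edgesOf_weave : ∀ (l : List (V × V)) (as bs : List V), l.length ≤ bs.length →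
    ∀ q ∈ l, s(q.1, q.2) ∈ edgesOf (weave l as bs)
  | q :: l, as, b :: bs, h, q', hq' => by
    rw [weave]
    rcases List.mem_cons.1 hq' with rfl | hq'
    · simp [edgesOf]
    · have := pair_mem_edgesOf_weave l as bs (by simpa using h) q' hq'
      exact mem_edgesOf_cons (mem_edgesOf_cons (mem_edgesOf_cons this _) _) _
  | q :: l, as, [], h, _, _ => by simp at h

end Weave

/-! ### Graphs close to a balanced complete bipartite graph -/

section LargeCut

variable {n : ℕ} {G : SimpleGraph (Fin n)} [DecidableRel G.Adj]

lemma cutSize_le (A : Finset (Fin n)) : cutSize G A ≤ A.card * Aᶜ.card := by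
  rw [← smul_eq_mul]
  exact sum_le_card_nsmul _ _ _ fun a _ => card_le_card inter_subset_right

/-- If there is a cut containing almost `n ^ 2 / 4` edges, then there is a partition into almost
equal parts, with almost complete bipartite graph, many neighbours across for each vertex, and
either nearly equal parts, or few neighbours in the larger part for each of its vertices. -/
lemma exists_large_cut {σ : ℝ} (hσ0 : 0 < σ) (hσ : σ ≤ 1 / 1024) (hdeg : ∀ v, n ≤ 2 * G.degree v)
    {T : Finset (Fin n)} (hT : (n : ℝ) ^ 2 / 4 - σ ^ 2 * n ^ 2 ≤ cutSize G T) :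
    ∃ (A : Finset (Fin n)) (r : ℕ), A.card = Aᶜ.card + r ∧ (r : ℝ) ≤ 2 * σ * n ∧
      (∀ v ∈ A, n ≤ 4 * (G.neighborFinset v ∩ Aᶜ).card) ∧
      (∀ v ∉ A, n ≤ 512 * (G.neighborFinset v ∩ A).card) ∧
      (∀ v ∈ A, r ≤ 2 * (G.neighborFinset v ∩ A).card) ∧
      (2 ≤ r → ∀ v ∈ A, 256 * (G.neighborFinset v ∩ A).card ≤ n) ∧
      ((univ.filter fun p : Fin n × Fin n => p.1 ∈ A ∧ p.2 ∈ Aᶜ ∧ ¬ G.Adj p.1 p.2).card : ℝ) ≤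
        2 * σ * n ^ 2 := by
  obtain ⟨A₀, hcut, hbig, hmax⟩ : ∃ A₀ : Finset (Fin n),
      (n : ℝ) ^ 2 / 4 - σ ^ 2 * n ^ 2 ≤ cutSize G A₀ ∧ A₀ᶜ.card ≤ A₀.card ∧
      ∀ B : Finset (Fin n), cutSize G B ≤ cutSize G A₀ := by
    obtain ⟨A, -, hA⟩ := exists_max_image (univ : Finset (Finset (Fin n))) (cutSize G) ⟨T, mem_univ T⟩
    have h1 : (n : ℝ) ^ 2 / 4 - σ ^ 2 * n ^ 2 ≤ cutSize G A :=
      hT.trans (by exact_mod_cast hA T (mem_univ T))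
    rcases le_total Aᶜ.card A.card with h | h
    · exact ⟨A, h1, h, fun B => hA B (mem_univ B)⟩
    · refine ⟨Aᶜ, by rwa [cutSize_compl], by rwa [compl_compl], fun B => ?_⟩
      rw [cutSize_compl]; exact hA B (mem_univ B)
  have hc : A₀.card + A₀ᶜ.card = n := by rw [card_add_card_compl, Fintype.card_fin]
  have hcr : (A₀.card : ℝ) + A₀ᶜ.card = n := by exact_mod_cast hc
  have hlocal : ∀ (B : Finset (Fin n)), (∀ B' : Finset (Fin n), cutSize G B' ≤ cutSize G B) →
      ∀ v ∈ B, n ≤ 4 * (G.neighborFinset v ∩ Bᶜ).card := by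
    intro B hB v hv
    have h1 := cutSize_erase G hv
    have h2 := hB (B.erase v)
    have h3 := card_inter_add_card_inter_compl G B v
    have h4 := hdeg v
    omega
  have hl1 := hlocal A₀ hmax
  have hl2 : ∀ v ∉ A₀, n ≤ 4 * (G.neighborFinset v ∩ A₀).card := by
    intro v hv
    have := hlocal A₀ᶜ (fun B => by rw [cutSize_compl]; exact hmax B) v (mem_compl.2 hv)
    rwa [compl_compl] at this
  set m := A₀.card - A₀ᶜ.card with hm
  have hn0 : (0 : ℝ) ≤ n := by positivity
  have hprod : (cutSize G A₀ : ℝ) ≤ A₀.card * A₀ᶜ.card := by exact_mod_cast cutSize_le A₀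
  have hmr : (m : ℝ) = A₀.card - A₀ᶜ.card := by rw [hm, Nat.cast_sub hbig]
  -- Since `m² = n² - 4 |A₀| |A₀ᶜ|`, a large cut forces nearly equal sides.
  have hmσ : (m : ℝ) ≤ 2 * σ * n := by
    refine le_of_sq_le_sq ?_ (by positivity)
    rw [hmr]
    nlinarith
  -- Vertices of `A₀` with many neighbours inside `A₀` are moved across until none is left or the
  -- sizes differ by at most one; `2 ≤ r` excludes the latter. At most `n / 1024` vertices move, so
  -- a moved vertex still has at least `n / 512` neighbours in the remaining part of `A₀`.
  set Z := A₀.filter fun v => n < 256 * (G.neighborFinset v ∩ A₀).card with hZ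
  obtain ⟨Z', hZ'Z, hZ'c⟩ := exists_subset_card_eq (s := Z) (n := min Z.card (m / 2)) (min_le_left _ _)
  have hZ'A : Z' ⊆ A₀ := hZ'Z.trans (filter_subset _ _)
  set q := Z'.card with hq
  have hqm : 2 * q ≤ m := by
    have := min_le_right Z.card (m / 2); omega
  have hqσ : (q : ℝ) ≤ σ * n := by
    have : (2 : ℝ) * q ≤ m := by exact_mod_cast hqm
    linarith
  have hq1024 : 1024 * q ≤ n := by
    have h1 : σ * n ≤ 1 / 1024 * n := by gcongr
    have : (1024 : ℝ) * q ≤ n := by linarith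
    exact_mod_cast this
  have hAc : (A₀ \ Z').card = A₀.card - q := card_sdiff_of_subset hZ'A
  have hcompl : (A₀ \ Z')ᶜ = A₀ᶜ ∪ Z' := by
    rw [sdiff_eq_inter_compl, compl_inter, compl_compl]
  have hAcc : (A₀ \ Z')ᶜ.card = A₀ᶜ.card + q := by
    rw [hcompl, card_union_of_disjoint]
    exact disjoint_left.2 fun x hx hx' => (mem_compl.1 hx) (hZ'A hx')
  have hqA : q ≤ A₀.card := card_le_card hZ'A
  have hnbr : ∀ v, (G.neighborFinset v ∩ A₀).card ≤ (G.neighborFinset v ∩ (A₀ \ Z')).card + q := by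
    intro v
    rw [← inter_sdiff_assoc]
    have := le_card_sdiff Z' (G.neighborFinset v ∩ A₀)
    omega
  refine ⟨A₀ \ Z', m - 2 * q, by omega, ?_, ?_, ?_, ?_, ?_, ?_⟩
  · exact le_trans (by exact_mod_cast Nat.sub_le _ _) hmσ
  · intro v hv
    refine (hl1 v (mem_sdiff.1 hv).1).trans ?_
    gcongr
    exact sdiff_subset
  · intro v hv
    have h1 := hnbr v
    by_cases hvA : v ∈ A₀
    · have hvZ : v ∈ Z' := by
        by_contra h; exact hv (mem_sdiff.2 ⟨hvA, h⟩)
      have := (mem_filter.1 (hZ'Z hvZ)).2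
      omega
    · have := hl2 v hvA
      omega
  · intro v _
    -- The degree of `v` is at least `n / 2`, but the other side has only `(n - r) / 2` vertices.
    have h1 := card_inter_add_card_inter_compl G (A₀ \ Z') v
    have h2 : (G.neighborFinset v ∩ (A₀ \ Z')ᶜ).card ≤ (A₀ \ Z')ᶜ.card :=
      card_le_card inter_subset_right
    have h3 := hdeg v
    omega
  · intro hr v hv
    obtain ⟨hvA, hvZ'⟩ := mem_sdiff.1 hv
    have hZc : Z'.card = Z.card := by
      rcases le_total Z.card (m / 2) with h | h
      · exact hZ'c.trans (min_eq_left h)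
      · have := hZ'c.trans (min_eq_right h)
        omega
    have hZZ : Z' = Z := eq_of_subset_of_card_le hZ'Z hZc.ge
    have hvZ : ¬ n < 256 * (G.neighborFinset v ∩ A₀).card := fun h =>
      hvZ' (hZZ ▸ mem_filter.2 ⟨hvA, h⟩)
    have h1 : (G.neighborFinset v ∩ (A₀ \ Z')).card ≤ (G.neighborFinset v ∩ A₀).card :=
      card_le_card (inter_subset_inter_left sdiff_subset)
    omega
  · have h1 := card_filter_not_adj (G := G) A₀ A₀ᶜ
    have h1' : ((univ.filter fun p : Fin n × Fin n =>
        p.1 ∈ A₀ ∧ p.2 ∈ A₀ᶜ ∧ ¬ G.Adj p.1 p.2).card : ℝ) + cutSize G A₀ =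
        A₀.card * A₀ᶜ.card := by exact_mod_cast h1
    have h2 : (univ.filter fun p : Fin n × Fin n =>
        p.1 ∈ A₀ \ Z' ∧ p.2 ∈ (A₀ \ Z')ᶜ ∧ ¬ G.Adj p.1 p.2).card ≤ (univ.filter fun p : Fin n × Fin n =>
        p.1 ∈ A₀ ∧ p.2 ∈ A₀ᶜ ∧ ¬ G.Adj p.1 p.2).card + n * q := by
      calc _ ≤ ((univ.filter fun p : Fin n × Fin n =>
          p.1 ∈ A₀ ∧ p.2 ∈ A₀ᶜ ∧ ¬ G.Adj p.1 p.2) ∪ (univ ×ˢ Z')).card := by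
            refine card_le_card fun p hp => ?_
            rw [hcompl] at hp
            simp only [mem_filter, mem_univ, true_and, mem_sdiff, mem_union, mem_product,
              mem_compl] at hp ⊢
            tauto
        _ ≤ _ := by
            refine (card_union_le _ _).trans ?_
            rw [card_product, card_univ, Fintype.card_fin]
    have h2' : ((univ.filter fun p : Fin n × Fin n =>
        p.1 ∈ A₀ \ Z' ∧ p.2 ∈ (A₀ \ Z')ᶜ ∧ ¬ G.Adj p.1 p.2).card : ℝ) ≤
        (univ.filter fun p : Fin n × Fin n =>
        p.1 ∈ A₀ ∧ p.2 ∈ A₀ᶜ ∧ ¬ G.Adj p.1 p.2).card + n * q := by exact_mod_cast h2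
    have h3 : (A₀.card : ℝ) * A₀ᶜ.card ≤ n ^ 2 / 4 := by
      rw [← hcr]; nlinarith [sq_nonneg ((A₀.card : ℝ) - A₀ᶜ.card)]
    have h4 : (n : ℝ) * q ≤ σ * n ^ 2 := by nlinarith
    have h5 : σ ^ 2 * (n : ℝ) ^ 2 ≤ σ * n ^ 2 := by
      gcongr
      nlinarith
    linarith

variable (G) in
/-- The edges within `X` which avoid `W`. -/
def inner (X W : Finset (Fin n)) : Finset (Sym2 (Fin n)) :=
  G.edgeFinset.filter fun e => ∃ a ∈ X, ∃ b ∈ X, a ∉ W ∧ b ∉ W ∧ e = s(a, b)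

/-- Each vertex of `W` spoils at most `Δ` pairs in either coordinate; an inner edge accounts for at
most two of the remaining pairs. -/
lemma card_filter_le_two_mul_card_inner {A X W : Finset (Fin n)} {Δ : ℕ}
    (hΔ : ∀ v ∈ W, v ∈ A → (G.neighborFinset v ∩ A).card ≤ Δ) :
    ((univ.filter fun p : Fin n × Fin n => p.1 ∈ A ∧ p.2 ∈ A ∧ G.Adj p.1 p.2).filter
      fun p => p.1 ∈ X ∧ p.2 ∈ X).card ≤ 2 * (inner G (X ∩ A) W).card + 2 * (Δ * W.card) := by
  set E := univ.filter fun p : Fin n × Fin n => p.1 ∈ A ∧ p.2 ∈ A ∧ G.Adj p.1 p.2 with hE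
  have h1 : ((E.filter fun p => p.1 ∈ X ∧ p.2 ∈ X).filter fun p => p.1 ∉ W ∧ p.2 ∉ W).card ≤
      2 * (inner G (X ∩ A) W).card := by
    refine (card_le_two_mul_card_image_sym2 _).trans (Nat.mul_le_mul_left 2 (card_le_card ?_))
    intro e he
    obtain ⟨p, hp, rfl⟩ := mem_image.1 he
    simp only [hE, mem_filter, mem_univ, true_and] at hp
    refine mem_filter.2 ⟨by simpa using hp.1.1.2.2, p.1, ?_, p.2, ?_, hp.2.1, hp.2.2, rfl⟩
    · exact mem_inter.2 ⟨hp.1.2.1, hp.1.1.1⟩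
    · exact mem_inter.2 ⟨hp.1.2.2, hp.1.1.2.1⟩
  have h2 : (E.filter fun p => p.1 ∈ W).card ≤ Δ * W.card := by
    refine (card_le_mul_card_image (f := Prod.fst) _ Δ ?_).trans
      (Nat.mul_le_mul_left _ (card_le_card ?_))
    · intro v hv
      obtain ⟨p, hp, rfl⟩ := mem_image.1 hv
      simp only [hE, mem_filter, mem_univ, true_and] at hp
      refine le_trans (card_le_card_of_injOn Prod.snd ?_ ?_) (hΔ p.1 hp.2 hp.1.1)
      · rintro ⟨a, b⟩ hab
        simp only [hE, coe_filter, mem_filter, mem_univ, true_and, Set.mem_ofPred_eq] at hab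
        rw [← hab.2]
        simpa using ⟨hab.1.1.2.2, hab.1.1.2.1⟩
      · rintro ⟨a, b⟩ hab ⟨c, d⟩ hcd h
        simp only [hE, coe_filter, mem_filter, mem_univ, true_and, Set.mem_ofPred_eq] at hab hcd
        exact Prod.ext (hab.2.trans hcd.2.symm) h
    · intro v hv
      obtain ⟨p, hp, rfl⟩ := mem_image.1 hv
      exact (mem_filter.1 hp).2
  have h3 : (E.filter fun p => p.2 ∈ W).card ≤ Δ * W.card := by
    refine le_trans (card_le_card_of_injOn Prod.swap ?_ Prod.swap_injective.injOn) h2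
    rintro ⟨a, b⟩ hab
    simp only [hE, coe_filter, mem_filter, mem_univ, true_and, Set.mem_ofPred_eq] at hab
    simp only [hE, coe_filter, mem_filter, mem_univ, true_and, Set.mem_ofPred_eq, Prod.swap]
    exact ⟨⟨hab.1.2.1, hab.1.1, hab.1.2.2.symm⟩, hab.2⟩
  have h4 : E.filter (fun p => p.1 ∈ X ∧ p.2 ∈ X) ⊆
      ((E.filter fun p => p.1 ∈ X ∧ p.2 ∈ X).filter fun p => p.1 ∉ W ∧ p.2 ∉ W) ∪
      ((E.filter fun p => p.1 ∈ W) ∪ (E.filter fun p => p.2 ∈ W)) := by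
    intro p hp
    simp only [mem_union, mem_filter] at hp ⊢
    tauto
  have h5 := card_le_card h4
  have h6 := card_union_le ((E.filter fun p => p.1 ∈ X ∧ p.2 ∈ X).filter fun p => p.1 ∉ W ∧ p.2 ∉ W)
    ((E.filter fun p => p.1 ∈ W) ∪ (E.filter fun p => p.2 ∈ W))
  have h7 := card_union_le (E.filter fun p => p.1 ∈ W) (E.filter fun p => p.2 ∈ W)
  omega

lemma length_pairVerts {V : Type*} (l : List (V × V)) : (pairVerts l).length = 2 * l.length := by
  induction l with
  | nil => rfl
  | cons p l ih => simp [pairVerts] at ih ⊢; omega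

/-- A set of edges which hits the inner edges avoiding any small set contains a matching. -/
lemma exists_matching {X : Finset (Fin n)} {M : Finset (Sym2 (Fin n))} {r : ℕ} (hr : 2 * r ≤ n)
    (hM : ∀ W : Finset (Fin n), W.card = 2 * (r - 1) → (inner G X W ∩ M).Nonempty) :
    ∀ j ≤ r, ∃ l : List (Fin n × Fin n), l.length = j ∧ (pairVerts l).Nodup ∧
      (∀ v ∈ pairVerts l, v ∈ X) ∧ ∀ q ∈ l, s(q.1, q.2) ∈ M := by
  intro j
  induction j with
  | zero => exact fun _ => ⟨[], rfl, List.nodup_nil, by simp [pairVerts], by simp⟩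
  | succ j ih =>
    intro hj
    obtain ⟨l, h1, h2, h3, h4⟩ := ih (by omega)
    -- Greedy choice: the next edge avoids the at most `2 (r - 1)` vertices used so far.
    have hcard : (pairVerts l).toFinset.card ≤ 2 * (r - 1) := by
      rw [List.toFinset_card_of_nodup h2, length_pairVerts]; omega
    obtain ⟨W, hW, -, hWc⟩ := exists_subsuperset_card_eq (subset_univ _) hcard
      (by rw [card_univ, Fintype.card_fin]; omega)
    obtain ⟨e, he⟩ := hM W hWc
    obtain ⟨he, heM⟩ := mem_inter.1 he
    obtain ⟨heE, a, ha, b, hb, haW, hbW, rfl⟩ := mem_filter.1 he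
    have hab : a ≠ b := by
      have : G.Adj a b := by simpa using heE
      exact this.ne
    have ha' : a ∉ pairVerts l := fun h => haW (hW (List.mem_toFinset.2 h))
    have hb' : b ∉ pairVerts l := fun h => hbW (hW (List.mem_toFinset.2 h))
    have hcons : pairVerts ((a, b) :: l) = a :: b :: pairVerts l := rfl
    refine ⟨(a, b) :: l, by simp [h1], ?_, ?_, ?_⟩
    · rw [hcons, List.nodup_cons, List.nodup_cons, List.mem_cons, not_or]
      exact ⟨⟨hab, ha'⟩, hb', h2⟩
    · intro v hv
      rw [hcons] at hv
      rcases List.mem_cons.1 hv with rfl | hv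
      · exact ha
      rcases List.mem_cons.1 hv with rfl | hv
      · exact hb
      exact h3 v hv
    · intro q hq
      rcases List.mem_cons.1 hq with rfl | hq
      · exact heM
      · exact h4 q hq

/-- The pairs of vertices on different sides of a partition. -/
def otherSide (A : Finset (Fin n)) : Set (Sym2 (Fin n)) :=
  Sym2.fromRel (r := fun x y => (x ∈ A ↔ y ∉ A)) ⟨fun _ _ h => by tauto⟩

lemma mem_otherSide {A : Finset (Fin n)} {x y : Fin n} :
    s(x, y) ∈ otherSide A ↔ (x ∈ A ↔ y ∉ A) := Sym2.fromRel_prop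

/-- The frame of the Hamilton cycles which contain the edges of a matching, and otherwise cross a
partition. -/
def crossingFrame (A : Finset (Fin n)) (l : List (Fin n × Fin n)) : Frame (Fin n) where
  adm := otherSide A
  forced := (l.map fun q => s(q.1, q.2)).toFinset
  trans a b c d h1 h2 h3 := by rw [mem_otherSide] at *; tauto

/-- Treating each matching edge as one vertex makes the sides equally large, so the cycle can
alternate. -/
lemma exists_isPath_crossingFrame {A : Finset (Fin n)} {l : List (Fin n × Fin n)}
    (hA : A.card = Aᶜ.card + l.length) (hne : Aᶜ.Nonempty) (hl : (pairVerts l).Nodup)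
    (hlA : ∀ v ∈ pairVerts l, v ∈ A) : ∃ P, (crossingFrame A l).IsPath P := by
  set as := (A \ (pairVerts l).toFinset).toList with has
  set bs := Aᶜ.toList with hbs
  have hasA : ∀ v, v ∈ as ↔ v ∈ A ∧ v ∉ pairVerts l := fun v => by simp [has]
  have hbsA : ∀ v, v ∈ bs ↔ v ∉ A := fun v => by simp [hbs]
  have hsub : (pairVerts l).toFinset ⊆ A := fun v hv => hlA v (List.mem_toFinset.1 hv)
  have hlen : l.length + as.length = bs.length := by
    have h1 := card_le_card hsub
    rw [List.toFinset_card_of_nodup hl, length_pairVerts] at h1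
    rw [has, hbs, length_toList, length_toList, card_sdiff_of_subset hsub,
      List.toFinset_card_of_nodup hl, length_pairVerts]
    omega
  have hperm := weave_perm l as bs hlen
  obtain ⟨c, hc⟩ := hne
  rw [mem_compl] at hc
  obtain ⟨h1, h2, h3⟩ := weave_spec (p := fun v => v ∈ A) l as bs hlA
    (fun v hv => ((hasA v).1 hv).1) (fun v hv => (hbsA v).1 hv) c hc
  have hnd : (pairVerts l ++ as ++ bs).Nodup := by
    rw [List.nodup_append, List.nodup_append]
    refine ⟨⟨hl, nodup_toList _, ?_⟩, nodup_toList _, ?_⟩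
    · rintro a ha b hb rfl
      exact ((hasA a).1 hb).2 ha
    · rintro a ha b hb rfl
      refine (hbsA a).1 hb ?_
      rcases List.mem_append.1 ha with h | h
      · exact hlA a h
      · exact ((hasA a).1 h).1
  refine ⟨weave l as bs, hperm.nodup_iff.2 hnd, fun v => hperm.mem_iff.2 ?_, ?_, ?_, ?_⟩
  · simp only [List.mem_append, hasA, hbsA]
    have := hlA v
    tauto
  · intro e he
    rcases h1 e (mem_edgesOf_cons he c) with ⟨x, y, rfl, hx, hy⟩ | ⟨q, hq, rfl⟩
    · left; rw [crossingFrame, mem_otherSide]; tauto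
    · right
      exact List.mem_toFinset.2 (List.mem_map.2 ⟨q, hq, rfl⟩)
  · intro e he
    obtain ⟨q, hq, rfl⟩ := List.mem_map.1 (List.mem_toFinset.1 he)
    exact pair_mem_edgesOf_weave l as bs (by omega) q hq
  · intro x y hx hy
    have h4 := h3 x hx
    have h5 := h2 y (by rw [List.getLast?_cons, hy]; rfl)
    rw [crossingFrame, mem_otherSide]; tauto

/-- Hitting a suitable light family yields a matching of given size in a suitable set `X`. -/
lemma exists_matching_family (hn : 1 ≤ n) {A : Finset (Fin n)} {r : ℕ} (hr : 2 * r ≤ n)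
    (hA : n ≤ 2 * A.card) (hdegA : ∀ v ∈ A, r ≤ 2 * (G.neighborFinset v ∩ A).card)
    (hΔ : 2 ≤ r → ∀ v ∈ A, 256 * (G.neighborFinset v ∩ A).card ≤ n)
    (N : Fin n → Finset (Fin n)) (hN : ∀ y, (n : ℝ) * (0.8625 : ℝ) ^ (N y).card ≤ 1 / 8)
    {C : ℝ} (hC : 256 ≤ C) :
    ∃ X ⊆ A, (∀ y, (N y).card ≤ 5 * (N y \ X).card) ∧
      ∃ F : Finset (Finset (Sym2 (Fin n))), (∀ Y ∈ F, Y ⊆ G.edgeFinset) ∧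
        weight n C F ≤ (n : ℝ)⁻¹ ∧ ∀ M : Finset (Sym2 (Fin n)), (∀ Y ∈ F, (Y ∩ M).Nonempty) →
          ∃ l : List (Fin n × Fin n), l.length = r ∧ (pairVerts l).Nodup ∧
            (∀ v ∈ pairVerts l, v ∈ X) ∧ ∀ q ∈ l, s(q.1, q.2) ∈ M := by
  rcases Nat.eq_zero_or_pos r with rfl | hrpos
  · refine ⟨∅, empty_subset _, fun y => by simp; omega, ∅, by simp, ?_, fun M _ =>
      ⟨[], rfl, List.nodup_nil, by simp [pairVerts], by simp⟩⟩
    rw [weight, sum_empty]; positivity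
  set E := univ.filter fun p : Fin n × Fin n => p.1 ∈ A ∧ p.2 ∈ A ∧ G.Adj p.1 p.2 with hE
  have hEc : E.card = ∑ a ∈ A, (G.neighborFinset a ∩ A).card := by
    have h1 : E = (A ×ˢ A).filter fun p => G.Adj p.1 p.2 := by
      ext p; simp [hE, and_assoc]
    rw [h1, card_filter, sum_product]
    refine sum_congr rfl fun a _ => ?_
    rw [sum_boole, Nat.cast_id]
    congr 1
    ext b; simp [and_comm]
  have hE4 : n * r ≤ 4 * E.card := by
    have h1 : A.card * r ≤ 2 * E.card := by
      rw [hEc, mul_sum, ← smul_eq_mul]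
      exact card_nsmul_le_sum _ _ _ fun a ha => hdegA a ha
    nlinarith
  have hEne : E.Nonempty := by
    rw [← card_pos]
    by_contra h
    have : n * r = 0 := by omega
    rcases Nat.mul_eq_zero.1 this with h | h <;> omega
  -- The matching may have linear size, too large for the sets `W` of the expansion family. It is
  -- therefore confined to a set `X`, fixed in advance, which pivots can avoid.
  obtain ⟨X, hX, hXN⟩ := exists_splitting hEne (fun p hp => by
    simp only [hE, mem_filter] at hp
    exact hp.2.2.2.ne) N hN
  refine ⟨X ∩ A, inter_subset_right, fun y => (hXN y).trans ?_,
    (powersetCard (2 * (r - 1)) univ).image (inner G (X ∩ A)), ?_, ?_, ?_⟩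
  · gcongr
    exact inter_subset_left
  · intro Y hY
    obtain ⟨W, _, rfl⟩ := mem_image.1 hY
    exact filter_subset _ _
  · refine (weight_le hn (by linarith) (m := 2 * (r - 1)) (p := 1) (a := (n : ℝ) * r / 128)
      ?_ ?_ ?_).trans (by rw [pow_one])
    · refine card_image_le.trans ?_
      rw [card_powersetCard, card_univ, Fintype.card_fin]
      exact Nat.choose_le_pow _ _
    · intro Y hY
      obtain ⟨W, hW, rfl⟩ := mem_image.1 hY
      have hWc := (mem_powersetCard.1 hW).2
      -- At least `nr / 32` ordered adjacent pairs lie in `X ∩ A`. Removing `W` costs at most `nr /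
      -- 64` of them, and nothing if `r = 1`.
      have h1 : n * r ≤ 128 * (inner G (X ∩ A) W).card := by
        rcases Nat.lt_or_ge r 2 with hr1 | hr2
        · have hr1 : r = 1 := by omega
          have hW0 : W = ∅ := by rw [← card_eq_zero, hWc, hr1]
          have := card_filter_le_two_mul_card_inner (G := G) (A := A) (X := X) (W := W) (Δ := 0)
            (by simp [hW0])
          rw [← hE, Nat.zero_mul] at this
          rw [hr1] at hE4 ⊢
          omega
        · have := card_filter_le_two_mul_card_inner (G := G) (A := A) (X := X) (W := W)
            (Δ := n / 256) (fun v _ hv => by have := hΔ hr2 v hv; omega)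
          rw [← hE] at this
          have h2 : 256 * (n / 256 * W.card) ≤ n * (2 * r) := by
            have h3 : W.card ≤ 2 * r := by omega
            have h4 : 256 * (n / 256) ≤ n := by omega
            calc 256 * (n / 256 * W.card) = 256 * (n / 256) * W.card := by ring
              _ ≤ n * (2 * r) := Nat.mul_le_mul h4 h3
          have h3 : n * (2 * r) = 2 * (n * r) := by ring
          omega
      have h2 : (n : ℝ) * r ≤ 128 * (inner G (X ∩ A) W).card := by exact_mod_cast h1
      linarith
    · have h1 : ((2 * (r - 1) : ℕ) : ℝ) + 1 ≤ 2 * r := by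
        have : 2 * (r - 1) + 1 ≤ 2 * r := by omega
        exact_mod_cast this
      have h2 : (0 : ℝ) ≤ n * r := by positivity
      calc (((2 * (r - 1) : ℕ) : ℝ) + (1 : ℕ)) * n ≤ 2 * r * n := by
            push_cast at h1 ⊢; gcongr
        _ = 256 * (n * r / 128) := by ring
        _ ≤ C * (n * r / 128) := by gcongr
  · intro M hM
    refine exists_matching (G := G) (M := M) hr (fun W hW => ?_) r le_rfl
    exact hM _ (mem_image_of_mem _ (mem_powersetCard.2 ⟨subset_univ _, hW⟩))

/-- Graphs of large minimum degree with an almost complete balanced cut are robust. -/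
theorem robust_of_large_cut (hn : 10 ^ 6 ≤ n) (hdeg : ∀ v, n ≤ 2 * G.degree v)
    (hdecay : ∀ k : ℕ, n ≤ 512 * k → (n : ℝ) * (0.8625 : ℝ) ^ k ≤ 1 / 8)
    {T : Finset (Fin n)} (hT : (n : ℝ) ^ 2 / 4 - (1 / 2 ^ 37) ^ 2 * n ^ 2 ≤ cutSize G T)
    {C : ℝ} (hC : 2 ^ 17 ≤ C) : Robust G C (1 / 2 ^ 36) := by
  have hn0 : (10 ^ 6 : ℝ) ≤ n := by exact_mod_cast hn
  obtain ⟨A, r, hAr, hrσ, hA1, hA2, hA3, hA4, hmiss⟩ :=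
    exists_large_cut (by norm_num) (by norm_num) hdeg hT
  have hc : A.card + Aᶜ.card = n := by rw [card_add_card_compl, Fintype.card_fin]
  have hrn : 4 * r ≤ n := by
    have : (4 : ℝ) * r ≤ n := by norm_num at hrσ ⊢; linarith
    exact_mod_cast this
  obtain ⟨X, hXA, hXN, F₂, hF₂E, hF₂w, hF₂⟩ := exists_matching_family (G := G) (A := A) (r := r)
    (by omega) (by omega) (by omega) hA3 hA4
    -- For `y ∈ A` the neighbours across avoid `X ⊆ A` anyway, so `univ` only serves to meet the
    -- size condition.
    (fun y => if y ∈ A then univ else G.neighborFinset y ∩ A)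
    (fun y => by
      refine hdecay _ ?_
      split_ifs with h
      · simp; omega
      · exact hA2 y h) (C := C) (le_trans (by norm_num) hC)
  let Γ : Fin n → Fin n → Prop := fun y u => G.Adj y u ∧ (y ∈ A ↔ u ∉ A) ∧ u ∉ X
  -- One fifth of the at least `n / 512` neighbours in `A` survives the removal of `X`.
  have hΓd : ∀ y, ∃ N : Finset (Fin n), n / 2560 ≤ N.card ∧ ∀ u ∈ N, Γ y u := by
    intro y
    by_cases hy : y ∈ A
    · have h1 := hA1 y hy
      refine ⟨G.neighborFinset y ∩ Aᶜ, by omega, fun u hu => ?_⟩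
      simp only [mem_inter, SimpleGraph.mem_neighborFinset, mem_compl] at hu
      exact ⟨hu.1, by simp [hy, hu.2], fun h => hu.2 (hXA h)⟩
    · have h1 := hA2 y hy
      have h2 := hXN y
      simp only [hy, if_false] at h2
      refine ⟨(G.neighborFinset y ∩ A) \ X, by omega, fun u hu => ?_⟩
      simp only [mem_sdiff, mem_inter, SimpleGraph.mem_neighborFinset] at hu
      exact ⟨hu.1.1, by simp [hy, hu.1.2], hu.2⟩
  have hd : (n : ℝ) / 5120 ≤ ((n / 2560 : ℕ) : ℝ) := by
    have : n ≤ 5120 * (n / 2560) := by omega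
    have : (n : ℝ) ≤ 5120 * ((n / 2560 : ℕ) : ℝ) := by exact_mod_cast this
    linarith
  obtain ⟨F₁, hF₁E, hF₁w, hF₁⟩ := exists_expansion_family (by omega) G (Γ := Γ) (fun _ _ h => h.1)
    (d := n / 2560) (k := n / 40960) (by omega) hΓd (le_trans (by norm_num) hC)
    (by
      have h1 : (2 : ℝ) ^ 17 * (n / 5120) ≤ C * ((n / 2560 : ℕ) : ℝ) := by gcongr
      norm_num at h1 ⊢; linarith)
  refine ⟨?_, F₁ ∪ F₂, ?_, ?_, ?_⟩
  · refine le_trans ?_ (sq_le_card_edgeFinset hdeg)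
    have : (0 : ℝ) ≤ n ^ 2 := by positivity
    linarith
  · intro Y hY
    rcases mem_union.1 hY with hY | hY
    · exact hF₁E Y hY
    · exact hF₂E Y hY
  · refine (weight_union_le C F₁ F₂).trans ?_
    have : (n : ℝ)⁻¹ ≤ (10 ^ 6)⁻¹ := by gcongr
    norm_num at this
    linarith
  · intro M hME hM
    obtain ⟨l, hl1, hl2, hl3, hl4⟩ := hF₂ M fun Y hY => hM Y (mem_union_right _ hY)
    refine ⟨(crossingFrame A l).deficit, isBoosterMeasure_of_expansion (by omega) G
      (exists_isPath_crossingFrame (by omega) (card_pos.1 (by omega)) hl2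
        fun v hv => hXA (hl3 v hv)) ?_ Γ ?_ (k := n / 40960) ?_
      (N := (univ.filter fun p : Fin n × Fin n => p.1 ∈ A ∧ p.2 ∈ Aᶜ ∧ ¬ G.Adj p.1 p.2) ∪
        (univ.filter fun p : Fin n × Fin n => p.1 ∈ A ∧ p.2 ∈ Aᶜ ∧ ¬ G.Adj p.1 p.2).image
          Prod.swap) ?_ ?_⟩
    · intro e he
      obtain ⟨q, hq, rfl⟩ := List.mem_map.1 (List.mem_toFinset.1 he)
      exact hl4 q hq
    · rintro y u ⟨_, h2, h3⟩
      refine ⟨mem_otherSide.2 h2, fun e he hue => h3 ?_⟩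
      obtain ⟨q, hq, rfl⟩ := List.mem_map.1 (List.mem_toFinset.1 he)
      refine hl3 u (List.mem_flatMap.2 ⟨q, hq, ?_⟩)
      simpa using hue
    · intro U W hU hUk hW
      exact hF₁ M (fun Y hY => hM Y (mem_union_left _ hY)) U W hU hUk (by omega)
    · intro x y h1 h2
      rw [crossingFrame, mem_otherSide] at h1
      by_cases hx : x ∈ A
      · exact mem_union_left _ (mem_filter.2 ⟨mem_univ _, hx, mem_compl.2 (h1.1 hx), h2⟩)
      · refine mem_union_right _ (mem_image.2 ⟨(y, x), mem_filter.2 ⟨mem_univ _, ?_,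
          mem_compl.2 hx, fun h => h2 h.symm⟩, rfl⟩)
        by_contra hy
        exact hx (h1.2 hy)
    · set D := univ.filter fun p : Fin n × Fin n => p.1 ∈ A ∧ p.2 ∈ Aᶜ ∧ ¬ G.Adj p.1 p.2 with hD
      have h1 : (D ∪ D.image Prod.swap).card ≤ 2 * D.card := by
        have := card_union_le D (D.image Prod.swap)
        have := card_image_le (s := D) (f := Prod.swap)
        omega
      have h2 : ((D ∪ D.image Prod.swap).card : ℝ) ≤ 2 * D.card := by exact_mod_cast h1
      have hk : (n : ℝ) / 81920 ≤ ((n / 40960 : ℕ) : ℝ) := by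
        have : n ≤ 81920 * (n / 40960) := by omega
        have : (n : ℝ) ≤ 81920 * ((n / 40960 : ℕ) : ℝ) := by exact_mod_cast this
        linarith
      have hk2 : ((n : ℝ) / 81920) ^ 2 ≤ ((n / 40960 : ℕ) : ℝ) ^ 2 := by gcongr
      have : (0 : ℝ) ≤ n ^ 2 := by positivity
      rw [div_pow] at hk2
      norm_num at hk2 hmiss ⊢
      linarith

end LargeCut

/-! ### Neighbourhoods determined by an order force an extremal cut -/

section Dichotomy

variable {n : ℕ} {G : SimpleGraph (Fin n)} [DecidableRel G.Adj]

open Classical in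
/-- Two subsets of `T`, on each of which a truth value is given, such that the values agree for
almost all pairs: then all values are almost always the same. -/
lemma exists_common_value {L U : Finset (Fin n)} (α β : Fin n → Prop) {η : ℝ}
    (hL : (n : ℝ) / 5 ≤ L.card) (hU : (n : ℝ) / 5 ≤ U.card) (hn : (0 : ℝ) < n)
    (hη : η ≤ 1 / 1000)
    (h : (((L ×ˢ U).filter fun p => ¬ (α p.1 ↔ β p.2)).card : ℝ) ≤ η * n ^ 2) :
    ∃ v : Prop, ((L.filter fun z => ¬ (α z ↔ v)).card : ℝ) ≤ 10 * η * n ∧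
      ((U.filter fun z => ¬ (β z ↔ v)).card : ℝ) ≤ 10 * η * n := by
  have h1 : (L.filter fun z => α z).card * (U.filter fun z => ¬ β z).card ≤
      ((L ×ˢ U).filter fun p => ¬ (α p.1 ↔ β p.2)).card := by
    rw [← card_product]
    refine card_le_card fun p hp => ?_
    simp only [mem_product, mem_filter] at hp ⊢
    tauto
  have h2 : (L.filter fun z => ¬ α z).card * (U.filter fun z => β z).card ≤
      ((L ×ˢ U).filter fun p => ¬ (α p.1 ↔ β p.2)).card := by
    rw [← card_product]
    refine card_le_card fun p hp => ?_
    simp only [mem_product, mem_filter] at hp ⊢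
    tauto
  have h3 := card_filter_add_card_filter_not (s := L) (fun z => α z)
  have h4 := card_filter_add_card_filter_not (s := U) (fun z => β z)
  set a₁ := (L.filter fun z => α z).card
  set a₀ := (L.filter fun z => ¬ α z).card
  set b₁ := (U.filter fun z => β z).card
  set b₀ := (U.filter fun z => ¬ β z).card
  have h1' : (a₁ : ℝ) * b₀ ≤ η * n ^ 2 := le_trans (by exact_mod_cast h1) h
  have h2' : (a₀ : ℝ) * b₁ ≤ η * n ^ 2 := le_trans (by exact_mod_cast h2) h
  have h3' : (a₁ : ℝ) + a₀ = L.card := by exact_mod_cast h3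
  have h4' : (b₁ : ℝ) + b₀ = U.card := by exact_mod_cast h4
  have key : ∀ x y : ℝ, 0 ≤ y → (n : ℝ) / 10 ≤ x → x * y ≤ η * n ^ 2 → y ≤ 10 * η * n := by
    intro x y hy hx hxy
    have : (n : ℝ) / 10 * y ≤ η * n ^ 2 := le_trans (by gcongr) hxy
    by_contra hlt
    rw [not_le] at hlt
    nlinarith
  have hη' : 10 * η * n ≤ (n : ℝ) / 100 := by nlinarith
  -- If `α` often holds on `L`, then `β` rarely fails on `U`, so it often holds there, and `α`
  -- rarely fails on `L`.
  rcases le_total ((n : ℝ) / 10) a₁ with ha | ha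
  · have hb₀ := key a₁ b₀ (by positivity) ha h1'
    have ha₀ := key b₁ a₀ (by positivity) (by linarith) (by linarith)
    exact ⟨True, by simpa using ha₀, by simpa using hb₀⟩
  · have hb₁ := key a₀ b₁ (by positivity) (by linarith) h2'
    have ha₁ := key b₀ a₁ (by positivity) (by linarith) (by linarith)
    exact ⟨False, by simpa using ha₁, by simpa using hb₁⟩

open Classical in
/-- If each neighbourhood of a vertex `z ∈ T` is almost determined by two sets of vertices,
applying to the vertices before and after `z`, then `T` spans a very sparse or a very dense cut. -/
lemma sparse_or_large_cut {pos : Fin n → ℕ} (hpos : Function.Injective pos) (α β : Fin n → Prop)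
    {θ : ℝ} (hθ : θ ≤ 1 / 6000) (hθn : 1 ≤ θ * n) (hdeg : ∀ v, n ≤ 2 * G.degree v)
    {T : Finset (Fin n)} (hT : (1 / 2 - θ) * n ≤ T.card) (hT' : (T.card : ℝ) ≤ (1 / 2 + θ) * n)
    {R : Fin n → Finset (Fin n)}
    (hRdef : ∀ z w, w ∈ R z ↔ pos w < pos z ∧ α w ∨ pos z < pos w ∧ β w)
    (hR : ∀ z ∈ T, ((R z).card : ℝ) ≤ (1 / 2 + θ) * n)
    (hN : ∀ z ∈ T, ((G.neighborFinset z \ R z).card : ℝ) ≤ θ * n) :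
    (cutSize G T : ℝ) ≤ 512 * θ * n ^ 2 ∨ (n : ℝ) ^ 2 / 4 - 512 * θ * n ^ 2 ≤ cutSize G T := by
  have hn0 : (0 : ℝ) < n := by
    rcases Nat.eq_zero_or_pos n with rfl | h
    · norm_num at hθn
    · exact_mod_cast h
  have hθ0 : 0 < θ := by
    by_contra h
    rw [not_lt] at h
    nlinarith
  have hdegr : ∀ v, (n : ℝ) ≤ 2 * (G.neighborFinset v).card := by
    intro v
    rw [G.card_neighborFinset_eq_degree]
    exact_mod_cast hdeg v
  -- `R z` is hardly larger than the neighbourhood, so it is almost contained in the neighbourhood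
  -- too.
  have hRN : ∀ z ∈ T, ((R z \ G.neighborFinset z).card : ℝ) ≤ 2 * θ * n := by
    intro z hz
    have h1 := card_sdiff_add_card_inter (R z) (G.neighborFinset z)
    have h2 := card_sdiff_add_card_inter (G.neighborFinset z) (R z)
    rw [inter_comm] at h2
    have h1' : ((R z \ G.neighborFinset z).card : ℝ) + (R z ∩ G.neighborFinset z).card =
      (R z).card := by exact_mod_cast h1
    have h2' : ((G.neighborFinset z \ R z).card : ℝ) + (R z ∩ G.neighborFinset z).card =
      (G.neighborFinset z).card := by exact_mod_cast h2
    have h3 := hR z hz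
    have h4 := hN z hz
    have h5 := hdegr z
    linarith
  have hTn : (T.card : ℝ) ≤ n := by
    exact_mod_cast (by simpa using card_le_univ T : T.card ≤ n)
  set X := (T ×ˢ T).filter fun p => ¬ (G.Adj p.1 p.2 ↔ p.2 ∈ R p.1) with hX
  have hXc : (X.card : ℝ) ≤ 3 * θ * n ^ 2 := by
    have h1 : X.card ≤ (T.sigma fun z => (G.neighborFinset z \ R z) ∪
        (R z \ G.neighborFinset z)).card := by
      refine card_le_card_of_injOn (fun p => ⟨p.1, p.2⟩) ?_ ?_
      · rintro ⟨a, b⟩ hab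
        simp only [hX, coe_filter, mem_product, Set.mem_ofPred_eq] at hab
        simp only [coe_sigma, Set.mem_sigma_iff, mem_coe, mem_union, mem_sdiff,
          SimpleGraph.mem_neighborFinset]
        tauto
      · rintro ⟨a, b⟩ _ ⟨c, d⟩ _ h
        simpa using h
    rw [card_sigma] at h1
    have h2 : (X.card : ℝ) ≤ ∑ z ∈ T, ((G.neighborFinset z \ R z ∪ R z \ G.neighborFinset z).card : ℝ) := by
      exact_mod_cast h1
    have h3 : ∀ z ∈ T, ((G.neighborFinset z \ R z ∪ R z \ G.neighborFinset z).card : ℝ) ≤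
        3 * θ * n := by
      intro z hz
      have h4 : ((G.neighborFinset z \ R z ∪ R z \ G.neighborFinset z).card : ℝ) ≤
          (G.neighborFinset z \ R z).card + (R z \ G.neighborFinset z).card := by
        exact_mod_cast card_union_le _ _
      linarith [hRN z hz, hN z hz]
    have h4 := sum_le_card_nsmul T _ _ h3
    rw [nsmul_eq_mul] at h4
    calc (X.card : ℝ) ≤ T.card * (3 * θ * n) := h2.trans h4
      _ ≤ n * (3 * θ * n) := by gcongr
      _ = _ := by ring
  -- For `z` before `w`, adjacency is given by `β w` as seen from `z` and by `α z` as seen from `w`.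
  -- Comparing the two for early `z` and late `w` shows that `α` on the early part and `β` on the
  -- late part are almost constant.
  have hbefore : ∀ z ∈ T, ∀ w ∈ T, pos z < pos w → (z, w) ∉ X → (G.Adj z w ↔ β w) := by
    intro z hz w hw hzw h
    simp only [hX, mem_filter, mem_product, hz, hw, true_and, not_not, hRdef] at h
    rw [h]
    constructor
    · rintro (h | h)
      · omega
      · exact h.2
    · exact fun h => Or.inr ⟨hzw, h⟩
  have hafter : ∀ z ∈ T, ∀ w ∈ T, pos z < pos w → (w, z) ∉ X → (G.Adj z w ↔ α z) := by
    intro z hz w hw hzw h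
    simp only [hX, mem_filter, mem_product, hz, hw, true_and, not_not, hRdef] at h
    rw [G.adj_comm, h]
    constructor
    · rintro (h | h)
      · exact h.2
      · omega
    · exact fun h => Or.inl ⟨hzw, h⟩
  obtain ⟨m, hL, hU⟩ : ∃ m, (n : ℝ) / 5 ≤ (T.filter fun z => pos z < m).card ∧
      (n : ℝ) / 5 ≤ (T.filter fun z => ¬ pos z < m).card := by
    have hex : ∃ m, (n : ℝ) / 5 ≤ (T.filter fun z => pos z < m).card := by
      refine ⟨T.sup pos + 1, ?_⟩
      rw [filter_true_of_mem fun z hz => Nat.lt_succ_of_le (le_sup hz)]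
      nlinarith
    refine ⟨Nat.find hex, Nat.find_spec hex, ?_⟩
    have hle : ((T.filter fun z => pos z < Nat.find hex).card : ℝ) ≤ n / 5 + 1 := by
      rcases Nat.eq_zero_or_pos (Nat.find hex) with h0 | h0
      · rw [h0]; simp; positivity
      · have h1 := Nat.find_min hex (Nat.sub_lt h0 one_pos)
        rw [not_le] at h1
        have h2 : (T.filter fun z => pos z < Nat.find hex).card ≤
            (T.filter fun z => pos z < Nat.find hex - 1).card + 1 := by
          calc _ ≤ ((T.filter fun z => pos z < Nat.find hex - 1) ∪
                T.filter fun z => pos z = Nat.find hex - 1).card := by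
                refine card_le_card fun z hz => ?_
                simp only [mem_filter, mem_union] at hz ⊢
                have := hz.2
                have : pos z < Nat.find hex - 1 ∨ pos z = Nat.find hex - 1 := by omega
                tauto
            _ ≤ _ := (card_union_le _ _).trans ?_
          gcongr
          rw [card_le_one]
          intro a ha b hb
          exact hpos ((mem_filter.1 ha).2.trans (mem_filter.1 hb).2.symm)
        have h3 : ((T.filter fun z => pos z < Nat.find hex).card : ℝ) ≤
            (T.filter fun z => pos z < Nat.find hex - 1).card + 1 := by exact_mod_cast h2
        linarith
    have h3 := card_filter_add_card_filter_not (s := T) (fun z => pos z < Nat.find hex)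
    have h3' : ((T.filter fun z => pos z < Nat.find hex).card : ℝ) +
      (T.filter fun z => ¬ pos z < Nat.find hex).card = T.card := by exact_mod_cast h3
    nlinarith
  set L := T.filter fun z => pos z < m with hLdef
  set U := T.filter fun z => ¬ pos z < m with hUdef
  have hLU : (((L ×ˢ U).filter fun p => ¬ (α p.1 ↔ β p.2)).card : ℝ) ≤ 6 * θ * n ^ 2 := by
    have h1 : ((L ×ˢ U).filter fun p => ¬ (α p.1 ↔ β p.2)).card ≤ X.card + X.card := by
      refine le_trans (card_le_card (t := X ∪ X.image Prod.swap) ?_)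
        ((card_union_le _ _).trans (Nat.add_le_add_left card_image_le _))
      rintro ⟨z, w⟩ hp
      by_contra hcon
      rw [mem_union, not_or] at hcon
      have hcon2 : (w, z) ∉ X := fun h => hcon.2 (mem_image.2 ⟨(w, z), h, rfl⟩)
      simp only [hLdef, hUdef, mem_filter, mem_product] at hp
      have hlt : pos z < pos w := by omega
      exact hp.2 ((hafter z hp.1.1.1 w hp.1.2.1 hlt hcon2).symm.trans
        (hbefore z hp.1.1.1 w hp.1.2.1 hlt hcon.1))
    have h2 : (((L ×ˢ U).filter fun p => ¬ (α p.1 ↔ β p.2)).card : ℝ) ≤ X.card + X.card := by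
      exact_mod_cast h1
    linarith
  obtain ⟨v, hLv, hUv⟩ := exists_common_value α β hL hU hn0 (by linarith) hLU
  set L' := L.filter fun z => ¬ (α z ↔ v) with hL'
  set U' := U.filter fun z => ¬ (β z ↔ v) with hU'
  -- The constant is `6 + 2 * 120`: both orders of the pairs in `X`, and the exceptional vertices
  -- `L' ∪ U'` in either coordinate.
  have hbad : (((T ×ˢ T).filter fun p => p.1 ≠ p.2 ∧ ¬ (G.Adj p.1 p.2 ↔ v)).card : ℝ) ≤
      246 * θ * n ^ 2 := by
    have h1 : ((T ×ˢ T).filter fun p => p.1 ≠ p.2 ∧ ¬ (G.Adj p.1 p.2 ↔ v)).card ≤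
        (X.card + X.card) + (L'.card + U'.card) * T.card + T.card * (L'.card + U'.card) := by
      refine le_trans (card_le_card (t := (X ∪ X.image Prod.swap) ∪ ((L' ∪ U') ×ˢ T) ∪
        (T ×ˢ (L' ∪ U'))) ?_) ?_
      -- If `z` is early, the pair is decided by `α z`; otherwise `w` is late as well, and `β w`
      -- decides.
      · have key : ∀ z ∈ T, ∀ w ∈ T, pos z < pos w → (z, w) ∉ X → (w, z) ∉ X →
            z ∉ L' → w ∉ U' → (G.Adj z w ↔ v) := by
          intro z hz w hw hzw h1 h2 h3 h4
          by_cases hzm : pos z < m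
          · rw [hafter z hz w hw hzw h2]
            by_contra h
            exact h3 (mem_filter.2 ⟨mem_filter.2 ⟨hz, hzm⟩, h⟩)
          · rw [hbefore z hz w hw hzw h1]
            by_contra h
            exact h4 (mem_filter.2 ⟨mem_filter.2 ⟨hw, by omega⟩, h⟩)
        rintro ⟨z, w⟩ hp
        simp only [mem_filter, mem_product] at hp
        obtain ⟨⟨hz, hw⟩, hne, hv⟩ := hp
        by_contra hcon
        simp only [mem_union, mem_product, hz, hw, true_and, and_true, not_or] at hcon
        have h2 : (w, z) ∉ X := fun h => hcon.1.1.2 (mem_image.2 ⟨(w, z), h, rfl⟩)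
        rcases lt_trichotomy (pos z) (pos w) with h | h | h
        · exact hv (key z hz w hw h hcon.1.1.1 h2 hcon.1.2.1 hcon.2.2)
        · exact hne (hpos h)
        · rw [G.adj_comm] at hv
          exact hv (key w hw z hz h h2 hcon.1.1.1 hcon.2.1 hcon.1.2.2)
      · refine (card_union_le _ _).trans (add_le_add ((card_union_le _ _).trans (add_le_add
          ((card_union_le _ _).trans (Nat.add_le_add_left card_image_le _)) ?_)) ?_)
        · rw [card_product]; gcongr; exact card_union_le _ _
        · rw [card_product]; gcongr; exact card_union_le _ _
    have h2 : (((T ×ˢ T).filter fun p => p.1 ≠ p.2 ∧ ¬ (G.Adj p.1 p.2 ↔ v)).card : ℝ) ≤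
        (X.card + X.card) + (L'.card + U'.card) * T.card + T.card * (L'.card + U'.card) := by
      exact_mod_cast h1
    have h3 : ((L'.card : ℝ) + U'.card) * T.card ≤ (120 * θ * n) * n := by
      gcongr; linarith
    linarith
  set b := ((T ×ˢ T).filter fun p => p.1 ≠ p.2 ∧ ¬ (G.Adj p.1 p.2 ↔ v)).card with hb
  have hsum : (∑ a ∈ T, ((G.neighborFinset a ∩ T).card : ℝ)) + cutSize G T =
      ∑ a ∈ T, ((G.neighborFinset a).card : ℝ) := by
    have := sum_inter_add_cutSize G T
    simp only [← G.card_neighborFinset_eq_degree] at this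
    exact_mod_cast this
  have hmiss : ((univ.filter fun p : Fin n × Fin n => p.1 ∈ T ∧ p.2 ∈ T ∧ ¬ G.Adj p.1 p.2).card : ℝ) +
      ∑ a ∈ T, ((G.neighborFinset a ∩ T).card : ℝ) = T.card * T.card := by
    exact_mod_cast card_filter_not_adj (G := G) T T
  have hnn : (n : ℝ) ≤ θ * n ^ 2 := by nlinarith
  -- If `T` is almost complete, its vertices have about `n / 2` neighbours, nearly all in `T`, so
  -- the cut is sparse. If `T` is almost independent, nearly all edges at `T` leave it.
  by_cases hv : v
  · left
    have h1 : (univ.filter fun p : Fin n × Fin n => p.1 ∈ T ∧ p.2 ∈ T ∧ ¬ G.Adj p.1 p.2).card ≤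
        b + T.card := by
      rw [← diag_card T]
      refine le_trans (card_le_card fun p hp => ?_) (card_union_le _ _)
      simp only [mem_filter, mem_univ, true_and, mem_union, mem_product, mem_diag, hv,
        iff_true] at hp ⊢
      tauto
    have h1' : ((univ.filter fun p : Fin n × Fin n => p.1 ∈ T ∧ p.2 ∈ T ∧ ¬ G.Adj p.1 p.2).card : ℝ) ≤
        b + T.card := by exact_mod_cast h1
    have h2 : ∀ z ∈ T, ((G.neighborFinset z).card : ℝ) ≤ (1 / 2 + 2 * θ) * n := by
      intro z hz
      have h3 : (G.neighborFinset z).card ≤ (R z).card + (G.neighborFinset z \ R z).card := by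
        have := le_card_sdiff (R z) (G.neighborFinset z)
        omega
      have h3' : ((G.neighborFinset z).card : ℝ) ≤
        (R z).card + (G.neighborFinset z \ R z).card := by exact_mod_cast h3
      linarith [hR z hz, hN z hz]
    have h3 := sum_le_card_nsmul T _ _ h2
    rw [nsmul_eq_mul] at h3
    have h4 : (T.card : ℝ) * ((1 / 2 + 2 * θ) * n - T.card) ≤ n * (3 * θ * n) := by
      calc (T.card : ℝ) * ((1 / 2 + 2 * θ) * n - T.card) ≤ T.card * (3 * θ * n) := by
            gcongr; linarith
        _ ≤ _ := by gcongr
    nlinarith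
  · right
    have h1 : ∑ a ∈ T, (G.neighborFinset a ∩ T).card ≤ b := by
      have h2 : (T.sigma fun a => G.neighborFinset a ∩ T).card ≤ b := by
        refine card_le_card_of_injOn (fun p => (p.1, p.2)) ?_ ?_
        · rintro ⟨a, c⟩ h
          simp only [coe_sigma, Set.mem_sigma_iff, mem_coe, mem_inter,
            SimpleGraph.mem_neighborFinset] at h
          simp only [coe_filter, mem_product, Set.mem_ofPred_eq, hv, iff_false, not_not]
          exact ⟨⟨h.1, h.2.2⟩, h.2.1.ne, h.2.1⟩
        · rintro ⟨a, c⟩ _ ⟨d, e⟩ _ h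
          simp only [Prod.mk.injEq] at h
          obtain ⟨rfl, rfl⟩ := h; rfl
      rwa [card_sigma] at h2
    have h1' : (∑ a ∈ T, ((G.neighborFinset a ∩ T).card : ℝ)) ≤ b := by exact_mod_cast h1
    have h2 := card_nsmul_le_sum T (fun a => ((G.neighborFinset a).card : ℝ)) (n / 2)
      (fun a _ => by linarith [hdegr a])
    rw [nsmul_eq_mul] at h2
    nlinarith

end Dichotomy

/-! ### One further rotation along an edge of `G` -/

section PivotEnds

variable {V : Type*} [Fintype V]

open Classical in
/-- The ends of the paths which arise from `P` by one rotation along an edge of `G`. -/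
noncomputable def pivotEnds (G : SimpleGraph V) (P : List V) : Finset V :=
  univ.filter fun w => ∃ X u Y y, P = X ++ u :: w :: Y ∧ (w :: Y).getLast? = some y ∧ G.Adj y u

lemma mem_pivotEnds {G : SimpleGraph V} {P : List V} {w : V} : w ∈ pivotEnds G P ↔
    ∃ X u Y y, P = X ++ u :: w :: Y ∧ (w :: Y).getLast? = some y ∧ G.Adj y u := by
  simp [pivotEnds]

end PivotEnds

/-! ### The score of a family of rotated paths -/

section Score

variable {V : Type*}

/-- There is a sequence of rotations, short compared to its value, to which no rotation increasing
the value by at least `κ` can be added. -/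
lemma exists_maximal_value (R : V → V → Prop) (P₀ : List V) {Ψ : List (List V) → ℕ} {B κ : ℕ}
    (hκ : 0 < κ) (hB : ∀ Ps, Ψ Ps ≤ B) :
    ∃ τ, Valid R P₀ τ ∧ κ * τ.length ≤ Ψ (eval P₀ τ) ∧
      ∀ i j, Valid R P₀ ((i, j) :: τ) → Ψ (eval P₀ ((i, j) :: τ)) < Ψ (eval P₀ τ) + κ := by
  classical
  -- A longest sequence among those whose score is at least `κ` per rotation.
  let p : ℕ → Prop := fun k => ∃ τ, Valid R P₀ τ ∧ κ * τ.length ≤ Ψ (eval P₀ τ) ∧ τ.length = k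
  have hbd : ∀ k, p k → k ≤ B := by
    rintro k ⟨τ, _, h, rfl⟩
    exact (Nat.le_mul_of_pos_left _ hκ).trans (h.trans (hB _))
  have hp : p 0 := ⟨[], trivial, by simp, rfl⟩
  obtain ⟨τ, h1, h2, h3⟩ := Nat.findGreatest_spec (P := p) (hbd _ hp) hp
  refine ⟨τ, h1, h2, fun i j hv => ?_⟩
  by_contra hlt
  rw [not_lt] at hlt
  have hp' : p (τ.length + 1) := ⟨(i, j) :: τ, hv, by
    rw [List.length_cons, Nat.mul_add, Nat.mul_one]; omega, rfl⟩
  have h4 := Nat.le_findGreatest (hbd _ hp') hp'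
  omega

lemma perm_rotation (X : List V) (u : V) (Y : List V) :
    (X ++ u :: Y.reverse).Perm (X ++ u :: Y) :=
  ((List.reverse_perm _).cons _).append_left _

lemma getLast?_rotation (X : List V) (u z : V) (Y : List V) :
    (X ++ u :: (z :: Y).reverse).getLast? = some z := by
  simp [List.getLast?_append, List.getLast?_cons]

lemma getLast?_append_cons_cons {X : List V} {u z : V} {Y : List V} :
    (X ++ u :: z :: Y).getLast? = (z :: Y).getLast? := by
  rw [List.getLast?_append, List.getLast?_cons_cons, List.getLast?_cons]; rfl

variable [DecidableEq V]

lemma ends_cons {P : List V} {z : V} (hz : P.getLast? = some z) (Ps : List (List V)) :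
    ends (P :: Ps) = insert z (ends Ps) := by
  rw [ends, List.filterMap_cons_some hz, List.toFinset_cons]; rfl

variable [Fintype V] (G : SimpleGraph V)

/-- The largest number of elements of `T ∪ pivotEnds G P` for the paths `P` ending at `z`. -/
noncomputable def best (T : Finset V) (Ps : List (List V)) (z : V) : ℕ :=
  (Ps.toFinset.filter fun P => P.getLast? = some z).sup fun P => (T ∪ pivotEnds G P).card

/-- A measure of the size of a family of paths, which grows with the set of ends and with the sets
of ends obtained by one more rotation. -/
noncomputable def score (Ps : List (List V)) : ℕ := ∑ z ∈ ends Ps, best G (ends Ps) Ps z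

lemma best_mono {T T' : Finset V} (hT : T ⊆ T') {Ps : List (List V)} (P : List V) (z : V) :
    best G T Ps z ≤ best G T' (P :: Ps) z := by
  refine Finset.sup_le fun Q hQ => ?_
  refine (card_le_card (union_subset_union_left hT)).trans
    (le_sup (f := fun P => (T' ∪ pivotEnds G P).card) ?_)
  simp only [mem_filter, List.mem_toFinset] at hQ ⊢
  exact ⟨List.mem_cons_of_mem _ hQ.1, hQ.2⟩

lemma le_best {T : Finset V} {Ps : List (List V)} {P : List V} {z : V} (hP : P ∈ Ps)
    (hz : P.getLast? = some z) : (T ∪ pivotEnds G P).card ≤ best G T Ps z :=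
  le_sup (f := fun P => (T ∪ pivotEnds G P).card) (by simp [hP, hz])

lemma exists_eq_best {T : Finset V} {Ps : List (List V)} {z : V} (hz : z ∈ ends Ps) :
    ∃ P ∈ Ps, P.getLast? = some z ∧ best G T Ps z = (T ∪ pivotEnds G P).card := by
  obtain ⟨P, hP, hPz⟩ := mem_ends.1 hz
  obtain ⟨Q, hQ, h⟩ := exists_mem_eq_sup (Ps.toFinset.filter fun P => P.getLast? = some z)
    ⟨P, by simp [hP, hPz]⟩ fun P => (T ∪ pivotEnds G P).card
  simp only [mem_filter, List.mem_toFinset] at hQ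
  exact ⟨Q, hQ.1, hQ.2, h⟩

lemma score_le (Ps : List (List V)) : score G Ps ≤ Fintype.card V * Fintype.card V := by
  refine (sum_le_card_nsmul _ _ (Fintype.card V) fun z _ => Finset.sup_le fun P _ => ?_).trans ?_
  · exact card_le_univ _
  · rw [smul_eq_mul]; exact Nat.mul_le_mul_right _ (card_le_univ _)

/-- The new end contributes a summand of at least `|pivotEnds G P|`, and no old summand decreases.
-/
lemma score_add_le_of_notMem {P : List V} {z : V} {Ps : List (List V)} (hz : P.getLast? = some z)
    (hzPs : z ∉ ends Ps) : score G Ps + (pivotEnds G P).card ≤ score G (P :: Ps) := by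
  rw [score, score, ends_cons hz, sum_insert hzPs, add_comm]
  refine add_le_add ((card_le_card subset_union_right).trans (le_best G (by simp) hz))
    (sum_le_sum fun w _ => best_mono G (subset_insert _ _) P w)

/-- Only the summand of `z` matters: with `P` available it is at least `|ends Ps ∪ pivotEnds G P|`.
-/
lemma score_add_le_of_mem {P : List V} {z : V} {Ps : List (List V)} (hz : P.getLast? = some z)
    (hzPs : z ∈ ends Ps) : score G Ps + (ends Ps ∪ pivotEnds G P).card ≤
      score G (P :: Ps) + best G (ends Ps) Ps z := by
  rw [score, score, ends_cons hz, insert_eq_self.2 hzPs, ← add_sum_erase _ _ hzPs,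
    ← add_sum_erase _ _ hzPs]
  have h1 := le_best G (T := ends Ps) (List.mem_cons_self (a := P) (l := Ps)) hz
  have h2 : ∑ w ∈ (ends Ps).erase z, best G (ends Ps) Ps w ≤
      ∑ w ∈ (ends Ps).erase z, best G (ends Ps) (P :: Ps) w :=
    sum_le_sum fun w _ => best_mono G Subset.rfl P w
  omega

open Classical in
/-- The edges of `G` along which a rotation increases the score by at least `κ`. -/
noncomputable def gainEdges (κ : ℕ) (Ps : List (List V)) : Finset (Sym2 V) :=
  univ.filter fun e => ∃ X u z Y y, X ++ u :: z :: Y ∈ Ps ∧ (z :: Y).getLast? = some y ∧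
    G.Adj y u ∧ e = s(y, u) ∧
    score G Ps + κ ≤ score G ((X ++ u :: (z :: Y).reverse) :: Ps)

variable {G} in
lemma mem_gainEdges {κ : ℕ} {Ps : List (List V)} {e : Sym2 V} : e ∈ gainEdges G κ Ps ↔
    ∃ X u z Y y, X ++ u :: z :: Y ∈ Ps ∧ (z :: Y).getLast? = some y ∧ G.Adj y u ∧ e = s(y, u) ∧
      score G Ps + κ ≤ score G ((X ++ u :: (z :: Y).reverse) :: Ps) := by
  simp [gainEdges]

end Score

/-! ### Counting sequences of rotations -/

section RotationFamily

variable {n : ℕ}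

lemma length_eq_of_nodup_of_full {P : List (Fin n)} (hP : P.Nodup) (hfull : ∀ v, v ∈ P) :
    P.length = n := by
  have h : P.toFinset = univ := eq_univ_of_forall fun v => List.mem_toFinset.2 (hfull v)
  rw [← List.toFinset_card_of_nodup hP, h, card_univ, Fintype.card_fin]

lemma Valid.nodup_and_full {V : Type*} {R : V → V → Prop} {P₀ : List V} {τ : List (ℕ × ℕ)}
    (hτ : Valid R P₀ τ) (h₀ : P₀.Nodup) (h₀' : ∀ v, v ∈ P₀) :
    ∀ P ∈ eval P₀ τ, P.Nodup ∧ ∀ v, v ∈ P := by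
  refine Valid.induction ⟨h₀, h₀'⟩ ?_ hτ
  intro X u z Y y h _ _
  have hperm := perm_rotation X u (z :: Y)
  exact ⟨hperm.nodup_iff.2 h.1, fun v => hperm.mem_iff.2 (h.2 v)⟩

lemma Valid.lt_of_mem {R : Fin n → Fin n → Prop} {P₀ : List (Fin n)} {τ : List (ℕ × ℕ)}
    (hτ : Valid R P₀ τ) (h₀ : P₀.Nodup) (h₀' : ∀ v, v ∈ P₀) :
    ∀ p ∈ τ, p.1 < τ.length ∧ p.2 < n := by
  induction τ with
  | nil => simp
  | cons q τ ih =>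
    obtain ⟨i, j⟩ := q
    obtain ⟨hv, X, u, z, Y, y, hi, rfl, _, _⟩ := hτ
    intro p hp
    rw [List.length_cons]
    rcases List.mem_cons.1 hp with rfl | hp
    · have h1 := (List.getElem?_eq_some_iff.1 hi).1
      rw [length_eval] at h1
      obtain ⟨h2, h3⟩ := hv.nodup_and_full h₀ h₀' _ (List.mem_of_getElem? hi)
      have h4 := length_eq_of_nodup_of_full h2 h3
      simp only [List.length_append, List.length_cons] at h4
      exact ⟨h1, by simp only; omega⟩
    · have := ih hv p hp
      exact ⟨by omega, this.2⟩

open Classical in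
/-- Hitting a suitable light family of edge sets ensures that rotations lead to a family of paths
whose score is increased much by rotations along few edges only. -/
lemma exists_rotation_family (hn : 1 ≤ n) (G : SimpleGraph (Fin n)) [DecidableRel G.Adj] {κ ℓ : ℕ}
    (hκ : 0 < κ) (hℓ : n * n ≤ κ * ℓ) (hℓn : ℓ + 1 ≤ n ^ 2) {a C : ℝ} (hC0 : 0 ≤ C)
    (hC : (((n + 2 + 3 * ℓ : ℕ) : ℝ) + (1 : ℕ)) * n ≤ C * a) :
    ∃ F : Finset (Finset (Sym2 (Fin n))), (∀ A ∈ F, A ⊆ G.edgeFinset) ∧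
      weight n C F ≤ (n : ℝ)⁻¹ ∧
      ∀ M : Finset (Sym2 (Fin n)), (∀ A ∈ F, (A ∩ M).Nonempty) → ∀ H, M ⊆ H →
        ∀ P₀ : List (Fin n), P₀.Nodup → (∀ v, v ∈ P₀) →
          ∃ τ, Valid (fun y u => G.Adj y u ∧ s(y, u) ∈ H) P₀ τ ∧
            (∀ i j, Valid (fun y u => G.Adj y u ∧ s(y, u) ∈ H) P₀ ((i, j) :: τ) →
              score G (eval P₀ ((i, j) :: τ)) < score G (eval P₀ τ) + κ) ∧
            ((gainEdges G κ (eval P₀ τ)).card : ℝ) < a := by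
  -- A code consists of the initial path, the length of the sequence and its entries. There are at
  -- most `n ^ (n + 2 + 3ℓ)` codes, and they depend on neither `M` nor `H`.
  let code : (Fin n → Fin n) × Fin (ℓ + 1) × (Fin ℓ → Fin (ℓ + 1) × Fin n) →
      Finset (Sym2 (Fin n)) := fun c => gainEdges G κ (eval (List.ofFn c.1)
        ((List.ofFn fun k => (((c.2.2 k).1 : ℕ), ((c.2.2 k).2 : ℕ))).take c.2.1))
  refine ⟨(univ.image code).filter fun A => a ≤ A.card, ?_, ?_, ?_⟩
  · intro A hA e he
    obtain ⟨c, _, rfl⟩ := mem_image.1 (mem_filter.1 hA).1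
    obtain ⟨X, u, z, Y, y, _, _, h, rfl, _⟩ := mem_gainEdges.1 he
    simpa using h
  · refine (weight_le hn hC0 (m := n + 2 + 3 * ℓ) (p := 1) (a := a) ?_
      (fun A hA => (mem_filter.1 hA).2) hC).trans (by rw [pow_one])
    calc _ ≤ (univ.image code).card := card_filter_le _ _
      _ ≤ n ^ n * ((ℓ + 1) * ((ℓ + 1) * n) ^ ℓ) := by
          refine card_image_le.trans (le_of_eq ?_)
          simp [Fintype.card_prod, Fintype.card_pi]
      _ ≤ n ^ n * (n ^ 2 * (n ^ 2 * n) ^ ℓ) := by gcongr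
      _ = n ^ (n + 2 + 3 * ℓ) := by
          rw [← pow_succ, ← pow_mul, ← pow_add, ← pow_add]; congr 1; ring
  · intro M hM H hMH P₀ h₀ h₀'
    obtain ⟨τ, hτ, hlen, hmax⟩ := exists_maximal_value
      (fun y u => G.Adj y u ∧ s(y, u) ∈ H) P₀ hκ (score_le G)
    refine ⟨τ, hτ, hmax, ?_⟩
    by_contra hlt
    rw [not_lt] at hlt
    have hτℓ : τ.length ≤ ℓ := by
      have h1 := hlen.trans (score_le G _)
      rw [Fintype.card_fin] at h1
      exact Nat.le_of_mul_le_mul_left (h1.trans hℓ) hκ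
    have hmem : gainEdges G κ (eval P₀ τ) ∈ univ.image code := by
      have hP₀len := length_eq_of_nodup_of_full h₀ h₀'
      have hlt := hτ.lt_of_mem h₀ h₀'
      refine mem_image.2 ⟨⟨fun i => P₀.get (i.cast hP₀len.symm), ⟨τ.length, by omega⟩, fun k =>
        if hk : (k : ℕ) < τ.length then (⟨τ[k].1, ?_⟩, ⟨τ[k].2, ?_⟩)
        -- Fillers, which `take` discards.
        else (⟨0, by omega⟩, ⟨0, by omega⟩)⟩, mem_univ _, ?_⟩
      · exact lt_of_lt_of_le (hlt _ (List.getElem_mem hk)).1 (by omega)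
      · exact (hlt _ (List.getElem_mem hk)).2
      · have h1 : List.ofFn (fun i : Fin n => P₀.get (i.cast hP₀len.symm)) = P₀ :=
          List.ext_getElem (by simp [hP₀len]) (by simp)
        simp only [code]
        rw [h1]
        congr 2
        refine List.ext_getElem (by simp [hτℓ]) fun k h2 h3 => ?_
        simp [h3]
    -- A large set of gain edges would be hit by `M`, which allows one more rotation gaining `κ`.
    obtain ⟨e, he⟩ := hM _ (mem_filter.2 ⟨hmem, hlt⟩)
    obtain ⟨he, heM⟩ := mem_inter.1 he
    obtain ⟨X, u, z, Y, y, hP, hy, hadj, rfl, hgain⟩ := mem_gainEdges.1 he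
    obtain ⟨i, hv, _, hev⟩ := hτ.append hP hy ⟨hadj, hMH heM⟩
    have := hmax _ _ hv
    rw [hev] at this
    omega

end RotationFamily

/-! ### Reading neighbourhoods off a path -/

section Positions

variable {V : Type*} [DecidableEq V]

/-- The successor of a vertex along a list. -/
def next (P : List V) (v : V) : V := P.getD (P.idxOf v + 1) v

/-- The predecessor of a vertex along a list. -/
def prev (P : List V) (v : V) : V := P.getD (P.idxOf v - 1) v

lemma next_eq {X : List V} {u w : V} {Y : List V} (h : (X ++ u :: w :: Y).Nodup) :
    next (X ++ u :: w :: Y) u = w := by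
  rw [next, idxOf_append_cons h]; simp

lemma idxOf_append_cons_cons {X : List V} {u w : V} {Y : List V} (h : (X ++ u :: w :: Y).Nodup) :
    (X ++ u :: w :: Y).idxOf w = X.length + 1 := by
  have h1 : X ++ u :: w :: Y = (X ++ [u]) ++ w :: Y := by simp
  rw [h1, idxOf_append_cons (h1 ▸ h)]; simp

lemma prev_eq {X : List V} {u w : V} {Y : List V} (h : (X ++ u :: w :: Y).Nodup) :
    prev (X ++ u :: w :: Y) w = u := by
  rw [prev, idxOf_append_cons_cons h]; simp

lemma idxOf_getD {P : List V} (hP : P.Nodup) {i : ℕ} (hi : i < P.length) (v : V) :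
    P.idxOf (P.getD i v) = i := by
  rw [List.getD_eq_getElem _ _ hi, hP.idxOf_getElem]

lemma idxOf_next {P : List V} (hP : P.Nodup) {v : V} (hv : P.idxOf v + 1 < P.length) :
    P.idxOf (next P v) = P.idxOf v + 1 := idxOf_getD hP hv v

lemma idxOf_prev {P : List V} (hP : P.Nodup) {v : V} (hv : P.idxOf v < P.length) :
    P.idxOf (prev P v) = P.idxOf v - 1 := idxOf_getD hP (by omega) v

lemma eq_of_idxOf_eq {P : List V} (hfull : ∀ v, v ∈ P) {v w : V} (h : P.idxOf v = P.idxOf w) :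
    v = w := (List.idxOf_inj (hfull v)).1 h

variable [Fintype V] {G : SimpleGraph V}

lemma next_mem_pivotEnds {P : List V} (hP : P.Nodup) (hfull : ∀ v, v ∈ P) {y u : V}
    (hy : P.getLast? = some y) (hadj : G.Adj y u) :
    next P u ∈ pivotEnds G P ∧ P.idxOf u + 1 < P.length := by
  obtain ⟨X, Y, rfl⟩ := List.append_of_mem (hfull u)
  cases Y with
  | nil =>
    simp only [List.getLast?_append, List.getLast?_singleton, Option.some_or,
      Option.some.injEq] at hy
    exact absurd hy hadj.ne'
  | cons w Y =>
    rw [next_eq hP, idxOf_append_cons hP]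
    refine ⟨mem_pivotEnds.2 ⟨X, u, Y, y, rfl, ?_, hadj⟩, by simp⟩
    rw [List.getLast?_append, List.getLast?_cons_cons] at hy
    rw [← hy, List.getLast?_cons]; rfl

/-- Distinct neighbours of the end have distinct successors on the path. -/
lemma degree_le_card_pivotEnds [DecidableRel G.Adj] {P : List V} (hP : P.Nodup)
    (hfull : ∀ v, v ∈ P) {y : V} (hy : P.getLast? = some y) :
    G.degree y ≤ (pivotEnds G P).card := by
  rw [← G.card_neighborFinset_eq_degree]
  refine card_le_card_of_injOn (next P) (fun u hu => ?_) fun u hu v hv h => ?_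
  · exact (next_mem_pivotEnds hP hfull hy (by simpa using hu)).1
  · have h1 := (next_mem_pivotEnds hP hfull hy (by simpa using hu : G.Adj y u)).2
    have h2 := (next_mem_pivotEnds hP hfull hy (by simpa using hv : G.Adj y v)).2
    have h3 := congrArg P.idxOf h
    rw [idxOf_next hP h1, idxOf_next hP h2] at h3
    exact eq_of_idxOf_eq hfull (by omega)

open Classical in
/-- The number of pairs formed by a set of edges is at most twice its size. -/
lemma sum_card_filter_le (A : Finset (Sym2 V)) (T : Finset V) :
    ∑ z ∈ T, (univ.filter fun u => s(z, u) ∈ A).card ≤ 2 * A.card := by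
  rw [← card_sigma]
  have h1 : (T.sigma fun z => univ.filter fun u => s(z, u) ∈ A).card =
      ((T ×ˢ univ).filter fun p => s(p.1, p.2) ∈ A).card := by
    refine card_bij (fun p _ => (p.1, p.2)) ?_ ?_ ?_
    · rintro ⟨a, b⟩ h; simpa using h
    · rintro ⟨a, b⟩ _ ⟨c, d⟩ _ h
      simp only [Prod.mk.injEq] at h
      obtain ⟨rfl, rfl⟩ := h; rfl
    · rintro ⟨a, b⟩ h
      exact ⟨⟨a, b⟩, by simpa using h, rfl⟩
  rw [h1]
  refine (card_le_two_mul_card_image_sym2 _).trans (Nat.mul_le_mul_left 2 (card_le_card ?_))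
  intro e he
  obtain ⟨p, hp, rfl⟩ := mem_image.1 he
  exact (mem_filter.1 hp).2

/-- A rotation along an edge outside `gainEdges` leads to an end, and to a path with few new ends
after one more rotation. -/
lemma rotation_of_notMem_gainEdges [DecidableRel G.Adj] {κ : ℕ} (hdeg : ∀ v, κ ≤ G.degree v)
    {Ps : List (List V)} (hPs : ∀ P ∈ Ps, P.Nodup ∧ ∀ v, v ∈ P) {X : List V} {u z : V} {Y : List V}
    {y : V} (hP : X ++ u :: z :: Y ∈ Ps) (hy : (z :: Y).getLast? = some y) (hadj : G.Adj y u)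
    (hgain : s(y, u) ∉ gainEdges G κ Ps) : z ∈ ends Ps ∧
      (pivotEnds G (X ++ u :: (z :: Y).reverse) \ ends Ps).card + (ends Ps).card <
        best G (ends Ps) Ps z + κ := by
  have hlt : score G ((X ++ u :: (z :: Y).reverse) :: Ps) < score G Ps + κ := by
    by_contra h
    rw [not_lt] at h
    exact hgain (mem_gainEdges.2 ⟨X, u, z, Y, y, hP, hy, hadj, rfl, h⟩)
  have hz := getLast?_rotation X u z Y
  obtain ⟨hnd, hfull⟩ := hPs _ hP
  have hperm := perm_rotation X u (z :: Y)
  by_cases hzT : z ∈ ends Ps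
  · refine ⟨hzT, ?_⟩
    have h1 := score_add_le_of_mem G hz hzT
    have h2 := card_sdiff_add_card (pivotEnds G (X ++ u :: (z :: Y).reverse)) (ends Ps)
    rw [union_comm] at h2
    omega
  -- A new end would raise the score by at least the minimum degree, hence by `κ`.
  · have h1 := score_add_le_of_notMem G hz hzT
    have h2 := degree_le_card_pivotEnds (G := G) (hperm.nodup_iff.2 hnd)
      (fun v => hperm.mem_iff.2 (hfull v)) hz
    have h3 := hdeg z
    omega

open Classical in
-- On a best path ending at `z`, one more rotation leads outside `ends Ps` only along a gain edge at
-- `z`.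
lemma best_le [DecidableRel G.Adj] {κ : ℕ} (hdeg : ∀ v, κ ≤ G.degree v)
    {Ps : List (List V)} (hPs : ∀ P ∈ Ps, P.Nodup ∧ ∀ v, v ∈ P) {z : V} (hz : z ∈ ends Ps) :
    best G (ends Ps) Ps z ≤
      (ends Ps).card + (univ.filter fun u => s(z, u) ∈ gainEdges G κ Ps).card := by
  obtain ⟨P, hP, hPz, hbest⟩ := exists_eq_best G (T := ends Ps) hz
  obtain ⟨hnd, hfull⟩ := hPs P hP
  rw [hbest, union_comm, ← card_sdiff_add_card, add_comm]
  refine Nat.add_le_add_left (card_le_card_of_injOn (prev P) ?_ ?_) _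
  · intro w hw
    obtain ⟨hw, hwT⟩ := mem_sdiff.1 hw
    obtain ⟨X, u, Y, y, rfl, hy, hadj⟩ := mem_pivotEnds.1 hw
    rw [getLast?_append_cons_cons, hy, Option.some.injEq] at hPz
    subst hPz
    rw [prev_eq hnd]
    simp only [coe_filter, mem_univ, true_and, Set.mem_ofPred_eq]
    by_contra h
    exact hwT (rotation_of_notMem_gainEdges hdeg hPs hP hy hadj h).1
  · have key : ∀ w ∈ pivotEnds G P \ ends Ps, 0 < P.idxOf w := by
      intro w hw
      obtain ⟨X, u, Y, y, rfl, -, -⟩ := mem_pivotEnds.1 (mem_sdiff.1 hw).1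
      rw [idxOf_append_cons_cons hnd]; omega
    intro w hw w' hw' h
    have h3 := congrArg P.idxOf h
    rw [idxOf_prev hnd (List.idxOf_lt_length_of_mem (hfull w)),
      idxOf_prev hnd (List.idxOf_lt_length_of_mem (hfull w'))] at h3
    have h4 := key w hw
    have h5 := key w' hw'
    exact eq_of_idxOf_eq hfull (by omega)

/-- If the score is increased by few rotations only, then there is a path most of whose rotations
have few new ends after one more rotation. -/
lemma exists_typical_path [DecidableRel G.Adj] {κ d : ℕ} (hκ : 0 < κ) (hκd : κ ≤ d)
    (hdeg : ∀ v, d ≤ G.degree v) {Ps : List (List V)} (hPs : ∀ P ∈ Ps, P.Nodup ∧ ∀ v, v ∈ P)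
    (hT : κ < (ends Ps).card) (hgain : 2 * (gainEdges G κ Ps).card ≤ κ * κ) :
    ∃ P : List V, P.Nodup ∧ (∀ v, v ∈ P) ∧ ∃ T ⊆ ends Ps, d ≤ T.card + 2 * κ ∧
      ∀ z ∈ T, ∃ X u Y, P = X ++ u :: z :: Y ∧
        (pivotEnds G (X ++ u :: (z :: Y).reverse) \ ends Ps).card ≤ 2 * κ := by
  classical
  have hdeg' : ∀ v, κ ≤ G.degree v := fun v => hκd.trans (hdeg v)
  set a : V → ℕ := fun z => (univ.filter fun u => s(z, u) ∈ gainEdges G κ Ps).card with ha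
  -- At most `κ` ends lie on `κ` or more gain edges. The path is chosen to end at some other `y`;
  -- `T` consists of the successors of neighbours of `y`, where gain edges at `y` and successors in
  -- `B` are left out, a loss of at most `κ` each.
  set B := (ends Ps).filter fun z => κ ≤ a z with hB
  have hBc : B.card ≤ κ := by
    have h1 := card_nsmul_le_sum B a κ fun z hz => (mem_filter.1 hz).2
    have h2 := sum_card_filter_le (gainEdges G κ Ps) B
    rw [smul_eq_mul] at h1
    exact Nat.le_of_mul_le_mul_right (h1.trans (h2.trans hgain)) hκ
  obtain ⟨y, hy, hyB⟩ := exists_mem_notMem_of_card_lt_card (hBc.trans_lt hT)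
  have hya : a y < κ := by
    by_contra h
    exact hyB (mem_filter.2 ⟨hy, not_lt.1 h⟩)
  obtain ⟨P, hP, hPy⟩ := mem_ends.1 hy
  obtain ⟨hnd, hfull⟩ := hPs P hP
  have hgood : ∀ u, G.Adj y u → s(y, u) ∉ gainEdges G κ Ps →
      ∃ X Y, P = X ++ u :: next P u :: Y ∧ next P u ∈ ends Ps ∧
        (pivotEnds G (X ++ u :: (next P u :: Y).reverse) \ ends Ps).card + (ends Ps).card <
        best G (ends Ps) Ps (next P u) + κ := by
    intro u hadj hu
    obtain ⟨X, u', Y, y', hPe, hy', hadj'⟩ :=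
      mem_pivotEnds.1 (next_mem_pivotEnds hnd hfull hPy hadj).1
    have huu' : u' = u := by
      have h1 : P.idxOf (next P u) = X.length + 1 := by
        generalize next P u = w at hPe
        subst hPe
        exact idxOf_append_cons_cons hnd
      have h2 : P.idxOf u' = X.length := by
        generalize next P u = w at hPe
        subst hPe
        exact idxOf_append_cons hnd
      have h3 := idxOf_next hnd (next_mem_pivotEnds hnd hfull hPy hadj).2
      exact eq_of_idxOf_eq hfull (by omega)
    subst huu'
    have hyy' : y' = y := by
      rw [hPe, getLast?_append_cons_cons, hy', Option.some.injEq] at hPy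
      exact hPy
    subst hyy'
    exact ⟨X, Y, hPe, rotation_of_notMem_gainEdges hdeg' hPs (hPe ▸ hP) hy' hadj hu⟩
  set D := (G.neighborFinset y).filter fun u => s(y, u) ∉ gainEdges G κ Ps with hD
  have hDc : d ≤ D.card + κ := by
    have h1 : D.card + ((G.neighborFinset y).filter fun u => ¬ s(y, u) ∉ gainEdges G κ Ps).card =
      (G.neighborFinset y).card := card_filter_add_card_filter_not _
    have h2 : ((G.neighborFinset y).filter fun u => ¬ s(y, u) ∉ gainEdges G κ Ps).card ≤ a y :=
      card_le_card fun u hu => mem_filter.2 ⟨mem_univ _, not_not.1 (mem_filter.1 hu).2⟩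
    have h3 := hdeg y
    rw [← G.card_neighborFinset_eq_degree] at h3
    omega
  have hDmem : ∀ u ∈ D, G.Adj y u ∧ s(y, u) ∉ gainEdges G κ Ps := fun u hu => by
    simpa [hD] using hu
  refine ⟨P, hnd, hfull, D.image (next P) \ B, ?_, ?_, ?_⟩
  · intro z hz
    obtain ⟨u, hu, rfl⟩ := mem_image.1 (mem_sdiff.1 hz).1
    obtain ⟨X, Y, _, h, _⟩ := hgood u (hDmem u hu).1 (hDmem u hu).2
    exact h
  · have h1 : (D.image (next P)).card = D.card := by
      refine card_image_of_injOn fun u hu v hv h => ?_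
      have h1 := (next_mem_pivotEnds hnd hfull hPy (hDmem u hu).1).2
      have h2 := (next_mem_pivotEnds hnd hfull hPy (hDmem v hv).1).2
      have h3 := congrArg P.idxOf h
      rw [idxOf_next hnd h1, idxOf_next hnd h2] at h3
      exact eq_of_idxOf_eq hfull (by omega)
    have h2 := le_card_sdiff B (D.image (next P))
    omega
  · intro z hz
    obtain ⟨hz, hzB⟩ := mem_sdiff.1 hz
    obtain ⟨u, hu, rfl⟩ := mem_image.1 hz
    obtain ⟨X, Y, hPe, hzT, h⟩ := hgood u (hDmem u hu).1 (hDmem u hu).2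
    refine ⟨X, u, Y, hPe, ?_⟩
    have h1 := best_le hdeg' hPs hzT
    have h2 : a (next P u) < κ := by
      by_contra h
      exact hzB (mem_filter.2 ⟨hzT, not_lt.1 h⟩)
    simp only [ha] at h2
    omega

/-- Successors of vertices before `z` have positions up to that of `z`, predecessors of vertices
after `z` have positions from it on. So only `z` can be counted twice. -/
lemma card_filter_next_or_prev_le {P : List V} (hP : P.Nodup) (hfull : ∀ v, v ∈ P) (T : Finset V)
    (z : V) : (univ.filter fun w => P.idxOf w < P.idxOf z ∧ next P w ∈ T ∨
      P.idxOf z < P.idxOf w ∧ prev P w ∈ T).card ≤ T.card + 1 := by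
  have hlt : ∀ v, P.idxOf v < P.length := fun v => List.idxOf_lt_length_of_mem (hfull v)
  have h1 : (univ.filter fun w => P.idxOf w < P.idxOf z ∧ next P w ∈ T).card ≤
      (T.filter fun w => P.idxOf w ≤ P.idxOf z).card := by
    have key : ∀ w, P.idxOf w < P.idxOf z → P.idxOf (next P w) = P.idxOf w + 1 :=
      fun w hw => idxOf_next hP (by have := hlt z; omega)
    refine card_le_card_of_injOn (next P) (fun w hw => ?_) fun w hw w' hw' h => ?_
    · simp only [coe_filter, mem_univ, true_and, Set.mem_ofPred_eq] at hw ⊢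
      exact ⟨hw.2, by rw [key w hw.1]; exact hw.1⟩
    · simp only [coe_filter, mem_univ, true_and, Set.mem_ofPred_eq] at hw hw'
      have h3 := congrArg P.idxOf h
      rw [key w hw.1, key w' hw'.1] at h3
      exact eq_of_idxOf_eq hfull (by omega)
  have h2 : (univ.filter fun w => P.idxOf z < P.idxOf w ∧ prev P w ∈ T).card ≤
      (T.filter fun w => P.idxOf z ≤ P.idxOf w).card := by
    refine card_le_card_of_injOn (prev P) (fun w hw => ?_) fun w hw w' hw' h => ?_
    · simp only [coe_filter, mem_univ, true_and, Set.mem_ofPred_eq] at hw ⊢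
      exact ⟨hw.2, by rw [idxOf_prev hP (hlt w)]; omega⟩
    · simp only [coe_filter, mem_univ, true_and, Set.mem_ofPred_eq] at hw hw'
      have h3 := congrArg P.idxOf h
      rw [idxOf_prev hP (hlt w), idxOf_prev hP (hlt w')] at h3
      exact eq_of_idxOf_eq hfull (by omega)
  have h3 := card_union_add_card_inter (T.filter fun w => P.idxOf w ≤ P.idxOf z)
    (T.filter fun w => P.idxOf z ≤ P.idxOf w)
  have h4 : ((T.filter fun w => P.idxOf w ≤ P.idxOf z) ∪
      (T.filter fun w => P.idxOf z ≤ P.idxOf w)).card ≤ T.card :=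
    card_le_card (union_subset (filter_subset _ _) (filter_subset _ _))
  have h5 : ((T.filter fun w => P.idxOf w ≤ P.idxOf z) ∩
      (T.filter fun w => P.idxOf z ≤ P.idxOf w)).card ≤ 1 := by
    rw [card_le_one]
    have key : ∀ a ∈ (T.filter fun w => P.idxOf w ≤ P.idxOf z) ∩
        (T.filter fun w => P.idxOf z ≤ P.idxOf w), a = z := by
      intro a ha
      simp only [mem_inter, mem_filter] at ha
      exact eq_of_idxOf_eq hfull (by omega)
    exact fun a ha b hb => (key a ha).trans (key b hb).symm
  rw [filter_or]
  have h6 := card_union_le (univ.filter fun w => P.idxOf w < P.idxOf z ∧ next P w ∈ T)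
    (univ.filter fun w => P.idxOf z < P.idxOf w ∧ prev P w ∈ T)
  omega

/-- The rotated path ends at `z`. Rotating it at `w` makes the successor of `w` on it an end: this
is the old successor if `w` lies in the unchanged part `X`, and the old predecessor if `w` lies in
the reversed part. -/
lemma next_or_prev_mem_pivotEnds {X : List V} {u z : V} {Y : List V}
    (hP : (X ++ u :: z :: Y).Nodup) (hfull : ∀ v, v ∈ X ++ u :: z :: Y) {w : V} (hadj : G.Adj z w)
    (hwu : w ≠ u) :
    ((X ++ u :: z :: Y).idxOf w < X.length ∧
      next (X ++ u :: z :: Y) w ∈ pivotEnds G (X ++ u :: (z :: Y).reverse)) ∨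
    (X.length + 1 < (X ++ u :: z :: Y).idxOf w ∧
      prev (X ++ u :: z :: Y) w ∈ pivotEnds G (X ++ u :: (z :: Y).reverse)) := by
  have hw := hfull w
  simp only [List.mem_append, List.mem_cons, hwu, hadj.ne', false_or] at hw
  rcases hw with hw | hw
  · left
    obtain ⟨X₁, X₂, rfl⟩ := List.append_of_mem hw
    obtain ⟨s, S, hs⟩ : ∃ s S, X₂ ++ [u] = s :: S := by cases X₂ <;> simp
    have h1 : (X₁ ++ w :: X₂) ++ u :: z :: Y = X₁ ++ w :: s :: (S ++ z :: Y) := by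
      rw [← List.cons_append, ← hs]; simp
    have h2 : (X₁ ++ w :: X₂) ++ u :: (z :: Y).reverse =
        X₁ ++ w :: s :: (S ++ (z :: Y).reverse) := by
      rw [← List.cons_append, ← hs]; simp
    rw [h2]
    rw [h1] at hP ⊢
    rw [next_eq hP, idxOf_append_cons hP]
    refine ⟨by simp, mem_pivotEnds.2 ⟨X₁, w, _, z, rfl, ?_, hadj⟩⟩
    simp [List.getLast?_append, List.getLast?_cons]
  · right
    obtain ⟨Y₁, Y₂, rfl⟩ := List.append_of_mem hw
    obtain ⟨Q, s, hs⟩ : ∃ Q s, z :: Y₁ = Q ++ [s] := by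
      rcases (z :: Y₁).eq_nil_or_concat with h | ⟨Q, s, h⟩
      · simp at h
      · exact ⟨Q, s, by simpa using h⟩
    have hs' : z :: (Y₁ ++ w :: Y₂) = Q ++ s :: w :: Y₂ := by
      rw [← List.cons_append, hs]; simp
    have h1 : X ++ u :: z :: (Y₁ ++ w :: Y₂) = (X ++ u :: Q) ++ s :: w :: Y₂ := by
      rw [hs']; simp
    have h2 : X ++ u :: (z :: (Y₁ ++ w :: Y₂)).reverse =
        (X ++ u :: Y₂.reverse) ++ w :: s :: Q.reverse := by
      rw [hs']; simp
    rw [h2]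
    rw [h1] at hP ⊢
    rw [prev_eq hP, idxOf_append_cons_cons hP]
    refine ⟨by simp, mem_pivotEnds.2 ⟨_, w, _, z, rfl, ?_, hadj⟩⟩
    have h3 : s :: Q.reverse = (z :: Y₁).reverse := by rw [hs]; simp
    rw [h3]; simp

/-- A neighbour of `z` not predicted by `T` yields an end outside `T`, different neighbours yielding
different ends. The extra `1` accounts for `u`, the predecessor of `z`. -/
lemma card_neighborFinset_sdiff_le [DecidableRel G.Adj] {X : List V} {u z : V} {Y : List V}
    (hP : (X ++ u :: z :: Y).Nodup) (hfull : ∀ v, v ∈ X ++ u :: z :: Y) (T : Finset V) :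
    (G.neighborFinset z \ univ.filter fun w =>
      (X ++ u :: z :: Y).idxOf w < (X ++ u :: z :: Y).idxOf z ∧ next (X ++ u :: z :: Y) w ∈ T ∨
      (X ++ u :: z :: Y).idxOf z < (X ++ u :: z :: Y).idxOf w ∧
        prev (X ++ u :: z :: Y) w ∈ T).card ≤
      (pivotEnds G (X ++ u :: (z :: Y).reverse) \ T).card + 1 := by
  set R := univ.filter fun w =>
      (X ++ u :: z :: Y).idxOf w < (X ++ u :: z :: Y).idxOf z ∧ next (X ++ u :: z :: Y) w ∈ T ∨
      (X ++ u :: z :: Y).idxOf z < (X ++ u :: z :: Y).idxOf w ∧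
        prev (X ++ u :: z :: Y) w ∈ T with hR
  have hz : (X ++ u :: z :: Y).idxOf z = X.length + 1 := idxOf_append_cons_cons hP
  have hlt : ∀ v, (X ++ u :: z :: Y).idxOf v < (X ++ u :: z :: Y).length :=
    fun v => List.idxOf_lt_length_of_mem (hfull v)
  have key : ((G.neighborFinset z \ R).erase u).card ≤
      (pivotEnds G (X ++ u :: (z :: Y).reverse) \ T).card := by
    have hmem : ∀ w ∈ (G.neighborFinset z \ R).erase u,
        ((X ++ u :: z :: Y).idxOf w < X.length ∧ next (X ++ u :: z :: Y) w ∈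
          pivotEnds G (X ++ u :: (z :: Y).reverse) \ T) ∨
        (X.length + 1 < (X ++ u :: z :: Y).idxOf w ∧ prev (X ++ u :: z :: Y) w ∈
          pivotEnds G (X ++ u :: (z :: Y).reverse) \ T) := by
      intro w hw
      simp only [mem_erase, mem_sdiff, SimpleGraph.mem_neighborFinset, hR, mem_filter, mem_univ,
        true_and, not_or, not_and, hz] at hw
      rcases next_or_prev_mem_pivotEnds hP hfull hw.2.1 hw.1 with h | h
      · exact Or.inl ⟨h.1, mem_sdiff.2 ⟨h.2, hw.2.2.1 (by omega)⟩⟩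
      · exact Or.inr ⟨h.1, mem_sdiff.2 ⟨h.2, hw.2.2.2 h.1⟩⟩
    refine card_le_card_of_injOn (fun w => if (X ++ u :: z :: Y).idxOf w < X.length then
      next (X ++ u :: z :: Y) w else prev (X ++ u :: z :: Y) w) (fun w hw => ?_)
      fun w hw w' hw' h => ?_
    · rcases hmem w hw with h | h
      · simp only [h.1, if_true]; exact h.2
      · simp only [show ¬ (X ++ u :: z :: Y).idxOf w < X.length by omega, if_false]; exact h.2
    · have hidx : ∀ w ∈ (G.neighborFinset z \ R).erase u,
          (X ++ u :: z :: Y).idxOf (if (X ++ u :: z :: Y).idxOf w < X.length then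
            next (X ++ u :: z :: Y) w else prev (X ++ u :: z :: Y) w) =
          if (X ++ u :: z :: Y).idxOf w < X.length then (X ++ u :: z :: Y).idxOf w + 1
          else (X ++ u :: z :: Y).idxOf w - 1 := by
        intro w hw
        split_ifs with h
        · refine idxOf_next hP ?_
          simp only [List.length_append, List.length_cons]; omega
        · exact idxOf_prev hP (hlt w)
      have h3 := congrArg (X ++ u :: z :: Y).idxOf h
      simp only at h3
      rw [hidx w hw, hidx w' hw'] at h3
      refine eq_of_idxOf_eq hfull ?_
      rcases hmem w hw with h1 | h1 <;> rcases hmem w' hw' with h2 | h2 <;> split_ifs at h3 <;>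
        omega
  have := pred_card_le_card_erase (s := G.neighborFinset z \ R) (a := u)
  omega

end Positions

/-! ### Graphs without extremal cuts -/

section NonExtremal

variable {n : ℕ} {G : SimpleGraph (Fin n)} [DecidableRel G.Adj]

/-- If the score of a sequence of rotations is maximal, then so is its set of ends. -/
lemma ends_subset_of_score_lt {κ : ℕ} (hdeg : ∀ v, κ ≤ G.degree v) {R : Fin n → Fin n → Prop}
    {P₀ : List (Fin n)} (h₀ : P₀.Nodup) (h₀' : ∀ v, v ∈ P₀) {τ : List (ℕ × ℕ)} {i j : ℕ}
    (hv : Valid R P₀ ((i, j) :: τ))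
    (hlt : score G (eval P₀ ((i, j) :: τ)) < score G (eval P₀ τ) + κ) :
    ends (eval P₀ ((i, j) :: τ)) ⊆ ends (eval P₀ τ) := by
  obtain ⟨hτ, X, u, z, Y, y, hi, rfl, hy, hR⟩ := hv
  rw [eval_cons_of_valid hi] at hlt ⊢
  rw [ends_cons_rot]
  refine insert_subset ?_ Subset.rfl
  by_contra hz
  obtain ⟨hnd, hfull⟩ := hτ.nodup_and_full h₀ h₀' _ (List.mem_of_getElem? hi)
  have hperm := perm_rotation X u (z :: Y)
  have h1 := score_add_le_of_notMem G (getLast?_rotation X u z Y) hz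
  have h2 := degree_le_card_pivotEnds (G := G) (hperm.nodup_iff.2 hnd)
    (fun v => hperm.mem_iff.2 (hfull v)) (getLast?_rotation X u z Y)
  have h3 := hdeg z
  omega

/-- A sequence of rotations of maximal score has many more than `n / 2` ends, unless there is a
very sparse or a very dense balanced cut. -/
lemma card_ends_or_extremal_cut {κ k : ℕ} {γ : ℝ} (hκ : 0 < κ) (hκk : κ ≤ k) (hκn : 2 * κ ≤ n)
    (hκγ : (κ : ℝ) ≤ γ * n) (hγ : γ ≤ 1 / 24000) (hγn : 1 ≤ γ * n)
    (hdeg : ∀ v, n ≤ 2 * G.degree v) {H : Finset (Sym2 (Fin n))}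
    (hexp : ∀ U W : Finset (Fin n), U.Nonempty → U.card ≤ k → W.card ≤ 3 * U.card →
      ∃ y ∈ U, ∃ u, u ∉ W ∧ G.Adj y u ∧ s(y, u) ∈ H)
    {P₀ : List (Fin n)} (h₀ : P₀.Nodup) (h₀' : ∀ v, v ∈ P₀) {τ : List (ℕ × ℕ)}
    (hτ : Valid (fun y u => G.Adj y u ∧ s(y, u) ∈ H) P₀ τ)
    (hmax : ∀ i j, Valid (fun y u => G.Adj y u ∧ s(y, u) ∈ H) P₀ ((i, j) :: τ) →
      score G (eval P₀ ((i, j) :: τ)) < score G (eval P₀ τ) + κ)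
    (hgain : 2 * (gainEdges G κ (eval P₀ τ)).card ≤ κ * κ) :
    (1 / 2 + γ) * n ≤ (ends (eval P₀ τ)).card ∨ ∃ T : Finset (Fin n),
      (1 / 2 - 4 * γ) * n ≤ T.card ∧ (T.card : ℝ) ≤ (1 / 2 + 4 * γ) * n ∧
      ((cutSize G T : ℝ) ≤ 2048 * γ * n ^ 2 ∨ (n : ℝ) ^ 2 / 4 - 2048 * γ * n ^ 2 ≤ cutSize G T) := by
  classical
  have hn : 0 < n := by omega
  have hκdeg : ∀ v, κ ≤ G.degree v := fun v => by have := hdeg v; omega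
  -- Expansion and Pósa's lemma supply the more than `κ` ends from which a typical path is chosen.
  have hends : k < (ends (eval P₀ τ)).card := by
    by_contra hk
    rw [not_lt] at hk
    have hne : (ends (eval P₀ τ)).Nonempty := by
      have hP₀ : P₀ ≠ [] := fun h => by simpa [h] using h₀' ⟨0, hn⟩
      exact ⟨P₀.getLast hP₀, mem_ends.2 ⟨P₀, mem_eval_self P₀ τ, List.getLast?_eq_some_getLast hP₀⟩⟩
    obtain ⟨y, hy, u, hu, hadj, hH⟩ := hexp _
      (ends (eval P₀ τ) ∪ pathNbrs P₀ (ends (eval P₀ τ))) hne hk (by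
        have h1 := card_union_le (ends (eval P₀ τ)) (pathNbrs P₀ (ends (eval P₀ τ)))
        have h2 := card_pathNbrs_le h₀ (ends (eval P₀ τ))
        omega)
    exact hu (posa h₀' hτ (fun i j hv => ends_subset_of_score_lt hκdeg h₀ h₀' hv (hmax i j hv))
      hy ⟨hadj, hH⟩)
  by_cases hbig : (1 / 2 + γ) * n ≤ (ends (eval P₀ τ)).card
  · exact Or.inl hbig
  rw [not_le] at hbig
  right
  obtain ⟨P, hnd, hfull, T, hTsub, hTc, hT⟩ := exists_typical_path hκ
    (by omega : κ ≤ (n + 1) / 2) (fun v => by have := hdeg v; omega)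
    (hτ.nodup_and_full h₀ h₀') (by omega) hgain
  have hTle : (T.card : ℝ) ≤ (ends (eval P₀ τ)).card := by exact_mod_cast card_le_card hTsub
  have hTc' : (n : ℝ) ≤ 2 * T.card + 4 * κ := by
    have : n ≤ 2 * T.card + 4 * κ := by omega
    exact_mod_cast this
  refine ⟨T, by linarith, by linarith, ?_⟩
  have := sparse_or_large_cut (G := G) (pos := P.idxOf) (fun _ _ h => eq_of_idxOf_eq hfull h)
    (fun w => next P w ∈ ends (eval P₀ τ)) (fun w => prev P w ∈ ends (eval P₀ τ)) (θ := 4 * γ)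
    (by linarith) (by linarith) hdeg (T := T) (by linarith) (by linarith)
    (R := fun z => univ.filter fun w => P.idxOf w < P.idxOf z ∧ next P w ∈ ends (eval P₀ τ) ∨
      P.idxOf z < P.idxOf w ∧ prev P w ∈ ends (eval P₀ τ)) (by simp) ?_ ?_
  · rcases this with h | h
    · left; linarith
    · right; linarith
  · intro z _
    have h1 := card_filter_next_or_prev_le hnd hfull (ends (eval P₀ τ)) z
    have h2 : ((univ.filter fun w => P.idxOf w < P.idxOf z ∧ next P w ∈ ends (eval P₀ τ) ∨
      P.idxOf z < P.idxOf w ∧ prev P w ∈ ends (eval P₀ τ)).card : ℝ) ≤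
        (ends (eval P₀ τ)).card + 1 := by exact_mod_cast h1
    linarith
  · intro z hz
    obtain ⟨X, u, Y, rfl, hXY⟩ := hT z hz
    have h1 := (card_neighborFinset_sdiff_le (G := G) hnd hfull (ends (eval P₀ τ))).trans
      (Nat.add_le_add_right hXY 1)
    refine le_trans (Nat.cast_le.2 h1) ?_
    push_cast
    linarith

/-- The frame of all Hamilton cycles. -/
def completeFrame (V : Type*) : Frame V where
  adm := Set.univ
  forced := ∅
  trans _ _ _ _ _ _ _ := trivial

lemma isPath_completeFrame_iff {V : Type*} {P : List V} :
    (completeFrame V).IsPath P ↔ P.Nodup ∧ ∀ v, v ∈ P :=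
  ⟨fun h => ⟨h.nodup, h.full⟩, fun h => ⟨h.1, h.2, fun _ _ => Or.inl trivial,
    fun e he => absurd he (notMem_empty e), fun _ _ _ _ => trivial⟩⟩

open Classical in
/-- If each linked vertex is linked to many more than `n / 2` vertices, then there are many linked
pairs of adjacent vertices. -/
lemma exists_linked_adj {F : Frame (Fin n)} {H : Finset (Sym2 (Fin n))} {γ : ℝ} (hγ : 0 ≤ γ)
    (hdeg : ∀ v, n ≤ 2 * G.degree v)
    (hlink : ∀ x y, F.Linked H x y →
      (1 / 2 + γ) * n ≤ (univ.filter fun z => F.Linked H x z).card) {x y : Fin n}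
    (hxy : F.Linked H x y) : ∃ D : Finset (Fin n × Fin n),
      (∀ p ∈ D, F.Linked H p.1 p.2 ∧ G.Adj p.1 p.2) ∧ γ / 2 * n ^ 2 ≤ D.card := by
  refine ⟨univ.filter fun p => F.Linked H p.1 p.2 ∧ G.Adj p.1 p.2, by simp, ?_⟩
  set L := univ.filter fun z => F.Linked H x z with hL
  -- At least `n / 2` neighbours of `z` and `(1/2 + γ) n` vertices linked to `z` have `γ n` vertices
  -- in common.
  have h1 : ∀ z ∈ L, γ * n ≤
      ((univ.filter fun w => F.Linked H z w ∧ G.Adj z w).card : ℝ) := by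
    intro z hz
    have h2 := hlink z x (mem_filter.1 hz).2.symm
    have h3 := card_union_add_card_inter (univ.filter fun w => F.Linked H z w) (G.neighborFinset z)
    have h4 : ((univ.filter fun w => F.Linked H z w) ∪ G.neighborFinset z).card ≤ n := by
      simpa using card_le_univ ((univ.filter fun w => F.Linked H z w) ∪ G.neighborFinset z)
    have h5 : (univ.filter fun w => F.Linked H z w) ∩ G.neighborFinset z =
        univ.filter fun w => F.Linked H z w ∧ G.Adj z w := by ext w; simp
    have h6 := hdeg z
    rw [← G.card_neighborFinset_eq_degree] at h6
    rw [h5] at h3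
    have h7 : 2 * (univ.filter fun w => F.Linked H z w).card ≤
        n + 2 * (univ.filter fun w => F.Linked H z w ∧ G.Adj z w).card := by omega
    have h8 : (2 : ℝ) * (univ.filter fun w => F.Linked H z w).card ≤
        n + 2 * (univ.filter fun w => F.Linked H z w ∧ G.Adj z w).card := by exact_mod_cast h7
    linarith
  have h2 : ∑ z ∈ L, (univ.filter fun w => F.Linked H z w ∧ G.Adj z w).card ≤
      (univ.filter fun p : Fin n × Fin n => F.Linked H p.1 p.2 ∧ G.Adj p.1 p.2).card := by
    rw [← card_sigma]
    refine card_le_card_of_injOn (fun p => (p.1, p.2)) ?_ ?_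
    · rintro ⟨a, b⟩ h
      simp only [coe_sigma, Set.mem_sigma_iff, mem_coe, mem_filter, mem_univ, true_and] at h
      simpa using h.2
    · rintro ⟨a, b⟩ _ ⟨c, d⟩ _ h
      simp only [Prod.mk.injEq] at h
      obtain ⟨rfl, rfl⟩ := h; rfl
  have h3 := card_nsmul_le_sum L _ _ h1
  rw [nsmul_eq_mul] at h3
  have h4 : (∑ z ∈ L, ((univ.filter fun w => F.Linked H z w ∧ G.Adj z w).card : ℝ)) ≤
      (univ.filter fun p : Fin n × Fin n => F.Linked H p.1 p.2 ∧ G.Adj p.1 p.2).card := by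
    exact_mod_cast h2
  have h5 := hlink x y hxy
  have hn : (0 : ℝ) ≤ n := by positivity
  calc γ / 2 * (n : ℝ) ^ 2 = 1 / 2 * n * (γ * n) := by ring
    _ ≤ L.card * (γ * n) := by
        gcongr
        refine le_trans ?_ h5
        gcongr; linarith
    _ ≤ _ := h3.trans h4

/-- Graphs of large minimum degree without extremal cuts are robust. -/
theorem robust_of_no_extremal_cut (hn : 2 ^ 100 ≤ n) (hdeg : ∀ v, n ≤ 2 * G.degree v)
    (hsparse : ∀ T : Finset (Fin n), n ≤ 3 * T.card → 3 * T.card ≤ 2 * n →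
      ¬ (cutSize G T : ℝ) ≤ 1 / 2 ^ 18 * n ^ 2)
    (hlarge : ∀ T : Finset (Fin n), ¬ (n : ℝ) ^ 2 / 4 - (1 / 2 ^ 37) ^ 2 * n ^ 2 ≤ cutSize G T)
    {C : ℝ} (hC : 2 ^ 91 * 2 ^ 174 ≤ C) : Robust G C (1 / 2 ^ 90) := by
  have hn0 : (2 ^ 100 : ℝ) ≤ n := by exact_mod_cast hn
  have hn2 : (0 : ℝ) ≤ (n : ℝ) ^ 2 := by positivity
  have hC0 : 0 ≤ C := le_trans (by positivity) hC
  -- With `γ = 2 ^ (-86)` the threshold `2048 γ = 2 ^ (-75)` for extremal cuts lies below both `2 ^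
  -- (-18)` and `(2 ^ (-37))²`.
  set κ := n / 2 ^ 86 with hκ
  have hκ1 : n ≤ 2 ^ 87 * κ := by omega
  have hκ2 : 2 ^ 86 * κ ≤ n := by omega
  have hκ1' : (n : ℝ) ≤ 2 ^ 87 * κ := by exact_mod_cast hκ1
  have hκ2' : (2 ^ 86 : ℝ) * κ ≤ n := by exact_mod_cast hκ2
  obtain ⟨F₁, hF₁E, hF₁w, hF₁⟩ := exists_expansion_family (by omega) G (Γ := G.Adj)
    (fun _ _ h => h) (d := n / 2) (k := n / 64) (by omega)
    (fun y => ⟨G.neighborFinset y, by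
      rw [G.card_neighborFinset_eq_degree]; have := hdeg y; omega, by simp⟩) hC0 (by
      have h1 : n ≤ 4 * (n / 2) := by omega
      have h1' : (n : ℝ) ≤ 4 * ((n / 2 : ℕ) : ℝ) := by exact_mod_cast h1
      have h2 : (80 : ℝ) * ((n / 2 : ℕ) : ℝ) ≤ C * ((n / 2 : ℕ) : ℝ) := by
        gcongr
        exact le_trans (by norm_num) hC
      linarith)
  -- Both `ℓ` and `κ` are of order `n`, so this concerns `n ^ O(n)` sets of quadratic size.
  obtain ⟨F₂, hF₂E, hF₂w, hF₂⟩ := exists_rotation_family (by omega) G (κ := κ) (ℓ := 2 ^ 87 * n)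
    (a := (κ : ℝ) ^ 2 / 2) (C := C) (by omega)
    (by
      calc n * n ≤ 2 ^ 87 * κ * n := Nat.mul_le_mul_right n hκ1
        _ = _ := by ring)
    (by
      calc 2 ^ 87 * n + 1 ≤ 2 ^ 100 * n := by omega
        _ ≤ n * n := Nat.mul_le_mul_right n hn
        _ = n ^ 2 := by ring) hC0
    (by
      have h1 : n + 2 + 3 * (2 ^ 87 * n) + 1 ≤ 2 ^ 90 * n := by omega
      have h1' : (((n + 2 + 3 * (2 ^ 87 * n) : ℕ) : ℝ) + (1 : ℕ)) ≤ 2 ^ 90 * n := by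
        exact_mod_cast h1
      calc (((n + 2 + 3 * (2 ^ 87 * n) : ℕ) : ℝ) + (1 : ℕ)) * n ≤ 2 ^ 90 * n * n := by gcongr
        _ = 2 ^ 90 * (n * n) := by ring
        _ ≤ 2 ^ 90 * ((2 ^ 87 * κ) * (2 ^ 87 * κ)) :=
            mul_le_mul_of_nonneg_left (mul_self_le_mul_self (Nat.cast_nonneg n) hκ1') (by norm_num)
        _ = 2 ^ 91 * 2 ^ 174 * (κ ^ 2 / 2) := by ring
        _ ≤ C * (κ ^ 2 / 2) := mul_le_mul_of_nonneg_right hC (by positivity))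
  refine ⟨?_, F₁ ∪ F₂, ?_, ?_, ?_⟩
  · refine le_trans ?_ (sq_le_card_edgeFinset hdeg)
    linarith
  · intro Y hY
    rcases mem_union.1 hY with hY | hY
    · exact hF₁E Y hY
    · exact hF₂E Y hY
  · refine (weight_union_le C F₁ F₂).trans ?_
    have : (n : ℝ)⁻¹ ≤ (2 ^ 100)⁻¹ := by gcongr
    norm_num at this
    linarith
  · intro M hME hM
    refine ⟨(completeFrame (Fin n)).deficit, isBoosterMeasure_deficit (by omega) G
      ⟨List.finRange n, isPath_completeFrame_iff.2 ⟨List.nodup_finRange n, List.mem_finRange⟩⟩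
      (empty_subset _) fun H hMH x y hxy => ?_⟩
    classical
    have hlink : ∀ x y, (completeFrame (Fin n)).Linked H x y → (1 / 2 + 1 / 2 ^ 86) * (n : ℝ) ≤
        (univ.filter fun z => (completeFrame (Fin n)).Linked H x z).card := by
      rintro x y ⟨P₀, hP₀, hx, hy, hc⟩
      obtain ⟨τ, hτ, hmax, hgain⟩ := hF₂ M (fun Y hY => hM Y (mem_union_right _ hY)) H hMH P₀
        hP₀.nodup hP₀.full
      have hsub : ends (eval P₀ τ) ⊆
          univ.filter fun z => (completeFrame (Fin n)).Linked H x z := by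
        intro z hz
        obtain ⟨P, hP, hPz⟩ := mem_ends.1 hz
        obtain ⟨h1, h2, h3⟩ := Valid.induction (Q := fun P => (completeFrame (Fin n)).IsPath P ∧
          P.head? = some x ∧ cost H P < (completeFrame (Fin n)).deficit H) ⟨hP₀, hx, hc⟩ (by
            rintro X u z Y y ⟨h1, h2, h3⟩ hy ⟨_, hR⟩
            refine ⟨h1.rotate hy trivial fun e he => absurd he (notMem_empty e), ?_,
              (cost_rotate_le hy hR).trans_lt h3⟩
            cases X <;> simpa using h2) hτ P hP
        exact mem_filter.2 ⟨mem_univ z, P, h1, h2, hPz, h3⟩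
      refine le_trans ?_ (Nat.cast_le.2 (card_le_card hsub))
      rcases card_ends_or_extremal_cut (G := G) (κ := κ) (k := n / 64) (γ := 1 / 2 ^ 86) (H := H)
        (by omega) (by omega) (by omega) (by linarith) (by norm_num) (by linarith) hdeg
        (fun U W hU hUk hW => by
          obtain ⟨y, hy, u, hu, hadj, hyu⟩ := hF₁ M (fun Y hY => hM Y (mem_union_left _ hY))
            U W hU hUk (by omega)
          exact ⟨y, hy, u, hu, hadj, hMH hyu⟩) hP₀.nodup hP₀.full hτ hmax (by
            have h1 : (2 : ℝ) * (gainEdges G κ (eval P₀ τ)).card ≤ κ * κ := by linarith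
            exact_mod_cast h1) with h | ⟨T, h1, h2, h3 | h3⟩
      · exact h
      · refine absurd (h3.trans ?_) (hsparse T ?_ ?_)
        · norm_num; linarith
        · have : (n : ℝ) ≤ 3 * T.card := by norm_num at h1; linarith
          exact_mod_cast this
        · have : (3 : ℝ) * T.card ≤ 2 * n := by norm_num at h2; linarith
          exact_mod_cast this
      · refine absurd (le_trans ?_ h3) (hlarge T)
        norm_num; linarith
    obtain ⟨D, hD, hDc⟩ := exists_linked_adj (G := G) (γ := 1 / 2 ^ 86) (by positivity) hdeg hlink
      hxy
    refine ⟨D, hD, le_trans ?_ hDc⟩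
    norm_num
    linarith

end NonExtremal

/-! ### Combining the cases and choosing the constants -/

section Conclusion

lemma Robust.mono {n : ℕ} {G : SimpleGraph (Fin n)} [DecidableRel G.Adj] {C ε ε' : ℝ}
    (h : Robust G C ε) (hε : ε' ≤ ε) : Robust G C ε' := by
  have hle : ε' * (n : ℝ) ^ 2 ≤ ε * n ^ 2 := by gcongr
  obtain ⟨hE, F, hF, hw, hM⟩ := h
  refine ⟨hle.trans hE, F, hF, hw, fun M hME hMF => ?_⟩
  obtain ⟨t, ht, h⟩ := hM M hME hMF
  exact ⟨t, ht, fun H hMH hHE => ⟨(h H hMH hHE).1, fun h0 => hle.trans ((h H hMH hHE).2 h0)⟩⟩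

/-- All large graphs of minimum degree at least half of their order are robust. -/
lemma exists_robust : ∃ C ε : ℝ, 0 < C ∧ 0 < ε ∧ ∃ n₀ : ℕ, ∀ n, n₀ ≤ n →
    ∀ (G : SimpleGraph (Fin n)) [DecidableRel G.Adj], (∀ v, n ≤ 2 * G.degree v) →
      Robust G C ε := by
  have hlim : Filter.Tendsto (fun k : ℕ => (k : ℝ) * (0.8625 : ℝ) ^ k) Filter.atTop (nhds 0) :=
    tendsto_self_mul_const_pow_of_lt_one (by norm_num) (by norm_num)
  obtain ⟨K, hK⟩ := Filter.eventually_atTop.1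
    (hlim.eventually (gt_mem_nhds (by norm_num : (0 : ℝ) < 1 / 4096)))
  refine ⟨2 ^ 91 * 2 ^ 174, 1 / 2 ^ 90, by positivity, by positivity, 2 ^ 100 + 512 * K,
    fun n hn G _ hdeg => ?_⟩
  by_cases h1 : ∃ T : Finset (Fin n), n ≤ 3 * T.card ∧ 3 * T.card ≤ 2 * n ∧
      (cutSize G T : ℝ) ≤ 1 / 2 ^ 18 * n ^ 2
  · obtain ⟨T, hT, hT', hcut⟩ := h1
    exact (robust_of_sparse_cut (by omega) hdeg hT hT' hcut (by norm_num)).mono (by norm_num)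
  by_cases h2 : ∃ T : Finset (Fin n), (n : ℝ) ^ 2 / 4 - (1 / 2 ^ 37) ^ 2 * n ^ 2 ≤ cutSize G T
  · obtain ⟨T, hT⟩ := h2
    refine (robust_of_large_cut (by omega) hdeg (fun k hk => ?_) hT (by norm_num)).mono
      (by norm_num)
    have h3 := hK k (by omega)
    have h4 : (n : ℝ) ≤ 512 * k := by exact_mod_cast hk
    calc (n : ℝ) * (0.8625 : ℝ) ^ k ≤ 512 * k * (0.8625 : ℝ) ^ k := by gcongr
      _ = 512 * (k * (0.8625 : ℝ) ^ k) := by ring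
      _ ≤ 1 / 8 := by linarith
  · push Not at h1 h2
    exact robust_of_no_extremal_cut (by omega) hdeg (fun T hT hT' => not_le.2 (h1 T hT hT'))
      (fun T => not_le.2 (h2 T)) le_rfl

lemma le_two_mul_degree {n : ℕ} {G : SimpleGraph (Fin n)} [DecidableRel G.Adj]
    (h : (n : ℝ) / 2 ≤ G.minDegree) (v : Fin n) : n ≤ 2 * G.degree v := by
  have h1 : (G.minDegree : ℝ) ≤ G.degree v := by exact_mod_cast G.minDegree_le_degree v
  have h2 : (n : ℝ) ≤ 2 * G.degree v := by linarith
  exact_mod_cast h2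

lemma one_le_log {n : ℕ} (hn : 3 ≤ n) : 1 ≤ Real.log n := by
  have h : (3 : ℝ) ≤ n := by exact_mod_cast hn
  rw [Real.le_log_iff_exp_le (by linarith)]
  linarith [Real.exp_one_lt_d9]

/-- Maker wins with bias at most `c n / log n`. -/
lemma exists_makerWins : ∃ c : ℝ, 0 < c ∧
    ∀ n : ℕ, 3 ≤ n → ∀ (G : SimpleGraph (Fin n)) [DecidableRel G.Adj],
      (n : ℝ) / 2 ≤ (G.minDegree : ℝ) → ∀ b : ℕ, 1 ≤ b → (b : ℝ) ≤ c * n / Real.log n →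
        ∀ first : Player, MakerWinsHamiltonicity G b first := by
  obtain ⟨C, ε, hC, hε, n₀, hrob⟩ := exists_robust
  -- The last bound makes small `n` vacuous: `b ≥ 1` and `log n ≥ 1` give `c n ≥ 1`, hence `n > n₀`.
  refine ⟨min (1 / (8 * C)) (min (ε / (24 * C + 9)) (1 / (n₀ + 1))), by positivity,
    fun n hn G _ hdeg b hb hbc first => ?_⟩
  set c := min (1 / (8 * C)) (min (ε / (24 * C + 9)) (1 / ((n₀ : ℝ) + 1)))
  have hc0 : 0 < c := by positivity
  have hc1 : c * (8 * C) ≤ 1 := by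
    rw [← le_div_iff₀ (by positivity)]; exact min_le_left _ _
  have hc2 : c * (24 * C + 9) ≤ ε := by
    rw [← le_div_iff₀ (by positivity)]; exact (min_le_right _ _).trans (min_le_left _ _)
  have hc3 : c * (n₀ + 1) ≤ 1 := by
    rw [← le_div_iff₀ (by positivity)]; exact (min_le_right _ _).trans (min_le_right _ _)
  have hlog := one_le_log hn
  have hn0 : (0 : ℝ) < n := by positivity
  rw [le_div_iff₀ (by linarith)] at hbc
  have hb1 : (1 : ℝ) ≤ b := by exact_mod_cast hb
  have hcn : 1 ≤ c * n := by nlinarith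
  have hnn₀ : n₀ ≤ n := by
    have : c * (n₀ + 1) ≤ c * n := hc3.trans hcn
    have := le_of_mul_le_mul_left this hc0
    exact_mod_cast (by linarith : (n₀ : ℝ) ≤ n)
  refine makerWins_of_robust G hC hε hn (hrob n hnn₀ G (le_two_mul_degree hdeg)) hb ?_ ?_ first
  · calc (b : ℝ) * (8 * C * Real.log n) = b * Real.log n * (8 * C) := by ring
      _ ≤ c * n * (8 * C) := by gcongr
      _ = c * (8 * C) * n := by ring
      _ ≤ 1 * n := by gcongr
      _ = n := one_mul _
  · calc (b : ℝ) * ((24 * C + 8) * Real.log n) = b * Real.log n * (24 * C + 8) := by ring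
      _ ≤ c * n * (24 * C + 8) := by gcongr
      _ < c * n * (24 * C + 9) := by gcongr; norm_num
      _ = c * (24 * C + 9) * n := by ring
      _ ≤ ε * n := by gcongr

/-- The critical bias is of order `n / log n`. -/
lemma exists_isCriticalBias : ∃ c₁ c₂ : ℝ, 0 < c₁ ∧ 0 < c₂ ∧ ∃ n₀ : ℕ,
    ∀ n : ℕ, n₀ ≤ n → ∀ (G : SimpleGraph (Fin n)) [DecidableRel G.Adj],
      (n : ℝ) / 2 ≤ (G.minDegree : ℝ) → ∀ first : Player, ∃ b₀ : ℕ, IsCriticalBias G first b₀ ∧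
        c₁ * n / Real.log n ≤ (b₀ : ℝ) ∧ (b₀ : ℝ) ≤ c₂ * n / Real.log n := by
  obtain ⟨c, hc, hmaker⟩ := exists_makerWins
  refine ⟨c / 2, 32, by positivity, by norm_num, ?_⟩
  obtain ⟨N, hN⟩ := Filter.eventually_atTop.1
    (tendsto_natCast_atTop_atTop.eventually (Real.isLittleO_log_id_atTop.bound
      (by positivity : (0 : ℝ) < c / 2)))
  refine ⟨max (max 3 N) ⌈Real.exp 16 + 4⌉₊, fun n hn G _ hdeg first => ?_⟩
  have hn3 : 3 ≤ n := le_trans (le_trans (le_max_left _ _) (le_max_left _ _)) hn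
  have hnexp : Real.exp 16 + 4 ≤ n := Nat.ceil_le.1 ((le_max_right _ _).trans hn)
  have hlog := one_le_log hn3
  have hn0 : (0 : ℝ) < n := by positivity
  have hlogn : 2 ≤ c * n / Real.log n := by
    have h := hN n (le_trans (le_trans (le_max_right _ _) (le_max_left _ _)) hn)
    rw [Real.norm_of_nonneg (by linarith), id, Real.norm_of_nonneg hn0.le] at h
    rw [le_div_iff₀ (by linarith)]
    linarith
  have hE : G.edgeFinset.Nonempty := by
    rw [← card_pos]
    have h1 := sq_le_card_edgeFinset (le_two_mul_degree hdeg)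
    exact_mod_cast (by positivity : (0 : ℝ) < (n : ℝ) ^ 2 / 4).trans_le h1
  have hub : ∀ b : ℕ, MakerWinsHamiltonicity G b first → (b : ℝ) ≤ 32 * n / Real.log n := by
    intro b hb
    by_contra h
    exact not_makerWinsHamiltonicity G hnexp hE (not_le.1 h) first hb
  set S := {b : ℕ | MakerWinsHamiltonicity G b first} with hS
  have hbdd : BddAbove S := ⟨⌊32 * n / Real.log n⌋₊, fun b hb => Nat.le_floor (hub b hb)⟩
  -- As `c n / log n ≥ 2`, rounding down loses at most a factor of two.
  have hfloor := Nat.lt_floor_add_one (c * n / Real.log n)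
  have hmem : ⌊c * n / Real.log n⌋₊ ∈ S := by
    refine hmaker n hn3 G hdeg _ ?_ (Nat.floor_le (by positivity)) first
    exact Nat.le_floor (by push_cast; linarith)
  have hsup : sSup S ∈ S := Nat.sSup_mem ⟨_, hmem⟩ hbdd
  refine ⟨sSup S, ⟨hsup, fun b hb => le_csSup hbdd hb⟩, ?_, hub _ hsup⟩
  have h1 : ((⌊c * n / Real.log n⌋₊ : ℕ) : ℝ) ≤ (sSup S : ℕ) := by
    exact_mod_cast le_csSup hbdd hmem
  have h2 : c / 2 * n / Real.log n = c * n / Real.log n / 2 := by ring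
  rw [h2]
  linarith

end Conclusion

end MakerBreaker

theorem theorem1p2 :
    (∃ c : ℝ, 0 < c ∧
      ∀ n : ℕ, 3 ≤ n → ∀ (G : SimpleGraph (Fin n)) [DecidableRel G.Adj],
        (n : ℝ) / 2 ≤ (G.minDegree : ℝ) →
        ∀ b : ℕ, 1 ≤ b → (b : ℝ) ≤ c * n / Real.log n →
          ∀ first : MakerBreaker.Player, MakerBreaker.MakerWinsHamiltonicity G b first) ∧
    (∃ c₁ c₂ : ℝ, 0 < c₁ ∧ 0 < c₂ ∧ ∃ n₀ : ℕ,
      ∀ n : ℕ, n₀ ≤ n → ∀ (G : SimpleGraph (Fin n)) [DecidableRel G.Adj],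
        (n : ℝ) / 2 ≤ (G.minDegree : ℝ) →
        ∀ first : MakerBreaker.Player, ∃ b₀ : ℕ, MakerBreaker.IsCriticalBias G first b₀ ∧
          c₁ * n / Real.log n ≤ (b₀ : ℝ) ∧ (b₀ : ℝ) ≤ c₂ * n / Real.log n) :=
  ⟨MakerBreaker.exists_makerWins, MakerBreaker.exists_isCriticalBias⟩
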